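/- All graphs are finite and simple. For a graph $G$ and $S\subseteq V(G)$ let $\mathcal C$ be the set of connected components of $G-S$. The *vertex integrity* of $G$ is the smallest integer $p$ for which there is a set $S\subseteq V(G)$ with $|S|\le p$ and $|V(H)\cup S|\le p$ for every connected component $H$ of $G-S$; such an $S$ is said to witness it. Two components $H_0,H_1\in\mathcal C$ are *twin-blocks*, $H_0\sim H_1$, if there is an isomorphism $\alpha\colon H_0\to H_1$ such that $uv\in E(G)\Leftrightarrow\alpha(u)v\in E(G)$ for all $u\in V(H_0)$, $v\in S$. Let $f(p)=2^{7p^3}$. An induced subgraph $G'$ of $G$ is a *reduced graph* of $G$ (with respect to $S$) if it is obtained from $G$ by removing, from each class of $\sim$ that contains at least $f(p)$ components, all but $f(p)$ of its components, and removing nothing else. A *trigraph* is a graph whose edges are partitioned into black and red edges; a graph is a trigraph all of whose edges are black. The *contraction* of two distinct vertices $u,v$ replaces them by a new vertex $w$, with a black edge $wx$ whenever $xu$ and $xv$ are both black, and a red edge $wy$ whenever $yu$ or $yv$ is red or exactly one of $yu,yv$ is a black edge. A *contraction sequence* of $G$ is a sequence of trigraphs that starts with $G$, in which each trigraph arises from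 the previous one by one contraction, and that ends with a single-vertex graph. Its *width* is the maximum red degree over all vertices of all its trigraphs. **Lemma.** There is a polynomial-time algorithm (on $n$-vertex graphs, the number of steps is bounded by a fixed polynomial in $n$, independent of $p$ and $t$) for the following task. Given a graph $G$ of vertex integrity $p$, a set $S\subseteq V(G)$ witnessing this, a reduced graph $G'$ of $G$ with respect to $S$, and a contraction sequence $C'$ of $G'$ of width $t$, compute a contraction sequence of $G$ of width at most $2t$. -/

import Mathlib

/-! ### Vertex integrity, twin-blocks and reduced graphs -/

/-- The vertex sets of the connected components of `G - S`. -/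
def componentsOff {V : Type*} (G : SimpleGraph V) (S : Finset V) : Set (Set V) :=
  Set.range fun c : (G.induce ((S : Set V)ᶜ)).ConnectedComponent => Subtype.val '' c.supp

/-- `S` shows that the vertex integrity of `G` is at most `p`: `|V(H) ∪ S| ≤ p` for every component
`H` of `G - S`. The bound `|S| ≤ p` matters only when `G - S` has no component at all. -/
def IntegrityWitness {V : Type*} (G : SimpleGraph V) (S : Finset V) (p : ℕ) : Prop :=
  S.card ≤ p ∧ ∀ H ∈ componentsOff G S, (H ∪ (S : Set V)).ncard ≤ p

/-- The vertex integrity of a finite graph (the set below contains `|V|`, through `S = V`). -/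
noncomputable def vertexIntegrity {V : Type*} [Fintype V] (G : SimpleGraph V) : ℕ :=
  sInf {p | ∃ S : Finset V, IntegrityWitness G S p}

/-- `H₀` and `H₁` are twin-blocks: there is an isomorphism between the graphs that they induce
which respects adjacency to every vertex of `S`. -/
def TwinBlocks {V : Type*} (G : SimpleGraph V) (S : Finset V) (H₀ H₁ : Set V) : Prop :=
  ∃ α : G.induce H₀ ≃g G.induce H₁, ∀ u : H₀, ∀ v ∈ S, G.Adj u v ↔ G.Adj (α u) v

/-- The class of the component `H` under the twin-block relation. -/
def twinClass {V : Type*} (G : SimpleGraph V) (S : Finset V) (H : Set V) : Set (Set V) :=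
  {K | K ∈ componentsOff G S ∧ TwinBlocks G S H K}

/-- The threshold `f(p) = 2 ^ (7 p³)` for a class to be large. -/
def largeThreshold (p : ℕ) : ℕ := 2 ^ (7 * p ^ 3)

/-- `W` is the vertex set of an induced subgraph that arises from `G` by removing all but `f(p)`
twin-blocks from each large class (classes that are not large, and `S`, are kept entirely). -/
def IsReducedVertexSet {V : Type*} (G : SimpleGraph V) (S : Finset V) (p : ℕ)
    (W : Finset V) : Prop :=
  S ⊆ W ∧
  (∀ H ∈ componentsOff G S, H ⊆ (W : Set V) ∨ Disjoint H (W : Set V)) ∧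
  ∀ H ∈ componentsOff G S,
    (largeThreshold p ≤ (twinClass G S H).ncard →
      {K | K ∈ twinClass G S H ∧ K ⊆ (W : Set V)}.ncard = largeThreshold p) ∧
    ((twinClass G S H).ncard < largeThreshold p →
      ∀ K ∈ twinClass G S H, K ⊆ (W : Set V))

/-! ### Trigraphs and contraction sequences -/

/-- A trigraph whose vertices are taken from `V`: a finite vertex set and disjoint sets of black
and of red edges on it. -/
structure Trigraph (V : Type*) where
  verts : Finset V
  black : SimpleGraph V
  red : SimpleGraph V
  black_mem : ∀ x y, black.Adj x y → x ∈ verts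
  red_mem : ∀ x y, red.Adj x y → x ∈ verts
  disjoint : ∀ x y, black.Adj x y → ¬ red.Adj x y

namespace Trigraph

/-- The induced subgraph `G[W]`, as a trigraph without red edges. -/
def ofGraph {V : Type*} (G : SimpleGraph V) (W : Finset V) : Trigraph V where
  verts := W
  black :=
    { Adj := fun x y => x ∈ W ∧ y ∈ W ∧ G.Adj x y
      symm := ⟨fun _ _ h => ⟨h.2.1, h.1, h.2.2.symm⟩⟩
      loopless := ⟨fun _ h => h.2.2.ne rfl⟩ }
  red := ⊥
  black_mem := fun _ _ h => h.1
  red_mem := fun _ _ h => h.elim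
  disjoint := fun _ _ _ h => h

/-- Black adjacency after contracting `u` and `v` into one vertex, which is named `u`. -/
def contractBlack {V : Type*} (T : Trigraph V) (u v x y : V) : Prop :=
  (x ≠ u ∧ y ≠ u ∧ T.black.Adj x y) ∨
  (x = u ∧ T.black.Adj u y ∧ T.black.Adj v y) ∨
  (y = u ∧ T.black.Adj u x ∧ T.black.Adj v x)

/-- The vertex obtained by contracting `u` and `v` has a red edge to `y`: one of `uy`, `vy` is red,
or exactly one of them is a black edge. -/
def redToMerged {V : Type*} (T : Trigraph V) (u v y : V) : Prop :=
  T.red.Adj u y ∨ T.red.Adj v y ∨ Xor (T.black.Adj u y) (T.black.Adj v y)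

/-- Red adjacency after contracting `u` and `v` into one vertex, which is named `u`. -/
def contractRed {V : Type*} (T : Trigraph V) (u v x y : V) : Prop :=
  (x ≠ u ∧ y ≠ u ∧ T.red.Adj x y) ∨
  (x = u ∧ T.redToMerged u v y) ∨
  (y = u ∧ T.redToMerged u v x)

/-- The contraction of two distinct vertices `u` and `v`; the new vertex takes over the
name `u`, and the name `v` disappears. (Used only for distinct `u`, `v` in `T.verts`.) -/
def contract {V : Type*} [DecidableEq V] (T : Trigraph V) (u v : V) : Trigraph V where
  verts := T.verts.erase v
  black :=
    { Adj := fun x y =>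
        x ∈ T.verts.erase v ∧ y ∈ T.verts.erase v ∧ x ≠ y ∧ T.contractBlack u v x y
      symm := ⟨by
        rintro x y ⟨hx, hy, hne, h⟩
        refine ⟨hy, hx, hne.symm, ?_⟩
        rcases h with ⟨h1, h2, h3⟩ | h | h
        · exact Or.inl ⟨h2, h1, h3.symm⟩
        · exact Or.inr (Or.inr h)
        · exact Or.inr (Or.inl h)⟩
      loopless := ⟨fun _ h => h.2.2.1 rfl⟩ }
  red :=
    { Adj := fun x y =>
        x ∈ T.verts.erase v ∧ y ∈ T.verts.erase v ∧ x ≠ y ∧ T.contractRed u v x y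
      symm := ⟨by
        rintro x y ⟨hx, hy, hne, h⟩
        refine ⟨hy, hx, hne.symm, ?_⟩
        rcases h with ⟨h1, h2, h3⟩ | h | h
        · exact Or.inl ⟨h2, h1, h3.symm⟩
        · exact Or.inr (Or.inr h)
        · exact Or.inr (Or.inl h)⟩
      loopless := ⟨fun _ h => h.2.2.1 rfl⟩ }
  black_mem := fun _ _ h => h.1
  red_mem := fun _ _ h => h.1
  disjoint := by
    rintro x y ⟨-, -, hne, hb⟩ ⟨-, -, -, hr⟩
    have key : ∀ z, T.black.Adj u z → T.black.Adj v z → ¬ T.redToMerged u v z := by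
      rintro z h1 h2 (h | h | h | h)
      · exact T.disjoint _ _ h1 h
      · exact T.disjoint _ _ h2 h
      · exact h.2 h2
      · exact h.2 h1
    rcases hb with ⟨h1, h2, h3⟩ | ⟨h1, h2, h3⟩ | ⟨h1, h2, h3⟩ <;>
      rcases hr with ⟨k1, k2, k3⟩ | ⟨k1, k2⟩ | ⟨k1, k2⟩
    · exact T.disjoint _ _ h3 k3
    · exact h1 k1
    · exact h2 k1
    · exact k1 h1
    · exact key _ h2 h3 k2
    · exact hne (h1.trans k1.symm)
    · exact k2 h1
    · exact hne (k1.trans h1.symm)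
    · exact key _ h2 h3 k2

open scoped Classical in
/-- The number of red edges at `x`. -/
noncomputable def redDegree {V : Type*} (T : Trigraph V) (x : V) : ℕ :=
  (T.verts.filter fun y => T.red.Adj x y).card

/-- The maximum red degree of a trigraph. -/
noncomputable def maxRedDegree {V : Type*} (T : Trigraph V) : ℕ :=
  T.verts.sup T.redDegree

/-- A contraction sequence is given by its list of contractions: the pair `(u, v)` contracts the
current vertices named `u` and `v` into one vertex named `u`. Each contraction takes two distinct
vertices of the current trigraph, and the last trigraph has a single vertex. -/
def IsContractionSequence {V : Type*} [DecidableEq V] : Trigraph V → List (V × V) → Prop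
  | T, [] => T.verts.card = 1
  | T, (u, v) :: C =>
      u ∈ T.verts ∧ v ∈ T.verts ∧ u ≠ v ∧ IsContractionSequence (T.contract u v) C

/-- The trigraphs `T = T₁, T₂, …` which a list of contractions runs through. -/
def trigraphs {V : Type*} [DecidableEq V] : Trigraph V → List (V × V) → List (Trigraph V)
  | T, [] => [T]
  | T, (u, v) :: C => T :: trigraphs (T.contract u v) C

/-- The width: the maximum red degree over all vertices in all trigraphs of the sequence. -/
noncomputable def width {V : Type*} [DecidableEq V] (T : Trigraph V) (C : List (V × V)) : ℕ :=
  ((T.trigraphs C).map maxRedDegree).foldr max 0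

end Trigraph

/-! ### Random access machines with unit-cost addition and subtraction

Programs are structured; the memory consists of registers and of arrays of natural numbers. Every
operation costs one step. There is no multiplication, so numbers gain at most one bit per step, and
polynomial time on this machine is polynomial time on Turing machines. -/

namespace RAM

/-- A memory content: registers `reg r`, and cells `mem a i` (cell number `i` of the array `a`). -/
structure State where
  reg : ℕ → ℕ
  mem : ℕ → ℕ → ℕ

/-- Arithmetic expressions. -/
inductive Expr where
  | lit (c : ℕ)
  | reg (r : ℕ)
  | load (a : ℕ) (i : Expr)
  | add (e f : Expr)
  | sub (e f : Expr)
  | lt (e f : Expr)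
  | eq (e f : Expr)

/-- The value of an expression; subtraction is truncated, and a comparison has value `1` or `0`. -/
def Expr.eval (s : State) : Expr → ℕ
  | .lit c => c
  | .reg r => s.reg r
  | .load a i => s.mem a (i.eval s)
  | .add e f => e.eval s + f.eval s
  | .sub e f => e.eval s - f.eval s
  | .lt e f => if e.eval s < f.eval s then 1 else 0
  | .eq e f => if e.eval s = f.eval s then 1 else 0

/-- The number of steps for evaluating an expression: one for each operation in it. -/
def Expr.cost : Expr → ℕ
  | .lit _ => 1
  | .reg _ => 1
  | .load _ i => i.cost + 1
  | .add e f => e.cost + f.cost + 1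
  | .sub e f => e.cost + f.cost + 1
  | .lt e f => e.cost + f.cost + 1
  | .eq e f => e.cost + f.cost + 1

/-- Programs. A test succeeds if the value of its expression is not `0`. -/
inductive Cmd where
  | skip
  | assign (r : ℕ) (e : Expr)
  | store (a : ℕ) (i e : Expr)
  | seq (c d : Cmd)
  | ite (e : Expr) (c d : Cmd)
  | loop (e : Expr) (c : Cmd)

/-- `s` after writing `x` into the register `r`. -/
def State.setReg (s : State) (r x : ℕ) : State :=
  { s with reg := Function.update s.reg r x }

/-- `s` after writing `x` into cell `i` of the array `a`. -/
def State.setMem (s : State) (a i x : ℕ) : State :=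
  { s with mem := Function.update s.mem a (Function.update (s.mem a) i x) }

/-- `Exec c s s' k`: started in `s`, the program `c` halts in `s'` after exactly `k` steps. -/
inductive Exec : Cmd → State → State → ℕ → Prop where
  | skip (s : State) : Exec .skip s s 1
  | assign (s : State) (r : ℕ) (e : Expr) :
      Exec (.assign r e) s (s.setReg r (e.eval s)) (e.cost + 1)
  | store (s : State) (a : ℕ) (i e : Expr) :
      Exec (.store a i e) s (s.setMem a (i.eval s) (e.eval s)) (i.cost + e.cost + 1)
  | seq {c d : Cmd} {s s' s'' : State} {k l : ℕ} :
      Exec c s s' k → Exec d s' s'' l → Exec (.seq c d) s s'' (k + l)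
  | ite_true {e : Expr} {c d : Cmd} {s s' : State} {k : ℕ} :
      e.eval s ≠ 0 → Exec c s s' k → Exec (.ite e c d) s s' (e.cost + 1 + k)
  | ite_false {e : Expr} {c d : Cmd} {s s' : State} {k : ℕ} :
      e.eval s = 0 → Exec d s s' k → Exec (.ite e c d) s s' (e.cost + 1 + k)
  | loop_done {e : Expr} {c : Cmd} {s : State} :
      e.eval s = 0 → Exec (.loop e c) s s (e.cost + 1)
  | loop_step {e : Expr} {c : Cmd} {s s' s'' : State} {k l : ℕ} :
      e.eval s ≠ 0 → Exec c s s' k → Exec (.loop e c) s' s'' l →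
        Exec (.loop e c) s s'' (e.cost + 1 + k + l)

/-- The start state on an input that consists of several lists of numbers: the list number `k`
stands in the array `k`, its length stands in the register `k`, and all else is `0`. -/
def State.init (x : List (List ℕ)) : State where
  reg k := (x.getD k []).length
  mem k i := (x.getD k []).getD i 0

/-- The output: the first `reg 0` cells of the array `0`. -/
def State.output (s : State) : List ℕ :=
  (List.range (s.reg 0)).map (s.mem 0)

/-- On the input `x`, the program `P` halts within `b` steps with the output `y`. -/
def ComputesWithin (P : Cmd) (x : List (List ℕ)) (y : List ℕ) (b : ℕ) : Prop :=
  ∃ (s : State) (k : ℕ), Exec P (State.init x) s k ∧ k ≤ b ∧ s.output = y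

end RAM

/-! ### Encodings -/

open scoped Classical in
/-- The adjacency matrix of a graph as a list of zeros and ones, row by row. -/
noncomputable def encodeGraph {n : ℕ} (G : SimpleGraph (Fin n)) : List ℕ :=
  (List.finRange n).flatMap fun i => (List.finRange n).map fun j => if G.Adj i j then 1 else 0

/-- The indicator vector of a vertex set. -/
def encodeSet {n : ℕ} (W : Finset (Fin n)) : List ℕ :=
  (List.finRange n).map fun i => if i ∈ W then 1 else 0

/-- A list of contractions `(u₁, v₁), (u₂, v₂), …` as the list `u₁, v₁, u₂, v₂, …`. -/
def encodeContractions {n : ℕ} (C : List (Fin n × Fin n)) : List ℕ :=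
  C.flatMap fun c => [c.1.val, c.2.val]

/-- The input for the algorithm: the number of vertices, the graph, the separator, the vertex set
of the induced subgraph, and the contraction sequence of the induced subgraph. -/
noncomputable def encodeInput {n : ℕ} (G : SimpleGraph (Fin n)) (S W : Finset (Fin n))
    (C' : List (Fin n × Fin n)) : List (List ℕ) :=
  [[n], encodeGraph G, encodeSet S, encodeSet W, encodeContractions C']

/-!
Write `p` for the vertex integrity, and `π` for the partition of `W` into the sets that have been
contracted to single vertices at some time of the given sequence. The components of `G - S` that are
missing in `W` are put back one at a time.

*Absorbing a component.* Let `K` be a missing component, and let `ψ` embed it into `W \ S` like a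
twin-block. Suppose that, for the current `π`, every vertex of `K` is completely adjacent or
completely non-adjacent to each part, and that the part of each `ψ k` meets a second component of
`G - S`. Then the contractions made so far can be repeated on `K`, and each part of `K` can then be
contracted into the corresponding part of `W`. The second condition means that no edge of `G[W]` off
`S` is black in the quotient once its ends are in such parts, so that the new members of the parts
cause no new red edges there. In between, each part has at most `t` red neighbours among the parts
of `W`, and at most `t` among those of `K`, since both come from quotients of `G[W]`; this is
`thin_override`, and `CanAbsorb.steps_absorbList` derives the contractions from it. Components that
have been absorbed stay in the parts that they have joined (`IsShadow`). Components that are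
absorbed later cause no red edges: they are homogeneous to all parts then, hence also before
(`RAM.Progress.succ`).

*Why there is a time for it, if `2 * t < p`.* A missing component has `f(p)` copies in `W`. Take the
last time at which it is homogeneous to all parts. The next contraction joins a neighbour of some
vertex `k` of `K`, which is in `S`, to a non-neighbour. As the red degree is at most `t`, the copies
of `k` are in few parts, so many of them are in one part. The neighbours of these copies in their
components are in few parts again, and so on along a connected ordering of `K`. In the end two whole
copies of `K` lie in the same parts, and either of them serves as the image of `ψ`
(`exists_absorbable`). The algorithm therefore tries all maps `ψ` at all times, and since
`|K| ^ |K| ≤ f(p) ≤ n` there are few of them.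

*The fallback.* If some component could not be absorbed, then `p ≤ 2 * t`. Contracting the
components of `G - S` one after the other into one vertex, and then `S`, keeps the red degree at
most `p` (`steps_starList`).

The program is verified with weakest preconditions (`RAM.wp`) that also bound the number of
iterations of every loop by `n + 1`, from which a polynomial bound on the number of steps follows
(`RAM.exists_polynomial_stepBound`). Contracted graphs are handled as quotients by a labelling of
the vertices, whose red edges are those between parts that are neither completely adjacent nor
completely non-adjacent (`isContractionSequence_quotientTrigraph_iff`).
-/

/-! ### Quotient trigraphs -/

/-- The labelling of the vertices after the parts labelled `u` and `v` are joined to one part, which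
is labelled `u`. -/
def merge {V : Type*} [DecidableEq V] (ρ : V → V) (u v : V) : V → V :=
  fun x => if ρ x = v then u else ρ x

/-- The labelling after a list of contractions. -/
def mergeAll {V : Type*} [DecidableEq V] (ρ : V → V) (C : List (V × V)) : V → V :=
  C.foldl (fun ρ c => merge ρ c.1 c.2) ρ

/-- The parts `a` and `b` of the labelling `ρ` of `U` are neither completely adjacent nor completely
non-adjacent. -/
def RedParts {V : Type*} (G : SimpleGraph V) (U : Finset V) (ρ : V → V) (a b : V) : Prop :=
  a ≠ b ∧ (∃ x ∈ U, ∃ y ∈ U, ρ x = a ∧ ρ y = b ∧ G.Adj x y) ∧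
    ∃ x ∈ U, ∃ y ∈ U, ρ x = a ∧ ρ y = b ∧ ¬ G.Adj x y

theorem RedParts.symm {V : Type*} {G : SimpleGraph V} {U : Finset V} {ρ : V → V} {a b : V}
    (h : RedParts G U ρ a b) : RedParts G U ρ b a := by
  obtain ⟨h0, ⟨x, hx, y, hy, hxa, hyb, h1⟩, ⟨x', hx', y', hy', hxa', hyb', h2⟩⟩ := h
  exact ⟨h0.symm, ⟨y, hy, x, hx, hyb, hxa, h1.symm⟩,
    ⟨y', hy', x', hx', hyb', hxa', fun h => h2 h.symm⟩⟩

/-- The trigraph that arises from `G[U]` by contracting every part of the labelling `ρ`. The vertex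
that stands for a part is the label of the part. -/
def quotientTrigraph {V : Type*} [DecidableEq V] (G : SimpleGraph V) (U : Finset V) (ρ : V → V) :
    Trigraph V where
  verts := U.image ρ
  black :=
    { Adj := fun a b => a ∈ U.image ρ ∧ b ∈ U.image ρ ∧ a ≠ b ∧
        ∀ x ∈ U, ∀ y ∈ U, ρ x = a → ρ y = b → G.Adj x y
      symm := ⟨fun _ _ h => ⟨h.2.1, h.1, h.2.2.1.symm, fun x hx y hy hxa hyb =>
        (h.2.2.2 y hy x hx hyb hxa).symm⟩⟩
      loopless := ⟨fun _ h => h.2.2.1 rfl⟩ }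
  red :=
    { Adj := RedParts G U ρ
      symm := ⟨fun _ _ h => h.symm⟩
      loopless := ⟨fun _ h => h.1 rfl⟩ }
  black_mem := fun _ _ h => h.1
  red_mem := by
    rintro a b ⟨-, ⟨x, hx, y, hy, rfl, rfl, -⟩, -⟩
    exact Finset.mem_image_of_mem _ hx
  disjoint := by
    rintro a b ⟨-, -, -, h⟩ ⟨-, -, x, hx, y, hy, hxa, hyb, hn⟩
    exact hn (h x hx y hy hxa hyb)

theorem Trigraph.ext' {V : Type*} {T T' : Trigraph V} (h : T.verts = T'.verts)
    (hb : ∀ x y, T.black.Adj x y ↔ T'.black.Adj x y)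
    (hr : ∀ x y, T.red.Adj x y ↔ T'.red.Adj x y) : T = T' := by
  have h1 : T.black = T'.black := by ext x y; exact hb x y
  have h2 : T.red = T'.red := by ext x y; exact hr x y
  cases T; cases T'
  simp only at h h1 h2
  subst h h1 h2
  rfl

section Quotient

variable {V : Type*} [DecidableEq V] {G : SimpleGraph V} {U : Finset V}

theorem ofGraph_eq_quotientTrigraph (G : SimpleGraph V) (U : Finset V) :
    Trigraph.ofGraph G U = quotientTrigraph G U id := by
  apply Trigraph.ext'
  · simp [Trigraph.ofGraph, quotientTrigraph]
  · intro x y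
    simp only [Trigraph.ofGraph, quotientTrigraph, Finset.image_id, id]
    constructor
    · rintro ⟨hx, hy, h⟩
      exact ⟨hx, hy, h.ne, by rintro x hx y hy rfl rfl; exact h⟩
    · rintro ⟨hx, hy, hne, h⟩
      exact ⟨hx, hy, h x hx y hy rfl rfl⟩
  · intro x y
    simp only [Trigraph.ofGraph, quotientTrigraph]
    constructor
    · intro h; exact h.elim
    · rintro ⟨-, ⟨a, ha, b, hb, rfl, rfl, h⟩, ⟨a', ha', b', hb', h1, h2, h'⟩⟩
      simp only [id] at h1 h2
      subst h1 h2
      exact (h' h).elim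

theorem image_merge {ρ : V → V} {u v : V} (hu : u ∈ U.image ρ) (huv : u ≠ v) :
    U.image (merge ρ u v) = (U.image ρ).erase v := by
  ext a
  simp only [Finset.mem_image, Finset.mem_erase, merge]
  constructor
  · rintro ⟨x, hx, rfl⟩
    split_ifs with h
    · exact ⟨huv, Finset.mem_image.1 hu⟩
    · exact ⟨h, x, hx, rfl⟩
  · rintro ⟨hav, x, hx, rfl⟩
    exact ⟨x, hx, if_neg hav⟩

theorem merge_eq_iff_of_ne {ρ : V → V} {u v a x : V} (hau : a ≠ u) (hav : a ≠ v) :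
    merge ρ u v x = a ↔ ρ x = a := by
  unfold merge
  split_ifs with h
  · constructor
    · intro h'; exact (hau h'.symm).elim
    · intro h'; exact (hav (h'.symm.trans h)).elim
  · rfl

theorem merge_eq_left_iff {ρ : V → V} {u v x : V} :
    merge ρ u v x = u ↔ ρ x = u ∨ ρ x = v := by
  unfold merge
  split_ifs with h <;> simp [h]

theorem redParts_merge_iff_of_ne {ρ : V → V} {u v a b : V} (hau : a ≠ u) (hav : a ≠ v)
    (hbu : b ≠ u) (hbv : b ≠ v) :
    RedParts G U (merge ρ u v) a b ↔ RedParts G U ρ a b := by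
  simp only [RedParts, merge_eq_iff_of_ne hau hav, merge_eq_iff_of_ne hbu hbv]

theorem redParts_merge_left_iff {ρ : V → V} {u v b : V} (hu : u ∈ U.image ρ) (hv : v ∈ U.image ρ)
    (hb : b ∈ U.image ρ) (hbu : b ≠ u) (hbv : b ≠ v) :
    RedParts G U (merge ρ u v) u b ↔ (quotientTrigraph G U ρ).redToMerged u v b := by
  simp only [RedParts, merge_eq_iff_of_ne hbu hbv, merge_eq_left_iff, Trigraph.redToMerged,
    quotientTrigraph, Xor]
  obtain ⟨x0, hx0, hxu⟩ := Finset.mem_image.1 hu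
  obtain ⟨x1, hx1, hxv⟩ := Finset.mem_image.1 hv
  obtain ⟨y0, hy0, hyb⟩ := Finset.mem_image.1 hb
  constructor
  · rintro ⟨-, ⟨x, hx, y, hy, hxa, hyb1, h1⟩, ⟨x', hx', y', hy', hxa', hyb', h2⟩⟩
    by_contra hcon
    have full : ∀ w, b ≠ w → ¬ RedParts G U ρ w b →
        (∀ x ∈ U, ∀ y ∈ U, ρ x = w → ρ y = b → G.Adj x y) ∨
        (∀ x ∈ U, ∀ y ∈ U, ρ x = w → ρ y = b → ¬ G.Adj x y) := by
      intro w hbw hr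
      by_contra hc
      rw [not_or] at hc
      obtain ⟨hc1, hc2⟩ := hc
      push Not at hc1 hc2
      obtain ⟨x, hx, y, hy, h1, h2, h3⟩ := hc1
      obtain ⟨x', hx', y', hy', h1', h2', h3'⟩ := hc2
      exact hr ⟨hbw.symm, ⟨x', hx', y', hy', h1', h2', h3'⟩, ⟨x, hx, y, hy, h1, h2, h3⟩⟩
    have fu := full u hbu fun h => hcon (Or.inl h)
    have fv := full v hbv fun h => hcon (Or.inr (Or.inl h))
    rcases fu with fu | fu <;> rcases fv with fv | fv
    · rcases hxa' with h | h
      · exact h2 (fu _ hx' _ hy' h hyb')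
      · exact h2 (fv _ hx' _ hy' h hyb')
    · exact hcon (Or.inr (Or.inr (Or.inl ⟨⟨hu, hb, hbu.symm, fu⟩, fun h =>
        fv _ hx1 _ hy0 hxv hyb (h.2.2.2 _ hx1 _ hy0 hxv hyb)⟩)))
    · exact hcon (Or.inr (Or.inr (Or.inr ⟨⟨hv, hb, hbv.symm, fv⟩, fun h =>
        fu _ hx0 _ hy0 hxu hyb (h.2.2.2 _ hx0 _ hy0 hxu hyb)⟩)))
    · rcases hxa with h | h
      · exact fu _ hx _ hy h hyb1 h1
      · exact fv _ hx _ hy h hyb1 h1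
  · rintro (⟨-, ⟨x, hx, y, hy, hxa, hyb1, h1⟩, ⟨x', hx', y', hy', hxa', hyb', h2⟩⟩ |
      ⟨-, ⟨x, hx, y, hy, hxa, hyb1, h1⟩, ⟨x', hx', y', hy', hxa', hyb', h2⟩⟩ | ⟨h, h'⟩ | ⟨h, h'⟩)
    · exact ⟨hbu.symm, ⟨x, hx, y, hy, Or.inl hxa, hyb1, h1⟩,
        ⟨x', hx', y', hy', Or.inl hxa', hyb', h2⟩⟩
    · exact ⟨hbu.symm, ⟨x, hx, y, hy, Or.inr hxa, hyb1, h1⟩,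
        ⟨x', hx', y', hy', Or.inr hxa', hyb', h2⟩⟩
    · refine ⟨hbu.symm, ⟨x0, hx0, y0, hy0, Or.inl hxu, hyb, h.2.2.2 _ hx0 _ hy0 hxu hyb⟩, ?_⟩
      by_contra hcon
      refine h' ⟨hv, hb, hbv.symm, fun x hx y hy hxv hyb => ?_⟩
      by_contra hn
      exact hcon ⟨x, hx, y, hy, Or.inr hxv, hyb, hn⟩
    · refine ⟨hbu.symm, ⟨x1, hx1, y0, hy0, Or.inr hxv, hyb, h.2.2.2 _ hx1 _ hy0 hxv hyb⟩, ?_⟩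
      by_contra hcon
      refine h' ⟨hu, hb, hbu.symm, fun x hx y hy hxv hyb => ?_⟩
      by_contra hn
      exact hcon ⟨x, hx, y, hy, Or.inl hxv, hyb, hn⟩

theorem RedParts.mem_left {ρ : V → V} {a b : V} (h : RedParts G U ρ a b) : a ∈ U.image ρ := by
  obtain ⟨-, ⟨x, hx, y, hy, rfl, rfl, -⟩, -⟩ := h
  exact Finset.mem_image_of_mem _ hx

theorem RedParts.mem_right {ρ : V → V} {a b : V} (h : RedParts G U ρ a b) : b ∈ U.image ρ :=
  h.symm.mem_left

/-- Contracting two vertices of a quotient trigraph joins the two parts. -/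
theorem contract_quotientTrigraph {ρ : V → V} {u v : V} (hu : u ∈ U.image ρ) (hv : v ∈ U.image ρ)
    (huv : u ≠ v) :
    (quotientTrigraph G U ρ).contract u v = quotientTrigraph G U (merge ρ u v) := by
  have him := image_merge (U := U) hu huv
  apply Trigraph.ext'
  · exact him.symm
  · intro a b
    have main : ∀ b, b ∈ U.image ρ → b ≠ u → b ≠ v →
        ((∀ x ∈ U, ∀ y ∈ U, merge ρ u v x = u → merge ρ u v y = b → G.Adj x y) ↔
        ((quotientTrigraph G U ρ).black.Adj u b ∧ (quotientTrigraph G U ρ).black.Adj v b)) := by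
      intro b hb hbu hbv
      simp only [merge_eq_iff_of_ne hbu hbv, merge_eq_left_iff, quotientTrigraph]
      constructor
      · intro h
        exact ⟨⟨hu, hb, hbu.symm, fun x hx y hy hxu hyb => h x hx y hy (Or.inl hxu) hyb⟩,
          ⟨hv, hb, hbv.symm, fun x hx y hy hxu hyb => h x hx y hy (Or.inr hxu) hyb⟩⟩
      · rintro ⟨h1, h2⟩ x hx y hy (h | h) hyb
        · exact h1.2.2.2 x hx y hy h hyb
        · exact h2.2.2.2 x hx y hy h hyb
    change (a ∈ (U.image ρ).erase v ∧ b ∈ (U.image ρ).erase v ∧ a ≠ b ∧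
      (quotientTrigraph G U ρ).contractBlack u v a b) ↔
      (a ∈ U.image (merge ρ u v) ∧ b ∈ U.image (merge ρ u v) ∧ a ≠ b ∧
        ∀ x ∈ U, ∀ y ∈ U, merge ρ u v x = a → merge ρ u v y = b → G.Adj x y)
    rw [him]
    refine and_congr_right fun ha => and_congr_right fun hb => and_congr_right fun hab => ?_
    obtain ⟨hav, ha⟩ := Finset.mem_erase.1 ha
    obtain ⟨hbv, hb⟩ := Finset.mem_erase.1 hb
    unfold Trigraph.contractBlack
    by_cases hau : a = u
    · subst hau
      rw [main b hb hab.symm hbv]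
      simp [hab.symm]
    · by_cases hbu : b = u
      · subst hbu
        have := main a ha hab hav
        simp only [ne_eq, not_true, false_and, and_false, hau, true_and, false_or]
        rw [← this]
        exact ⟨fun h x hx y hy hxa hyb => (h y hy x hx hyb hxa).symm,
          fun h x hx y hy hxa hyb => (h y hy x hx hyb hxa).symm⟩
      · simp only [merge_eq_iff_of_ne hau hav, merge_eq_iff_of_ne hbu hbv]
        simp [hau, hbu, quotientTrigraph, ha, hb, hab, -Finset.mem_image]
  · intro a b
    change (a ∈ (U.image ρ).erase v ∧ b ∈ (U.image ρ).erase v ∧ a ≠ b ∧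
      (quotientTrigraph G U ρ).contractRed u v a b) ↔ RedParts G U (merge ρ u v) a b
    have mem : RedParts G U (merge ρ u v) a b → a ∈ (U.image ρ).erase v ∧
        b ∈ (U.image ρ).erase v ∧ a ≠ b := by
      intro h
      rw [← him]
      exact ⟨h.mem_left, h.mem_right, h.1⟩
    rw [show RedParts G U (merge ρ u v) a b ↔ (a ∈ (U.image ρ).erase v ∧
        b ∈ (U.image ρ).erase v ∧ a ≠ b ∧ RedParts G U (merge ρ u v) a b) from
      ⟨fun h => ⟨(mem h).1, (mem h).2.1, (mem h).2.2, h⟩, fun h => h.2.2.2⟩]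
    refine and_congr_right fun ha => and_congr_right fun hb => and_congr_right fun hab => ?_
    obtain ⟨hav, ha⟩ := Finset.mem_erase.1 ha
    obtain ⟨hbv, hb⟩ := Finset.mem_erase.1 hb
    unfold Trigraph.contractRed
    by_cases hau : a = u
    · subst hau
      rw [redParts_merge_left_iff hu hv hb hab.symm hbv]
      simp [hab.symm]
    · by_cases hbu : b = u
      · subst hbu
        rw [show RedParts G U (merge ρ b v) a b ↔ RedParts G U (merge ρ b v) b a from
          ⟨RedParts.symm, RedParts.symm⟩, redParts_merge_left_iff hu hv ha hab hav]
        simp [hau]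
      · rw [redParts_merge_iff_of_ne hau hav hbu hbv]
        simp [hau, hbu, quotientTrigraph]

/-- Every part of the labelling `ρ` of `U` has at most `B` red neighbours. -/
def Thin {V : Type*} (G : SimpleGraph V) (U : Finset V) (B : ℕ) (ρ : V → V) : Prop :=
  ∀ (a : V) (F : Finset V), (∀ b ∈ F, RedParts G U ρ a b) → F.card ≤ B

theorem maxRedDegree_quotientTrigraph_le_iff {ρ : V → V} {B : ℕ} :
    (quotientTrigraph G U ρ).maxRedDegree ≤ B ↔ Thin G U B ρ := by
  classical
  unfold Trigraph.maxRedDegree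
  rw [Finset.sup_le_iff]
  constructor
  · intro h a F hF
    by_cases hFe : F = ∅
    · simp [hFe]
    · obtain ⟨b0, hb0⟩ := Finset.nonempty_iff_ne_empty.2 hFe
      refine le_trans (Finset.card_le_card ?_) (h a (hF b0 hb0).mem_left)
      intro b hb
      exact Finset.mem_filter.2 ⟨(hF b hb).mem_right, hF b hb⟩
  · intro h a _
    exact h a _ fun b hb => (Finset.mem_filter.1 hb).2

/-- From the labelling `ρ` of `U`, each contraction of the list `C` takes two distinct parts, and
all the quotients have red degree at most `B`. -/
def Steps (G : SimpleGraph V) (U : Finset V) (B : ℕ) : (V → V) → List (V × V) → Prop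
  | ρ, [] => Thin G U B ρ
  | ρ, (u, v) :: C => Thin G U B ρ ∧ u ∈ U.image ρ ∧ v ∈ U.image ρ ∧ u ≠ v ∧
      Steps G U B (merge ρ u v) C

theorem Steps.thin {B : ℕ} {ρ : V → V} {C : List (V × V)} (h : Steps G U B ρ C) :
    Thin G U B ρ := by
  cases C with
  | nil => exact h
  | cons c C => exact h.1

theorem mergeAll_append (ρ : V → V) (C D : List (V × V)) :
    mergeAll ρ (C ++ D) = mergeAll (mergeAll ρ C) D := by
  simp [mergeAll]

theorem mergeAll_cons (ρ : V → V) (c : V × V) (D : List (V × V)) :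
    mergeAll ρ (c :: D) = mergeAll (merge ρ c.1 c.2) D := rfl

theorem steps_append {B : ℕ} {ρ : V → V} {C D : List (V × V)} :
    Steps G U B ρ (C ++ D) ↔ Steps G U B ρ C ∧ Steps G U B (mergeAll ρ C) D := by
  induction C generalizing ρ with
  | nil => exact ⟨fun h => ⟨h.thin, h⟩, fun h => h.2⟩
  | cons c C ih =>
    obtain ⟨u, v⟩ := c
    simp only [List.cons_append, Steps, ih, mergeAll_cons]
    tauto

theorem isContractionSequence_quotientTrigraph_iff {B : ℕ} {ρ : V → V} {C : List (V × V)} :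
    ((quotientTrigraph G U ρ).IsContractionSequence C ∧ (quotientTrigraph G U ρ).width C ≤ B) ↔
      Steps G U B ρ C ∧ (U.image (mergeAll ρ C)).card = 1 := by
  induction C generalizing ρ with
  | nil =>
    simp only [Trigraph.IsContractionSequence, Trigraph.width, Trigraph.trigraphs, Steps,
      mergeAll, List.foldl, List.map, List.foldr, ← maxRedDegree_quotientTrigraph_le_iff]
    simp only [Nat.max_zero, quotientTrigraph]
    tauto
  | cons c C ih =>
    obtain ⟨u, v⟩ := c
    have hw : (quotientTrigraph G U ρ).width ((u, v) :: C) ≤ B ↔ Thin G U B ρ ∧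
        ((quotientTrigraph G U ρ).contract u v).width C ≤ B := by
      simp only [Trigraph.width, Trigraph.trigraphs, List.map, List.foldr,
        ← maxRedDegree_quotientTrigraph_le_iff, max_le_iff]
    rw [hw, mergeAll_cons]
    simp only [Trigraph.IsContractionSequence, Steps]
    constructor
    · rintro ⟨⟨hu, hv, huv, h⟩, ht, hw⟩
      rw [contract_quotientTrigraph hu hv huv] at h hw
      obtain ⟨h1, h2⟩ := ih.1 ⟨h, hw⟩
      exact ⟨⟨ht, hu, hv, huv, h1⟩, h2⟩
    · rintro ⟨⟨ht, hu, hv, huv, h1⟩, h2⟩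
      obtain ⟨h, hw⟩ := ih.2 ⟨h1, h2⟩
      rw [← contract_quotientTrigraph hu hv huv] at h hw
      exact ⟨⟨hu, hv, huv, h⟩, ht, hw⟩

end Quotient

/-! ### Absorbing a component into a quotient -/

/-- The setting: `S ⊆ W`, and `comp` labels the vertices off `S` such that adjacent vertices have
the same label and each class is contained in `W` or disjoint from `W`. -/
structure Layout {V : Type*} (G : SimpleGraph V) (S W : Finset V) (comp : V → ℕ) : Prop where
  sub : S ⊆ W
  adj : ∀ x y, x ∉ S → y ∉ S → G.Adj x y → comp x = comp y
  mem : ∀ x y, x ∉ S → y ∉ S → comp x = comp y → (x ∈ W ↔ y ∈ W)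

/-- `π` labels each part of `W` by one of its elements, and fixes all vertices off `W`. -/
structure IsLabelling {V : Type*} (W : Finset V) (π : V → V) : Prop where
  mem : ∀ x ∈ W, π x ∈ W
  idem : ∀ x, π (π x) = π x
  fix : ∀ x, x ∉ W → π x = x

/-- The vertex `k` is completely adjacent or completely non-adjacent to each part of `W`. -/
def Homogeneous {V : Type*} (G : SimpleGraph V) (W : Finset V) (π : V → V) (k : V) : Prop :=
  ∀ x ∈ W, G.Adj k x ↔ G.Adj k (π x)

/-- `ψ` embeds `K` as an induced subgraph into `W \ S`, with the same adjacencies to `S`; the part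
of each image meets a second component; and the vertices of `K` are homogeneous to all parts. Then
`K` can be contracted into the quotient by `π`. -/
structure Absorbable {V : Type*} (G : SimpleGraph V) (S W : Finset V) (comp : V → ℕ) (π : V → V)
    (K : Finset V) (ψ : V → V) : Prop where
  mem : ∀ k ∈ K, ψ k ∈ W ∧ ψ k ∉ S
  adj : ∀ k ∈ K, ∀ k' ∈ K, G.Adj k k' ↔ G.Adj (ψ k) (ψ k')
  inj : ∀ k ∈ K, ∀ k' ∈ K, ψ k = ψ k' → k = k'
  adjS : ∀ k ∈ K, ∀ s ∈ S, G.Adj k s ↔ G.Adj (ψ k) s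
  other : ∀ k ∈ K, ∃ z ∈ W, z ∉ S ∧ comp z ≠ comp (ψ k) ∧ π z = π (ψ k)
  homog : ∀ k ∈ K, Homogeneous G W π k

/-- `φ` maps each vertex off `W` that has been absorbed to the vertex of `W` whose part it has
joined, and fixes all other vertices. -/
structure IsShadow {V : Type*} (G : SimpleGraph V) (S W : Finset V) (comp : V → ℕ) (π : V → V)
    (φ : V → V) : Prop where
  fix : ∀ x ∈ W, φ x = x
  or : ∀ x, φ x = x ∨ φ x ∈ W
  notMem : ∀ x, x ∉ W → φ x ∈ W → φ x ∉ S
  adjS : ∀ x, x ∉ W → φ x ∈ W → ∀ s ∈ S, G.Adj x s ↔ G.Adj (φ x) s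
  adj : ∀ x, x ∉ W → φ x ∈ W → ∀ y, y ∉ W → G.Adj x y → φ y ∈ W ∧ G.Adj (φ x) (φ y)
  other : ∀ x, x ∉ W → φ x ∈ W → ∃ z ∈ W, z ∉ S ∧ comp z ≠ comp (φ x) ∧ π z = π (φ x)

theorem Homogeneous.iff {V : Type*} {G : SimpleGraph V} {W : Finset V} {π : V → V} {k : V}
    (h : Homogeneous G W π k) {x y : V} (hx : x ∈ W) (hy : y ∈ W) (hxy : π x = π y) :
    G.Adj k x ↔ G.Adj k y := by
  rw [h x hx, h y hy, hxy]

section Absorb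

variable {V : Type*} [DecidableEq V] {G : SimpleGraph V} {S W K : Finset V} {comp : V → ℕ}
  {π φ ψ θ ν : V → V}

/-- The map `f` on `K`, and `g` elsewhere. -/
def override {V : Type*} [DecidableEq V] (K : Finset V) (f g : V → V) : V → V :=
  fun x => if x ∈ K then f x else g x

theorem Layout.mem_S_of_adj (hL : Layout G S W comp) {x y : V} (hx : x ∉ W) (hy : y ∈ W)
    (h : G.Adj x y) : y ∈ S := by
  by_contra hyS
  have hxS : x ∉ S := fun h => hx (hL.sub h)
  exact hx ((hL.mem x y hxS hyS (hL.adj x y hxS hyS h)).2 hy)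

theorem IsShadow.adj_of_adj (hL : Layout G S W comp) (hφ : IsShadow G S W comp π φ) {x y : V}
    (hx : φ x ∈ W) (hy : φ y ∈ W) (h : G.Adj x y) : G.Adj (φ x) (φ y) := by
  by_cases hxW : x ∈ W
  · by_cases hyW : y ∈ W
    · rwa [hφ.fix x hxW, hφ.fix y hyW]
    · have := hL.mem_S_of_adj hyW hxW h.symm
      rw [hφ.fix x hxW]
      exact ((hφ.adjS y hyW hy x this).1 h.symm).symm
  · by_cases hyW : y ∈ W
    · have := hL.mem_S_of_adj hxW hyW h
      rw [hφ.fix y hyW]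
      exact (hφ.adjS x hxW hx y this).1 h
    · exact (hφ.adj x hxW hx y hyW h).2

/-- A non-adjacent pair of vertices yields one in `W` that lies in the same parts: if the shadows of
the two vertices happen to be adjacent, then the part of one shadow contains a vertex of another
component. -/
theorem IsShadow.exists_not_adj (hL : Layout G S W comp) (hφ : IsShadow G S W comp π φ) {x y : V}
    (hx : φ x ∈ W) (hy : φ y ∈ W) (h : ¬ G.Adj x y) :
    ∃ x' ∈ W, ∃ y' ∈ W, π x' = π (φ x) ∧ π y' = π (φ y) ∧ ¬ G.Adj x' y' := by
  by_cases hadj : G.Adj (φ x) (φ y)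
  · have aux : ∀ x y, x ∉ W → φ x ∈ W → φ y ∈ W → G.Adj (φ x) (φ y) → ¬ G.Adj x y →
        ∃ x' ∈ W, ∃ y' ∈ W, π x' = π (φ x) ∧ π y' = π (φ y) ∧ ¬ G.Adj x' y' := by
      intro x y hxW hx hy hadj h
      have hyS : φ y ∉ S := by
        intro hyS
        by_cases hyW : y ∈ W
        · rw [hφ.fix y hyW] at hadj hyS
          exact h ((hφ.adjS x hxW hx y hyS).2 hadj)
        · exact hφ.notMem y hyW hy hyS
      obtain ⟨z, hzW, hzS, hz, hπ⟩ := hφ.other x hxW hx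
      refine ⟨z, hzW, φ y, hy, hπ, rfl, fun hzy => hz ?_⟩
      rw [hL.adj z (φ y) hzS hyS hzy, hL.adj (φ x) (φ y) (hφ.notMem x hxW hx) hyS hadj]
    by_cases hxW : x ∈ W
    · by_cases hyW : y ∈ W
      · rw [hφ.fix x hxW, hφ.fix y hyW] at hadj
        exact (h hadj).elim
      · obtain ⟨y', hy', x', hx', h1, h2, h3⟩ :=
          aux y x hyW hy hx hadj.symm fun h' => h h'.symm
        exact ⟨x', hx', y', hy', h2, h1, fun h' => h3 h'.symm⟩
    · exact aux x y hxW hx hy hadj h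
  · exact ⟨φ x, hx, φ y, hy, rfl, rfl, hadj⟩

/-- Red edges between parts with shadows in `W` are already red in the quotient of `G[W]`. -/
theorem IsShadow.redParts (hL : Layout G S W comp) (hφ : IsShadow G S W comp π φ)
    {U : Finset V} {ρ : V → V} {a b a' b' : V} (hab : a' ≠ b')
    (ha : ∀ x, ρ x = a → φ x ∈ W ∧ π (φ x) = a') (hb : ∀ x, ρ x = b → φ x ∈ W ∧ π (φ x) = b')
    (h : RedParts G U ρ a b) : RedParts G W π a' b' := by
  obtain ⟨-, ⟨x, -, y, -, hxa, hyb, h1⟩, ⟨x', -, y', -, hxa', hyb', h2⟩⟩ := h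
  refine ⟨hab, ⟨φ x, (ha x hxa).1, φ y, (hb y hyb).1, (ha x hxa).2, (hb y hyb).2,
    hφ.adj_of_adj hL (ha x hxa).1 (hb y hyb).1 h1⟩, ?_⟩
  obtain ⟨x'', hx'', y'', hy'', e1, e2, h3⟩ :=
    hφ.exists_not_adj hL (ha x' hxa').1 (hb y' hyb').1 h2
  exact ⟨x'', hx'', y'', hy'', e1.trans (ha x' hxa').2, e2.trans (hb y' hyb').2, h3⟩

/-- The absorption of a union of components off `W`. -/
theorem IsShadow.override (hφ : IsShadow G S W comp π φ)
    (hKW : ∀ k ∈ K, k ∉ W) (hK : ∀ k ∈ K, ∀ y, y ∉ W → G.Adj k y → y ∈ K)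
    (hψ : Absorbable G S W comp π K ψ) : IsShadow G S W comp π (override K ψ φ) := by
  have hin : ∀ x ∈ K, _root_.override K ψ φ x = ψ x := fun x hx => if_pos hx
  have hout : ∀ x, x ∉ K → _root_.override K ψ φ x = φ x := fun x hx => if_neg hx
  constructor
  · intro x hx
    rw [hout x fun h => hKW x h hx, hφ.fix x hx]
  · intro x
    by_cases hx : x ∈ K
    · rw [hin x hx]; exact Or.inr (hψ.mem x hx).1
    · rw [hout x hx]; exact hφ.or x
  · intro x hxW h
    by_cases hx : x ∈ K
    · rw [hin x hx]; exact (hψ.mem x hx).2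
    · rw [hout x hx] at h ⊢; exact hφ.notMem x hxW h
  · intro x hxW h
    by_cases hx : x ∈ K
    · rw [hin x hx]; exact hψ.adjS x hx
    · rw [hout x hx] at h ⊢; exact hφ.adjS x hxW h
  · intro x hxW h y hyW hadj
    by_cases hx : x ∈ K
    · have hy := hK x hx y hyW hadj
      rw [hin x hx, hin y hy]
      exact ⟨(hψ.mem y hy).1, (hψ.adj x hx y hy).1 hadj⟩
    · have hy : y ∉ K := fun hy => hx (hK y hy x hxW hadj.symm)
      rw [hout x hx] at h ⊢
      rw [hout y hy]
      exact hφ.adj x hxW h y hyW hadj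
  · intro x hxW h
    by_cases hx : x ∈ K
    · rw [hin x hx]; exact hψ.other x hx
    · rw [hout x hx] at h ⊢; exact hφ.other x hxW h

/-- The bound on the red degrees while `K` is being absorbed. The components absorbed before have
joined the parts of `π` (through `φ`). Inside `K` the parts are those of an earlier labelling `θ`,
carried over by `ψ`, and `ν` tells how they are named: a part of `K` either still stands alone,
named by one of its vertices, or, if `θ = π`, has joined the part of `W` that it corresponds to.

The factor 2 has two sources: the red neighbours with labels in `W` are red neighbours in the
quotient by `π` or by `θ`, and so are those with labels in `K`. -/
theorem thin_override [Fintype V] {t : ℕ} (hL : Layout G S W comp) (hπ : IsLabelling W π)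
    (hφ : IsShadow G S W comp π φ) (hKW : ∀ k ∈ K, k ∉ W)
    (hK : ∀ k ∈ K, ∀ y, y ∉ W → G.Adj k y → y ∈ K) (hψ : Absorbable G S W comp π K ψ)
    (hrest : ∀ x, φ x ∉ W → x ∉ K → Homogeneous G W π x)
    (htπ : Thin G W t π) (htθ : Thin G W t θ) (hθπ : ∀ x ∈ W, ∀ y ∈ W, θ x = θ y → π x = π y)
    (hν : ∀ k ∈ K, (ν (θ (ψ k)) ∈ K ∧ θ (ψ (ν (θ (ψ k)))) = θ (ψ k)) ∨
      (ν (θ (ψ k)) = θ (ψ k) ∧ θ = π)) :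
    Thin G Finset.univ (2 * t) (override K (fun x => ν (θ (ψ x))) (fun x => π (φ x))) := by
  classical
  set ρ := override K (fun x => ν (θ (ψ x))) (fun x => π (φ x)) with hρ
  have hin : ∀ x ∈ K, ρ x = ν (θ (ψ x)) := fun x hx => if_pos hx
  have hout : ∀ x, x ∉ K → ρ x = π (φ x) := fun x hx => if_neg hx
  have hsh := hφ.override hKW hK hψ
  set σ := override K ψ φ with hσ
  have hσin : ∀ x ∈ K, σ x = ψ x := fun x hx => if_pos hx
  have hσout : ∀ x, x ∉ K → σ x = φ x := fun x hx => if_neg hx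
  -- the members of a part whose label is in `W`
  have partW : ∀ a ∈ W, ∀ x, ρ x = a → σ x ∈ W ∧ π (σ x) = a := by
    intro a ha x hx
    by_cases hxK : x ∈ K
    · rw [hin x hxK] at hx
      rw [hσin x hxK]
      refine ⟨(hψ.mem x hxK).1, ?_⟩
      rcases hν x hxK with h | ⟨h, h'⟩
      · rw [hx] at h
        exact (hKW a h.1 ha).elim
      · rw [← h', ← h, hx]
    · rw [hout x hxK] at hx
      rw [hσout x hxK]
      refine ⟨?_, hx⟩
      by_contra hn
      rw [hπ.fix _ hn] at hx
      exact hn (hx ▸ ha)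
  -- the members of a part whose label is in `K`
  have partK : ∀ b ∈ K, ∀ y, ρ y = b → y ∈ K ∧ θ (ψ y) = θ (ψ b) := by
    intro b hb y hy
    by_cases hyK : y ∈ K
    · rw [hin y hyK] at hy
      refine ⟨hyK, ?_⟩
      rcases hν y hyK with ⟨-, h⟩ | ⟨h, -⟩
      · rw [← h, hy]
      · rcases hν y hyK with ⟨-, h2⟩ | ⟨-, h2⟩
        · rw [← h2, hy]
        · have h3 := (hπ.mem _ (hψ.mem y hyK).1)
          rw [← h2, ← h, hy] at h3
          exact (hKW b hb h3).elim
    · rw [hout y hyK] at hy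
      rcases hφ.or y with h | h
      · by_cases hyW : y ∈ W
        · rw [h] at hy
          exact (hKW b hb (hy ▸ hπ.mem y hyW)).elim
        · rw [h, hπ.fix y hyW] at hy
          exact (hyK (hy ▸ hb)).elim
      · exact (hKW b hb (hy ▸ hπ.mem _ h)).elim
  -- a vertex that is neither in `W` nor absorbed nor in `K` is a part of its own
  have partE : ∀ a, a ∉ W → a ∉ K → ∀ x, ρ x = a → x = a ∧ φ a = a ∧ a ∉ W := by
    intro a haW haK x hx
    by_cases hxK : x ∈ K
    · rw [hin x hxK] at hx
      rcases hν x hxK with h | ⟨h, h'⟩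
      · exact (haK (hx ▸ h.1)).elim
      · have := hπ.mem _ (hψ.mem x hxK).1
        rw [← h', ← h, hx] at this
        exact (haW this).elim
    · rw [hout x hxK] at hx
      rcases hφ.or x with h | h
      · by_cases hxW : x ∈ W
        · rw [h] at hx
          exact (haW (hx ▸ hπ.mem x hxW)).elim
        · rw [h, hπ.fix x hxW] at hx
          subst hx
          exact ⟨rfl, h, haW⟩
      · exact (haW (hx ▸ hπ.mem _ h)).elim
  -- no red edges at such a vertex
  have redE : ∀ a b, a ∉ W → a ∉ K → ¬ RedParts G Finset.univ ρ a b := by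
    rintro a b haW haK ⟨-, ⟨x, -, y, -, hxa, hyb, h1⟩, ⟨x', -, y', -, hxa', hyb', h2⟩⟩
    obtain ⟨e, hφa, -⟩ := partE a haW haK x hxa
    obtain ⟨e', -, -⟩ := partE a haW haK x' hxa'
    rw [e] at h1
    rw [e'] at h2
    have hhom := hrest a (by rw [hφa]; exact haW) haK
    by_cases hbW : b ∈ W
    · obtain ⟨hy, hyb⟩ := partW b hbW y hyb
      obtain ⟨hy', hyb'⟩ := partW b hbW y' hyb'
      have aux : ∀ y, y ∉ W → σ y ∈ W → ¬ G.Adj a y := by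
        intro y hyW hy hadj
        have := (hsh.adj y hyW hy a haW hadj.symm).1
        rw [hσout a haK, hφa] at this
        exact haW this
      have hyW : y ∈ W := by
        by_contra hyW
        exact aux y hyW hy h1
      rw [hsh.fix y hyW] at hyb hy
      have h3 := (hhom.iff hy hy' (hyb.trans hyb'.symm)).1 h1
      have hS := hL.mem_S_of_adj haW hy' h3
      have hyW' : y' ∈ W := by
        by_contra hyW'
        exact hsh.notMem y' hyW' hy' hS
      rw [hsh.fix y' hyW'] at h3
      exact h2 h3
    · by_cases hbK : b ∈ K
      · have hyK := (partK b hbK y hyb).1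
        exact haK (hK y hyK a haW h1.symm)
      · obtain ⟨e1, -, -⟩ := partE b hbW hbK y hyb
        obtain ⟨e2, -, -⟩ := partE b hbW hbK y' hyb'
        rw [e1] at h1
        rw [e2] at h2
        exact h2 h1
  have redWW : ∀ a ∈ W, ∀ b ∈ W, RedParts G Finset.univ ρ a b → RedParts G W π a b := by
    intro a ha b hb h
    exact hsh.redParts hL h.1 (partW a ha) (partW b hb) h
  have redKK : ∀ a ∈ K, ∀ b ∈ K, RedParts G Finset.univ ρ a b →
      RedParts G W θ (θ (ψ a)) (θ (ψ b)) := by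
    rintro a ha b hb ⟨hab, ⟨x, -, y, -, hxa, hyb, h1⟩, ⟨x', -, y', -, hxa', hyb', h2⟩⟩
    obtain ⟨hxK, hx⟩ := partK a ha x hxa
    obtain ⟨hyK, hy⟩ := partK b hb y hyb
    obtain ⟨hxK', hx'⟩ := partK a ha x' hxa'
    obtain ⟨hyK', hy'⟩ := partK b hb y' hyb'
    refine ⟨fun h => hab ?_, ⟨ψ x, (hψ.mem x hxK).1, ψ y, (hψ.mem y hyK).1, hx, hy,
      (hψ.adj x hxK y hyK).1 h1⟩, ⟨ψ x', (hψ.mem x' hxK').1, ψ y', (hψ.mem y' hyK').1, hx', hy',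
      fun h => h2 ((hψ.adj x' hxK' y' hyK').2 h)⟩⟩
    rw [← hxa, ← hyb, hin x hxK, hin y hyK, hx, hy, h]
  -- red edges between `W` and `K` come from red edges between the corresponding parts of `θ`
  have redWK : ∀ a ∈ W, ∀ b ∈ K, RedParts G Finset.univ ρ a b →
      RedParts G W θ (θ a) (θ (ψ b)) := by
    intro a ha b hb hred
    obtain ⟨hab, ⟨x, -, y, -, hxa, hyb, h1⟩, ⟨x', -, y', -, hxa', hyb', h2⟩⟩ := id hred
    obtain ⟨hxW, hx⟩ := partW a ha x hxa
    obtain ⟨hxW', hx'⟩ := partW a ha x' hxa'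
    obtain ⟨hyK, hy⟩ := partK b hb y hyb
    obtain ⟨hyK', hy'⟩ := partK b hb y' hyb'
    have ha' : π a = a := by rw [← hx, hπ.idem]
    by_cases hxK : x ∈ K
    · -- the part of `W` has absorbed a part of `K`
      obtain ⟨h3, h4⟩ : ν (θ (ψ x)) = θ (ψ x) ∧ θ = π := by
        rcases hν x hxK with h | h
        · rw [← hin x hxK, hxa] at h
          exact (hKW a h.1 ha).elim
        · exact h
      rw [h4, ha']
      refine hsh.redParts hL ?_ (partW a ha) (fun z hz => ?_) hred
      · intro h5
        have h6 : θ (ψ y) = θ (ψ x) := by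
          rw [hy, h4, ← h5, ← hx, hσin x hxK]
        exact hab (by rw [← hxa, ← hyb, hin x hxK, hin y hyK, h6])
      · obtain ⟨hz1, hz2⟩ := partK b hb z hz
        rw [hσin z hz1]
        exact ⟨(hψ.mem z hz1).1, by rw [← h4, hz2]⟩
    · -- the part of `W` has a vertex of `S`, hence no neighbour of `K` off `S`
      have hxS : x ∈ S := by
        by_contra hxS
        by_cases hxW0 : x ∈ W
        · exact hxS (hL.mem_S_of_adj (hKW y hyK) hxW0 h1.symm)
        · exact hxK (hK y hyK x hxW0 h1.symm)
      have hxW0 := hL.sub hxS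
      rw [hsh.fix x hxW0] at hx
      have haS : G.Adj y a := by
        rw [← ha', ← hx, hπ.idem]
        exact (hψ.homog y hyK x hxW0).1 h1.symm
      have haS' := hL.mem_S_of_adj (hKW y hyK) ha haS
      have hnot : ∀ k ∈ K, π (ψ k) ≠ a := by
        intro k hk h3
        have h4 := ((hψ.homog y hyK).iff (hψ.mem k hk).1 ha (h3.trans ha'.symm)).2 haS
        exact (hψ.mem k hk).2 (hL.mem_S_of_adj (hKW y hyK) (hψ.mem k hk).1 h4)
      have hxK' : x' ∉ K := by
        intro hxK'
        rw [hσin x' hxK'] at hx'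
        exact hnot x' hxK' hx'
      have hya' : ¬ G.Adj y' a := by
        intro h3
        have h4 := ((hψ.homog y' hyK').iff hxW' ha (hx'.trans ha'.symm)).2 h3
        have h5 := hL.mem_S_of_adj (hKW y' hyK') hxW' h4
        have h6 : x' ∈ W := by
          by_contra h6
          exact hsh.notMem x' h6 hxW' h5
        rw [hsh.fix x' h6] at h4
        exact h2 h4.symm
      refine ⟨fun h3 => ?_, ⟨a, ha, ψ y, (hψ.mem y hyK).1, rfl, hy,
        ((hψ.adjS y hyK a haS').1 haS).symm⟩, ⟨a, ha, ψ y', (hψ.mem y' hyK').1, rfl, hy',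
        fun h => hya' ((hψ.adjS y' hyK' a haS').2 h.symm)⟩⟩
      exact hnot b hb (by rw [← hθπ a ha _ (hψ.mem b hb).1 h3, ha'])
  have injK : ∀ b ∈ K, ∀ b' ∈ K, b ∈ Finset.univ.image ρ → b' ∈ Finset.univ.image ρ →
      θ (ψ b) = θ (ψ b') → b = b' := by
    intro b hb b' hb' h1 h2 h
    obtain ⟨y, -, hy⟩ := Finset.mem_image.1 h1
    obtain ⟨y', -, hy'⟩ := Finset.mem_image.1 h2
    obtain ⟨hyK, e⟩ := partK b hb y hy
    obtain ⟨hyK', e'⟩ := partK b' hb' y' hy'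
    rw [← hy, ← hy', hin y hyK, hin y' hyK', e, e', h]
  intro a F hF
  have hsplit : F = (F.filter fun b => b ∈ W) ∪ (F.filter fun b => b ∈ K) := by
    ext b
    simp only [Finset.mem_union, Finset.mem_filter]
    constructor
    · intro hb
      by_cases hbW : b ∈ W
      · exact Or.inl ⟨hb, hbW⟩
      · by_cases hbK : b ∈ K
        · exact Or.inr ⟨hb, hbK⟩
        · exact (redE b a hbW hbK (hF b hb).symm).elim
    · rintro (h | h) <;> exact h.1
  have hcK : (F.filter fun b => b ∈ K).card ≤ t := by
    have himg : ((F.filter fun b => b ∈ K).image fun b => θ (ψ b)).card =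
        (F.filter fun b => b ∈ K).card := by
      apply Finset.card_image_of_injOn
      intro b hb b' hb' h
      simp only [Finset.coe_filter, Set.mem_ofPred_eq] at hb hb'
      exact injK b hb.2 b' hb'.2 (hF b hb.1).mem_right (hF b' hb'.1).mem_right h
    rw [← himg]
    by_cases haW : a ∈ W
    · refine htθ (θ a) _ fun c hc => ?_
      obtain ⟨b, hb, rfl⟩ := Finset.mem_image.1 hc
      obtain ⟨hbF, hbK⟩ := Finset.mem_filter.1 hb
      exact redWK a haW b hbK (hF b hbF)
    · refine htθ (θ (ψ a)) _ fun c hc => ?_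
      obtain ⟨b, hb, rfl⟩ := Finset.mem_image.1 hc
      obtain ⟨hbF, hbK⟩ := Finset.mem_filter.1 hb
      by_cases haK : a ∈ K
      · exact redKK a haK b hbK (hF b hbF)
      · exact (redE a b haW haK (hF b hbF)).elim
  have hcW : (F.filter fun b => b ∈ W).card ≤ t := by
    by_cases haW : a ∈ W
    · refine htπ a _ fun b hb => ?_
      obtain ⟨hbF, hbW⟩ := Finset.mem_filter.1 hb
      exact redWW a haW b hbW (hF b hbF)
    · have himg : ((F.filter fun b => b ∈ W).image θ).card = (F.filter fun b => b ∈ W).card := by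
        apply Finset.card_image_of_injOn
        intro b hb b' hb' h
        simp only [Finset.coe_filter, Set.mem_ofPred_eq] at hb hb'
        have aux : ∀ b ∈ F, b ∈ W → π b = b := by
          intro b hb hbW
          obtain ⟨y, -, hy⟩ := Finset.mem_image.1 (hF b hb).mem_right
          rw [← (partW b hbW y hy).2, hπ.idem]
        rw [← aux b hb.1 hb.2, ← aux b' hb'.1 hb'.2]
        exact hθπ b hb.2 b' hb'.2 h
      rw [← himg]
      refine htθ (θ (ψ a)) _ fun c hc => ?_
      obtain ⟨b, hb, rfl⟩ := Finset.mem_image.1 hc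
      obtain ⟨hbF, hbW⟩ := Finset.mem_filter.1 hb
      by_cases haK : a ∈ K
      · exact (redWK b hbW a haK (hF b hbF).symm).symm
      · exact (redE a b haW haK (hF b hbF)).elim
  rw [hsplit]
  refine (Finset.card_union_le _ _).trans ?_
  omega

end Absorb

/-! ### The contractions that absorb a component -/

/-- Bookkeeping while the contractions of `W` are repeated on a copy: `R u` is the label of the part
of the copy that corresponds to the part `u` of `W`, if there is one. This is the table after the
contraction `c`. -/
def mimicTable {V : Type*} [DecidableEq V] (R : V → Option V) (c : V × V) : V → Option V :=
  Function.update (Function.update R c.1 ((R c.1).or (R c.2))) c.2 none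

/-- The contraction of the copy that corresponds to the contraction `c` of `W`, if both parts meet
the copied component. -/
def mimicStep {V : Type*} (R : V → Option V) (c : V × V) : List (V × V) :=
  match R c.1, R c.2 with
  | some a, some b => [(a, b)]
  | _, _ => []

/-- The contractions of the copy that correspond to a list of contractions of `W`. -/
def mimicList {V : Type*} [DecidableEq V] : (V → Option V) → List (V × V) → List (V × V)
  | _, [] => []
  | R, c :: C => mimicStep R c ++ mimicList (mimicTable R c) C

/-- The contraction that joins the part of the copy to the corresponding part `u` of `W`. -/
def joinStep {V : Type*} (R : V → Option V) (u : V) : List (V × V) :=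
  match R u with
  | some k => [(u, k)]
  | none => []

/-- The contractions that join all parts of the copy to the corresponding parts of `W`. -/
def joinList {V : Type*} [DecidableEq V] : (V → Option V) → List V → List (V × V)
  | _, [] => []
  | R, u :: l => joinStep R u ++ joinList (Function.update R u none) l

/-- All contractions that absorb a component: first its parts are contracted like those of its
image, then they are joined to the parts of `W`. -/
def absorbList {V : Type*} [DecidableEq V] (R : V → Option V) (C : List (V × V)) (l : List V) :
    List (V × V) :=
  mimicList R C ++ joinList (C.foldl mimicTable R) l

theorem IsLabelling.id {V : Type*} (W : Finset V) : IsLabelling W (id : V → V) :=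
  ⟨fun _ h => h, fun _ => rfl, fun _ _ => rfl⟩

section Labelling

variable {V : Type*} [DecidableEq V] {G : SimpleGraph V} {W : Finset V} {ρ : V → V}

theorem IsLabelling.merge (h : IsLabelling W ρ) {u v : V} (hu : u ∈ W.image ρ)
    (hv : v ∈ W.image ρ) (huv : u ≠ v) : IsLabelling W (merge ρ u v) := by
  obtain ⟨x, hx, rfl⟩ := Finset.mem_image.1 hu
  obtain ⟨y, hy, rfl⟩ := Finset.mem_image.1 hv
  refine ⟨fun z hz => ?_, fun z => ?_, fun z hz => ?_⟩
  · unfold _root_.merge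
    split_ifs
    · exact h.mem x hx
    · exact h.mem z hz
  · unfold _root_.merge
    split_ifs with h1 h2 h2
    · rfl
    · rw [h.idem]
    · rw [h.idem] at h2; exact (h1 h2).elim
    · rw [h.idem]
  · unfold _root_.merge
    rw [h.fix z hz, if_neg]
    rintro rfl
    exact hz (h.mem y hy)

theorem IsLabelling.mergeAll {t : ℕ} {C : List (V × V)} (h : IsLabelling W ρ)
    (hC : Steps G W t ρ C) : IsLabelling W (mergeAll ρ C) := by
  induction C generalizing ρ with
  | nil => exact h
  | cons c C ih =>
    obtain ⟨-, hu, hv, huv, hC⟩ := hC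
    exact ih (h.merge hu hv huv) hC

theorem mergeAll_congr (C : List (V × V)) {x y : V} (h : ρ x = ρ y) :
    mergeAll ρ C x = mergeAll ρ C y := by
  induction C generalizing ρ with
  | nil => exact h
  | cons c C ih =>
    apply ih
    simp only [merge, h]

theorem Steps.thin_mergeAll {t : ℕ} {C : List (V × V)} (hC : Steps G W t ρ C) :
    Thin G W t (mergeAll ρ C) := by
  rw [← List.append_nil C, steps_append] at hC
  exact hC.2

end Labelling

section Mimic

variable {V : Type*} [DecidableEq V] {G : SimpleGraph V} {S W K : Finset V} {comp : V → ℕ}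
  {π φ ψ θ : V → V} {R : V → Option V}

/-- The labelling during the absorption of `K`: a part of `K` is labelled by the entry of the table
`R` at the corresponding part of `W`, or, without an entry, by the label of that part, which it has
joined. -/
def tableLabelling {V : Type*} [DecidableEq V] (K : Finset V) (π φ ψ θ : V → V) (R : V → Option V) :
    V → V :=
  override K (fun x => (R (θ (ψ x))).getD (θ (ψ x))) (fun x => π (φ x))

/-- The entries of the table `R` are labels of parts of `K`. -/
def IsTable {V : Type*} (K : Finset V) (ψ θ : V → V) (R : V → Option V) : Prop :=
  ∀ u k, R u = some k → k ∈ K ∧ θ (ψ k) = u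

/-- All that `thin_override` asks of `K` and `ψ`, and of the vertices that stay unabsorbed. -/
structure CanAbsorb (G : SimpleGraph V) (S W : Finset V) (comp : V → ℕ) (t : ℕ) (π φ : V → V)
    (K : Finset V) (ψ : V → V) : Prop where
  layout : Layout G S W comp
  labelling : IsLabelling W π
  shadow : IsShadow G S W comp π φ
  notMem : ∀ k ∈ K, k ∉ W
  fix : ∀ k ∈ K, φ k = k
  closed : ∀ k ∈ K, ∀ y, y ∉ W → G.Adj k y → y ∈ K
  absorbable : Absorbable G S W comp π K ψ
  rest : ∀ x, φ x ∉ W → x ∉ K → Homogeneous G W π x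
  thin : Thin G W t π

theorem CanAbsorb.notMem_of_notMem {t : ℕ} (h : CanAbsorb G S W comp t π φ K ψ) {x : V}
    (hx : x ∉ K) : π (φ x) ∉ K := by
  intro hk
  by_cases hW : φ x ∈ W
  · exact h.notMem _ hk (h.labelling.mem _ hW)
  · rw [h.labelling.fix _ hW] at hk
    rcases h.shadow.or x with h' | h'
    · exact hx (h' ▸ hk)
    · exact hW h'

theorem IsTable.mimicTable (hR : IsTable K ψ θ R) {u v : V} (huv : u ≠ v) :
    IsTable K ψ (merge θ u v) (mimicTable R (u, v)) := by
  intro w k hk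
  unfold _root_.mimicTable at hk
  simp only [Function.update_apply] at hk
  split_ifs at hk with h1 h2
  · subst h2
    unfold merge
    cases hRu : R w with
    | some a =>
      rw [hRu] at hk
      simp only [Option.some_or, Option.some.injEq] at hk
      subst hk
      obtain ⟨h3, h4⟩ := hR w a hRu
      exact ⟨h3, by rw [h4, if_neg huv]⟩
    | none =>
      rw [hRu, Option.none_or] at hk
      obtain ⟨h3, h4⟩ := hR v k hk
      exact ⟨h3, if_pos h4⟩
  · obtain ⟨h3, h4⟩ := hR w k hk
    unfold merge
    exact ⟨h3, by rw [h4, if_neg h1]⟩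

theorem mimicTable_isSome (hR : ∀ k ∈ K, (R (θ (ψ k))).isSome) {u v : V} (huv : u ≠ v) :
    ∀ k ∈ K, (mimicTable R (u, v) (merge θ u v (ψ k))).isSome := by
  intro k hk
  have := hR k hk
  unfold mimicTable merge
  simp only [Function.update_apply]
  by_cases h1 : θ (ψ k) = v
  · rw [h1] at this
    simp [h1, huv, this]
  · simp only [h1, if_false]
    by_cases h2 : θ (ψ k) = u
    · rw [h2] at this
      simp [h2, this]
    · simp [h2, this]

/-- The two phases of an absorption: either all parts of `K` still have labels of their own, and `θ`
is the labelling that is being repeated on `K`; or `θ` has reached `π`, and some parts of `K` have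
joined those of `W`. -/
theorem CanAbsorb.thin_table [Fintype V] {t : ℕ} (h : CanAbsorb G S W comp t π φ K ψ)
    (htθ : Thin G W t θ) (hθπ : ∀ x ∈ W, ∀ y ∈ W, θ x = θ y → π x = π y) (hR : IsTable K ψ θ R)
    (hor : (∀ k ∈ K, (R (θ (ψ k))).isSome) ∨ θ = π) :
    Thin G Finset.univ (2 * t) (tableLabelling K π φ ψ θ R) := by
  refine thin_override (ν := fun u => (R u).getD u) h.layout h.labelling h.shadow h.notMem
    h.closed h.absorbable h.rest h.thin htθ hθπ fun k hk => ?_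
  cases hRk : R (θ (ψ k)) with
  | some k' =>
    left
    have := hR _ k' hRk
    simpa using this
  | none =>
    right
    rcases hor with hor | hor
    · have := hor k hk
      rw [hRk] at this
      simp at this
    · exact ⟨rfl, hor⟩

/-- A contraction of `W` in which only one of the two parts meets the image of `K` changes the
table, but not the labelling; nothing has to be contracted then. -/
theorem CanAbsorb.steps_mimicList [Fintype V] {t : ℕ} (h : CanAbsorb G S W comp t π φ K ψ)
    {C : List (V × V)} (hC : Steps G W t θ C) (hθ : mergeAll θ C = π) (hR : IsTable K ψ θ R)
    (hR' : ∀ k ∈ K, (R (θ (ψ k))).isSome) :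
    Steps G Finset.univ (2 * t) (tableLabelling K π φ ψ θ R) (mimicList R C) ∧
      mergeAll (tableLabelling K π φ ψ θ R) (mimicList R C) =
        tableLabelling K π φ ψ π (C.foldl mimicTable R) ∧
      IsTable K ψ π (C.foldl mimicTable R) := by
  have hθπ : ∀ x ∈ W, ∀ y ∈ W, θ x = θ y → π x = π y := by
    intro x _ y _ hxy
    rw [← hθ]
    exact mergeAll_congr C hxy
  have thin := h.thin_table hC.thin hθπ hR (Or.inl hR')
  induction C generalizing θ R with
  | nil =>
    simp only [mergeAll, List.foldl] at hθ
    subst hθ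
    exact ⟨thin, rfl, hR⟩
  | cons c C ih =>
    obtain ⟨u, v⟩ := c
    obtain ⟨-, hu, hv, huv, hC⟩ := hC
    have hR1 := hR.mimicTable huv
    have hR2 := mimicTable_isSome hR' huv
    have hθπ' : ∀ x ∈ W, ∀ y ∈ W, merge θ u v x = merge θ u v y → π x = π y := by
      intro x _ y _ hxy
      rw [← hθ]
      exact mergeAll_congr (ρ := merge θ u v) C hxy
    obtain ⟨ih1, ih2, ih3⟩ := ih hC hθ hR1 hR2 hθπ'
      (h.thin_table hC.thin hθπ' hR1 (Or.inl hR2))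
    have hmerge : (∀ a b, R u = some a → R v = some b →
        tableLabelling K π φ ψ (merge θ u v) (mimicTable R (u, v)) =
          merge (tableLabelling K π φ ψ θ R) a b) ∧ (R u = none ∨ R v = none →
        tableLabelling K π φ ψ (merge θ u v) (mimicTable R (u, v)) =
          tableLabelling K π φ ψ θ R) := by
      constructor
      · intro a b ha hb
        funext x
        unfold tableLabelling override
        by_cases hx : x ∈ K
        · simp only [hx, if_true, merge, mimicTable, Function.update_apply, ha, hb]
          by_cases h1 : θ (ψ x) = v
          · simp [h1, huv, hb]
          · by_cases h2 : θ (ψ x) = u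
            · simp only [h2, huv, if_false, ha]
              have : a ≠ b := by
                rintro rfl
                exact huv ((hR u a ha).2.symm.trans (hR v a hb).2)
              simp [this]
            · simp only [h1, h2, if_false]
              obtain ⟨k', hk'⟩ := Option.isSome_iff_exists.1 (hR' x hx)
              rw [hk']
              simp only [Option.getD_some]
              rw [if_neg]
              rintro rfl
              exact h1 ((hR _ k' hk').2.symm.trans (hR v k' hb).2)
        · simp only [hx, if_false, merge]
          rw [if_neg]
          rintro h3
          exact h.notMem_of_notMem hx (h3 ▸ (hR v b hb).1)
      · intro hnone
        funext x
        unfold tableLabelling override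
        by_cases hx : x ∈ K
        · obtain ⟨k', hk'⟩ := Option.isSome_iff_exists.1 (hR' x hx)
          simp only [hx, if_true, merge, mimicTable, Function.update_apply]
          by_cases h1 : θ (ψ x) = v
          · rw [h1] at hk'
            rcases hnone with h2 | h2
            · simp [h1, huv, h2, hk']
            · rw [h2] at hk'; simp at hk'
          · by_cases h2 : θ (ψ x) = u
            · rw [h2] at hk'
              simp [h2, huv, hk']
            · simp [h1, h2]
        · simp [hx]
    rw [mimicList, List.foldl]
    cases ha : R u with
    | none =>
      have hs : mimicStep R (u, v) = [] := by simp [mimicStep, ha]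
      rw [hs, List.nil_append, ← hmerge.2 (Or.inl ha)]
      exact ⟨ih1, ih2, ih3⟩
    | some a =>
      cases hb : R v with
      | none =>
        have hs : mimicStep R (u, v) = [] := by simp [mimicStep, hb]
        rw [hs, List.nil_append, ← hmerge.2 (Or.inr hb)]
        exact ⟨ih1, ih2, ih3⟩
      | some b =>
        have hs : mimicStep R (u, v) = [(a, b)] := by simp [mimicStep, ha, hb]
        rw [hs, List.cons_append, List.nil_append, mergeAll_cons, Steps,
          ← hmerge.1 a b ha hb]
        have him : ∀ w k, R w = some k → k ∈ Finset.univ.image (tableLabelling K π φ ψ θ R) := by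
          intro w k hk
          obtain ⟨h1, h2⟩ := hR w k hk
          refine Finset.mem_image.2 ⟨k, Finset.mem_univ _, ?_⟩
          simp [tableLabelling, override, h1, h2, hk]
        refine ⟨⟨thin, him u a ha, him v b hb, ?_, ih1⟩, ih2, ih3⟩
        rintro rfl
        exact huv ((hR u a ha).2.symm.trans (hR v a hb).2)

theorem CanAbsorb.steps_joinList [Fintype V] {t : ℕ} (h : CanAbsorb G S W comp t π φ K ψ)
    (l : List V) (hR : IsTable K ψ π R) (hl : ∀ u, u ∉ l → R u = none) :
    Steps G Finset.univ (2 * t) (tableLabelling K π φ ψ π R) (joinList R l) ∧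
      mergeAll (tableLabelling K π φ ψ π R) (joinList R l) = π ∘ override K ψ φ := by
  have thin := h.thin_table h.thin (fun _ _ _ _ h => h) hR (Or.inr rfl)
  induction l generalizing R with
  | nil =>
    refine ⟨thin, ?_⟩
    funext x
    have : R (π (ψ x)) = none := hl _ (by simp)
    simp only [joinList, mergeAll, List.foldl, tableLabelling, override, this, Option.getD_none,
      Function.comp]
    split_ifs <;> rfl
  | cons u l ih =>
    have hR1 : IsTable K ψ π (Function.update R u none) := by
      intro w k hk
      rw [Function.update_apply] at hk
      split_ifs at hk
      exact hR w k hk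
    have hl1 : ∀ w, w ∉ l → Function.update R u none w = none := by
      intro w hw
      rw [Function.update_apply]
      split_ifs with h1
      · rfl
      · exact hl w (by simp [h1, hw])
    obtain ⟨ih1, ih2⟩ := ih hR1 hl1 (h.thin_table h.thin (fun _ _ _ _ h => h) hR1 (Or.inr rfl))
    rw [joinList]
    cases ha : R u with
    | none =>
      have : Function.update R u none = R := by rw [← ha, Function.update_eq_self]
      rw [this] at ih1 ih2 ⊢
      simpa [joinStep, ha] using ⟨ih1, ih2⟩
    | some k =>
      obtain ⟨hkK, hku⟩ := hR u k ha
      have huW : u ∈ W := hku ▸ h.labelling.mem _ (h.absorbable.mem k hkK).1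
      have huK : u ∉ K := fun hu => h.notMem u hu huW
      have huk : u ≠ k := fun hh => huK (hh ▸ hkK)
      have hmerge : tableLabelling K π φ ψ π (Function.update R u none) =
          merge (tableLabelling K π φ ψ π R) u k := by
        funext x
        unfold tableLabelling override
        by_cases hx : x ∈ K
        · simp only [hx, if_true, merge, Function.update_apply]
          by_cases h2 : π (ψ x) = u
          · simp [h2, ha]
          · simp only [h2, if_false]
            rw [if_neg]
            intro h3
            cases hRx : R (π (ψ x)) with
            | none =>
              rw [hRx] at h3
              simp only [Option.getD_none] at h3
              exact h.notMem k hkK (h3 ▸ h.labelling.mem _ (h.absorbable.mem x hx).1)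
            | some k' =>
              rw [hRx] at h3
              simp only [Option.getD_some] at h3
              subst h3
              exact h2 ((hR _ _ hRx).2.symm.trans hku)
        · simp only [hx, if_false, merge]
          rw [if_neg]
          rintro h3
          exact h.notMem_of_notMem hx (h3 ▸ hkK)
      have hs : joinStep R u = [(u, k)] := by simp [joinStep, ha]
      rw [hs, List.cons_append, List.nil_append, mergeAll_cons, Steps, ← hmerge]
      refine ⟨⟨thin, Finset.mem_image.2 ⟨u, Finset.mem_univ _, ?_⟩,
        Finset.mem_image.2 ⟨k, Finset.mem_univ _, ?_⟩, huk, ih1⟩, ih2⟩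
      · simp only [tableLabelling, override, huK, if_false, h.shadow.fix u huW]
        rw [← hku, h.labelling.idem]
      · simp [tableLabelling, override, hkK, hku, ha]

/-- The contractions of `absorbList` lead from the quotient in which `K` is not absorbed to the one
in which it is, with red degrees at most `2 * t`. -/
theorem CanAbsorb.steps_absorbList [Fintype V] {t : ℕ} (h : CanAbsorb G S W comp t π φ K ψ)
    {C : List (V × V)} (hC : Steps G W t id C) (hπ : mergeAll id C = π)
    (hR : ∀ u k, R u = some k ↔ k ∈ K ∧ ψ k = u) {l : List V} (hl : ∀ u, u ∈ l) :
    Steps G Finset.univ (2 * t) (π ∘ φ) (absorbList R C l) ∧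
      mergeAll (π ∘ φ) (absorbList R C l) = π ∘ override K ψ φ := by
  have h0 : tableLabelling K π φ ψ id R = π ∘ φ := by
    funext x
    unfold tableLabelling override
    by_cases hx : x ∈ K
    · simp only [hx, if_true, id, (hR (ψ x) x).2 ⟨hx, rfl⟩, Option.getD_some, Function.comp]
      rw [h.fix x hx, h.labelling.fix x (h.notMem x hx)]
    · simp [hx]
  obtain ⟨h1, h2, h3⟩ := h.steps_mimicList hC hπ (fun u k hk => (hR u k).1 hk)
    (fun k hk => by simp only [id]; rw [(hR (ψ k) k).2 ⟨hk, rfl⟩]; rfl)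
  obtain ⟨h4, h5⟩ := h.steps_joinList l h3 fun u hu => (hu (hl u)).elim
  rw [h0] at h1 h2
  unfold absorbList
  rw [steps_append, mergeAll_append, h2]
  exact ⟨⟨h1, h4⟩, h5⟩

end Mimic

/-! ### The sequence that contracts everything into one vertex -/

/-- The contractions that join all vertices of a list to its first vertex. -/
def starList {V : Type*} : List V → List (V × V)
  | [] => []
  | b :: l => l.map fun v => (b, v)

section Star

variable {V : Type*} [DecidableEq V] {G : SimpleGraph V} {S : Finset V}

theorem thin_star [Fintype V] {p : ℕ} (hp : 1 ≤ p) {A : List V} {b : V} (hb : b ∈ A)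
    (h : ∀ F : Finset V, (∀ y ∈ F, y ∉ A ∧ ∃ x ∈ A, G.Adj x y) → F.card ≤ p) :
    Thin G Finset.univ p (fun x => if x ∈ A then b else x) := by
  have hlab : ∀ a x, a ≠ b → (if x ∈ A then b else x) = a → x = a ∧ a ∉ A := by
    intro a x ha hx
    split_ifs at hx with h1
    · exact (ha hx.symm).elim
    · exact ⟨hx, hx ▸ h1⟩
  have hb' : ∀ x, (if x ∈ A then b else x) = b → x ∈ A := by
    intro x hx
    split_ifs at hx with h1
    · exact h1
    · exact hx ▸ hb
  intro a F hF
  by_cases hab : a = b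
  · subst hab
    refine h F fun y hy => ?_
    obtain ⟨hay, ⟨x, -, z, -, hxa, hzy, hadj⟩, -⟩ := hF y hy
    obtain ⟨rfl, h2⟩ := hlab y z hay.symm hzy
    exact ⟨h2, x, hb' x hxa, hadj⟩
  · refine le_trans (Finset.card_le_card (t := {b}) fun c hc => ?_) (by simpa using hp)
    rw [Finset.mem_singleton]
    by_contra hcb
    obtain ⟨-, ⟨x, -, z, -, hxa, hzy, hadj⟩, ⟨x', -, z', -, hxa', hzy', hadj'⟩⟩ := hF c hc
    obtain ⟨rfl, -⟩ := hlab a x hab hxa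
    obtain ⟨rfl, -⟩ := hlab c z hcb hzy
    obtain ⟨rfl, -⟩ := hlab _ x' hab hxa'
    obtain ⟨rfl, -⟩ := hlab _ z' hcb hzy'
    exact hadj' hadj

/-- Every component is named by `key`, whose values are below `N` off `S`; on `S` it is `N`, so that
`S` comes last. If the list runs through the components of `G - S` one by one, and then through `S`,
all red edges go from the first vertex to `S` and to at most one component. -/
theorem steps_starList [Fintype V] {p N : ℕ} {key : V → ℕ} (hp : 1 ≤ p)
    (hkS : ∀ x ∈ S, key x = N) (hkN : ∀ x, x ∉ S → key x < N)
    (hadj : ∀ x y, x ∉ S → y ∉ S → G.Adj x y → key x = key y)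
    (hcard : ∀ c, ((Finset.univ.filter fun y => y ∉ S ∧ key y = c) ∪ S).card ≤ p)
    {l : List V} (hnd : l.Nodup) (hmem : ∀ x, x ∈ l) (hsort : l.Pairwise fun x y => key x ≤ key y)
    (hne : l ≠ []) :
    Steps G Finset.univ p id (starList l) ∧
      (Finset.univ.image (mergeAll id (starList l))).card = 1 := by
  have hthin : ∀ A B : List V, A ++ B = l →
      ∀ F : Finset V, (∀ y ∈ F, y ∉ A ∧ ∃ x ∈ A, G.Adj x y) → F.card ≤ p := by
    intro A B hAB F hF
    rw [← hAB, List.pairwise_append] at hsort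
    have hle : ∀ y ∈ F, ∀ x ∈ A, key x ≤ key y := by
      intro y hy x hx
      have : y ∈ A ++ B := hAB ▸ hmem y
      exact hsort.2.2 x hx y ((List.mem_append.1 this).resolve_left (hF y hy).1)
    have hSle : S.card ≤ p := le_trans (Finset.card_le_card Finset.subset_union_right) (hcard 0)
    have hnS : ∀ y ∈ F, y ∉ S → ∀ x ∈ A, x ∉ S := by
      intro y hy hyS x hx hxS
      have h1 := hle y hy x hx
      rw [hkS x hxS] at h1
      exact absurd (hkN y hyS) (not_lt.2 h1)
    by_cases hall : ∀ y ∈ F, y ∈ S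
    · exact (Finset.card_le_card hall).trans hSle
    · push Not at hall
      obtain ⟨y0, hy0, hy0S⟩ := hall
      refine le_trans (Finset.card_le_card fun y hy => ?_) (hcard (key y0))
      by_cases hyS : y ∈ S
      · exact Finset.mem_union_right _ hyS
      · obtain ⟨-, x, hx, hxy⟩ := hF y hy
        obtain ⟨-, x0, hx0, hxy0⟩ := hF y0 hy0
        have e1 := hadj x y (hnS y hy hyS x hx) hyS hxy
        have e2 := hadj x0 y0 (hnS y hy hyS x0 hx0) hy0S hxy0
        have h1 := hle y hy x0 hx0
        have h2 := hle y0 hy0 x hx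
        refine Finset.mem_union_left _ (Finset.mem_filter.2 ⟨Finset.mem_univ _, hyS, ?_⟩)
        omega
  cases l with
  | nil => exact (hne rfl).elim
  | cons b l =>
    have main : ∀ B A : List V, b ∈ A → A ++ B = b :: l →
        Steps G Finset.univ p (fun x => if x ∈ A then b else x) (B.map fun v => (b, v)) ∧
        mergeAll (fun x => if x ∈ A then b else x) (B.map fun v => (b, v)) = fun _ => b := by
      intro B
      induction B with
      | nil =>
        intro A hbA hAB
        refine ⟨thin_star hp hbA (hthin A [] hAB), ?_⟩
        funext x
        have : x ∈ A := by
          rw [List.append_nil] at hAB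
          exact hAB ▸ hmem x
        simp [mergeAll, this]
      | cons v B ih =>
        intro A hbA hAB
        have hvA : v ∉ A := by
          intro hv
          rw [← hAB, List.nodup_append] at hnd
          exact hnd.2.2 v hv v (by simp) rfl
        have hbv : b ≠ v := fun h => hvA (h ▸ hbA)
        have hm : merge (fun x => if x ∈ A then b else x) b v =
            fun x => if x ∈ A ++ [v] then b else x := by
          funext x
          unfold merge
          simp only [List.mem_append, List.mem_singleton]
          by_cases h1 : x ∈ A
          · simp [h1, hbv]
          · simp [h1]
        obtain ⟨ih1, ih2⟩ := ih (A ++ [v]) (by simp [hbA]) (by simpa using hAB)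
        rw [List.map_cons, mergeAll_cons, Steps, hm]
        refine ⟨⟨thin_star hp hbA (hthin A _ hAB), Finset.mem_image.2 ⟨b, Finset.mem_univ _, ?_⟩,
          Finset.mem_image.2 ⟨v, Finset.mem_univ _, ?_⟩, hbv, ih1⟩, ih2⟩
        · simp [hbA]
        · simp [hvA]
    obtain ⟨h1, h2⟩ := main l [b] (by simp) rfl
    have hid : (fun x => if x ∈ [b] then b else x) = (id : V → V) := by
      funext x
      by_cases hx : x = b <;> simp [hx]
    rw [hid] at h1 h2
    refine ⟨h1, ?_⟩
    change (Finset.univ.image (mergeAll id (l.map fun v => (b, v)))).card = 1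
    rw [h2, Finset.card_eq_one]
    refine ⟨b, ?_⟩
    ext x
    simp only [Finset.mem_image, Finset.mem_univ, true_and, Finset.mem_singleton]
    exact ⟨fun ⟨_, h⟩ => h.symm, fun h => ⟨b, h.symm⟩⟩

end Star

/-! ### Components and their labels -/

/-- `comp` assigns the same label to two vertices off `S` exactly if they are in one component of
`G - S`. The labels of the vertices of `S` are arbitrary. -/
def IsComponentLabel {V : Type*} (G : SimpleGraph V) (S : Finset V) (comp : V → ℕ) : Prop :=
  ∀ x y : ((S : Set V)ᶜ : Set V), comp x = comp y ↔ (G.induce ((S : Set V)ᶜ)).Reachable x y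

/-- The vertices off `S` with label `c`. -/
def block {V : Type*} [Fintype V] [DecidableEq V] (S : Finset V) (comp : V → ℕ) (c : ℕ) :
    Finset V :=
  Finset.univ.filter fun y => y ∉ S ∧ comp y = c

theorem IsComponentLabel.of_adj {V : Type*} {G : SimpleGraph V} {S : Finset V}
    {comp : V → ℕ} (h : IsComponentLabel G S comp) {x y : V} (hx : x ∉ S) (hy : y ∉ S)
    (hxy : G.Adj x y) : comp x = comp y := by
  refine (h ⟨x, by simpa using hx⟩ ⟨y, by simpa using hy⟩).2 (SimpleGraph.Adj.reachable ?_)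
  exact hxy

section Blocks

variable {V : Type*} [Fintype V] [DecidableEq V] {G : SimpleGraph V} {S W : Finset V}
  {comp : V → ℕ}

theorem mem_block {c : ℕ} {x : V} : x ∈ block S comp c ↔ x ∉ S ∧ comp x = c := by
  simp [block]

theorem IsComponentLabel.mem_componentsOff_iff (h : IsComponentLabel G S comp) {H : Set V} :
    H ∈ componentsOff G S ↔ ∃ x, x ∉ S ∧ H = block S comp (comp x) := by
  have key : ∀ x : ((S : Set V)ᶜ : Set V), Subtype.val ''
      ((G.induce ((S : Set V)ᶜ)).connectedComponentMk x).supp =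
        (block S comp (comp x) : Set V) := by
    intro x
    ext y
    simp only [Set.mem_image, SimpleGraph.ConnectedComponent.mem_supp_iff, Subtype.exists,
      Finset.mem_coe, mem_block, exists_and_right, exists_eq_right]
    constructor
    · rintro ⟨hy, h1⟩
      exact ⟨by simpa using hy, (h ⟨y, hy⟩ x).2 (SimpleGraph.ConnectedComponent.eq.1 h1)⟩
    · rintro ⟨hy, h1⟩
      have hy' : y ∈ ((S : Set V)ᶜ : Set V) := by simpa using hy
      exact ⟨hy', SimpleGraph.ConnectedComponent.eq.2 ((h ⟨y, hy'⟩ x).1 h1)⟩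
  constructor
  · rintro ⟨c, rfl⟩
    induction c using SimpleGraph.ConnectedComponent.ind with
    | h x => exact ⟨x, fun hx => x.2 (Finset.mem_coe.2 hx), key x⟩
  · rintro ⟨x, hx, rfl⟩
    exact ⟨(G.induce ((S : Set V)ᶜ)).connectedComponentMk ⟨x, by simpa using hx⟩, key _⟩

theorem IsComponentLabel.exists_adj (h : IsComponentLabel G S comp) {x : V}
    {A : Finset V} (hA : A ⊆ block S comp (comp x)) (hAne : A.Nonempty)
    (hA' : A ≠ block S comp (comp x)) :
    ∃ k ∈ A, ∃ k' ∈ block S comp (comp x), k' ∉ A ∧ G.Adj k k' := by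
  by_contra hcon
  push Not at hcon
  obtain ⟨a, ha⟩ := hAne
  obtain ⟨haS, hax⟩ := mem_block.1 (hA ha)
  refine hA' (Finset.Subset.antisymm hA fun y hy => ?_)
  obtain ⟨hyS, hyx⟩ := mem_block.1 hy
  have hr := (h ⟨a, by simpa using haS⟩ ⟨y, by simpa using hyS⟩).1 (hax.trans hyx.symm)
  have aux : ∀ u v : ((S : Set V)ᶜ : Set V), (G.induce ((S : Set V)ᶜ)).Walk u v →
      (u : V) ∈ A → (v : V) ∈ A := by
    intro u v w
    induction w with
    | nil => exact fun h => h
    | @cons u v w huv _ ih =>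
      intro hu
      apply ih
      by_contra hv
      refine hcon u hu v ?_ hv huv
      have hvS : (v : V) ∉ S := fun h => v.2 (Finset.mem_coe.2 h)
      have huS : (u : V) ∉ S := fun h => u.2 (Finset.mem_coe.2 h)
      exact mem_block.2 ⟨hvS, (h.of_adj huS hvS huv).symm.trans (mem_block.1 (hA hu)).2⟩
  obtain ⟨w⟩ := hr
  exact aux _ _ w ha

theorem IsReducedVertexSet.layout {p : ℕ} (hW : IsReducedVertexSet G S p W)
    (h : IsComponentLabel G S comp) : Layout G S W comp := by
  refine ⟨hW.1, fun x y hx hy => h.of_adj hx hy, ?_⟩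
  have aux : ∀ x y, x ∉ S → y ∉ S → comp x = comp y → x ∈ W → y ∈ W := by
    intro x y hx hy hxy hxW
    rcases hW.2.1 _ (h.mem_componentsOff_iff.2 ⟨x, hx, rfl⟩) with h1 | h1
    · exact h1 (Finset.mem_coe.2 (mem_block.2 ⟨hy, hxy.symm⟩))
    · exact (Set.disjoint_left.1 h1 (Finset.mem_coe.2 (mem_block.2 ⟨hx, rfl⟩)) hxW).elim
  exact fun x y hx hy hxy => ⟨aux x y hx hy hxy, aux y x hy hx hxy.symm⟩

theorem IntegrityWitness.card_block_union_le {p : ℕ} (hS : IntegrityWitness G S p)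
    (h : IsComponentLabel G S comp) (c : ℕ) : (block S comp c ∪ S).card ≤ p := by
  by_cases hc : ∃ x, x ∉ S ∧ comp x = c
  · obtain ⟨x, hx, rfl⟩ := hc
    have := hS.2 _ (h.mem_componentsOff_iff.2 ⟨x, hx, rfl⟩)
    rwa [← Finset.coe_union, Set.ncard_coe_finset] at this
  · have : block S comp c = ∅ := by
      ext y
      simp only [mem_block, Finset.notMem_empty, iff_false]
      exact fun hy => hc ⟨y, hy⟩
    rw [this, Finset.empty_union]
    exact hS.1

end Blocks

/-! ### A component can be absorbed at some time -/

theorem exists_constant_subset {V ι : Type*} [DecidableEq V] {J : Finset ι} {f : ι → V}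
    {F : Finset V} {m n : ℕ}
    (hF : ∀ j ∈ J, f j ∈ F) (hFm : F.card ≤ m) (hne : F.Nonempty) (hn : m * n ≤ J.card) :
    ∃ J' ⊆ J, n ≤ J'.card ∧ ∃ c, ∀ j ∈ J', f j = c := by
  obtain ⟨y, -, hy⟩ := Finset.exists_le_card_fiber_of_mul_le_card_of_maps_to hF hne
    ((Nat.mul_le_mul_right n hFm).trans hn)
  exact ⟨_, Finset.filter_subset _ _, hy, y, fun j hj => (Finset.mem_filter.1 hj).2⟩

section Pigeonhole

variable {V ι : Type*} [DecidableEq V] {G : SimpleGraph V} {W : Finset V} {t : ℕ}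
  {π : V → V}

/-- If the vertices `a j` lie in one part, then their private neighbours `b j` lie in few parts. -/
theorem exists_constant_of_adj (hπ : Thin G W t π) {J : Finset ι} {a b : ι → V}
    (ha : ∀ j ∈ J, a j ∈ W) (hb : ∀ j ∈ J, b j ∈ W) (hab : ∀ j ∈ J, G.Adj (a j) (b j))
    (hnot : ∀ i ∈ J, ∀ j ∈ J, i ≠ j → ¬ G.Adj (a i) (b j)) (hJ : 2 ≤ J.card) {c : V}
    (hc : ∀ j ∈ J, π (a j) = c) {n : ℕ} (hn : (t + 1) * n ≤ J.card) :
    ∃ J' ⊆ J, n ≤ J'.card ∧ ∃ c, ∀ j ∈ J', π (b j) = c := by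
  classical
  have hF : ((J.image fun j => π (b j)).erase c).card ≤ t := by
    refine hπ c _ fun d hd => ?_
    obtain ⟨hdc, hd⟩ := Finset.mem_erase.1 hd
    obtain ⟨j, hj, rfl⟩ := Finset.mem_image.1 hd
    obtain ⟨i, hi, hij⟩ := Finset.exists_mem_ne (by omega : 1 < J.card) j
    exact ⟨hdc.symm, ⟨a j, ha j hj, b j, hb j hj, hc j hj, rfl, hab j hj⟩,
      ⟨a i, ha i hi, b j, hb j hj, hc i hi, rfl, hnot i hi j hj hij⟩⟩
  refine exists_constant_subset (F := insert c ((J.image fun j => π (b j)).erase c))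
    (fun j hj => ?_) ((Finset.card_insert_le _ _).trans (Nat.succ_le_succ hF))
    (Finset.insert_nonempty _ _) hn
  by_cases h : π (b j) = c
  · exact Finset.mem_insert.2 (Or.inl h)
  · exact Finset.mem_insert_of_mem (Finset.mem_erase.2 ⟨h, Finset.mem_image_of_mem _ hj⟩)

/-- Given many disjoint copies of a connected set `K` without edges between them: if the copies of
one vertex lie in few parts, then two copies agree in the parts of all their vertices. The copies
are thinned out vertex by vertex, along a connected ordering of `K`. -/
theorem exists_pair_of_many_copies (hπ : Thin G W t π) {K : Finset V} {I : Finset ι}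
    {a : ι → V → V} (ha : ∀ j ∈ I, ∀ k ∈ K, a j k ∈ W)
    (hadj : ∀ j ∈ I, ∀ k ∈ K, ∀ k' ∈ K, G.Adj k k' → G.Adj (a j k) (a j k'))
    (hnot : ∀ i ∈ I, ∀ j ∈ I, i ≠ j → ∀ k ∈ K, ∀ k' ∈ K, ¬ G.Adj (a i k) (a j k'))
    (hconn : ∀ A ⊆ K, A.Nonempty → A ≠ K → ∃ k ∈ A, ∃ k' ∈ K, k' ∉ A ∧ G.Adj k k')
    {k0 : V} (hk0 : k0 ∈ K) {J0 : Finset ι} (hJ0 : J0 ⊆ I)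
    (hJ0c : (t + 2) ^ (K.card - 1) * 2 ≤ J0.card) {c0 : V} (hc0 : ∀ j ∈ J0, π (a j k0) = c0) :
    ∃ i ∈ I, ∃ j ∈ I, i ≠ j ∧ ∀ k ∈ K, π (a i k) = π (a j k) := by
  have main : ∀ r, r + 1 ≤ K.card → ∃ A ⊆ K, A.card = r + 1 ∧ ∃ J ⊆ I,
      (t + 2) ^ (K.card - 1 - r) * 2 ≤ J.card ∧ ∀ k ∈ A, ∃ c, ∀ j ∈ J, π (a j k) = c := by
    intro r
    induction r with
    | zero =>
      intro _
      refine ⟨{k0}, by simpa using hk0, by simp, J0, hJ0, hJ0c, fun k hk => ?_⟩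
      rw [Finset.mem_singleton] at hk
      subst hk
      exact ⟨c0, hc0⟩
    | succ r ih =>
      intro hr
      obtain ⟨A, hAK, hAc, J, hJ, hJc, hconst⟩ := ih (by omega)
      obtain ⟨k, hk, k', hk', hk'A, hkk'⟩ := hconn A hAK
        (Finset.card_pos.1 (by omega)) (by rintro rfl; omega)
      obtain ⟨c, hc⟩ := hconst k hk
      have he : K.card - 1 - r = (K.card - 1 - (r + 1)) + 1 := by omega
      rw [he, pow_succ] at hJc
      have hpos : 1 ≤ (t + 2) ^ (K.card - 1 - (r + 1)) := Nat.one_le_pow _ _ (by omega)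
      obtain ⟨J', hJ', hJ'c, c', hc'⟩ := exists_constant_of_adj hπ (J := J) (a := fun j => a j k)
        (b := fun j => a j k') (fun j hj => ha j (hJ hj) k (hAK hk))
        (fun j hj => ha j (hJ hj) k' hk')
        (fun j hj => hadj j (hJ hj) k (hAK hk) k' hk' hkk')
        (fun i hi j hj hij => hnot i (hJ hi) j (hJ hj) hij k (hAK hk) k' hk')
        (le_trans (by nlinarith) hJc) hc (n := (t + 2) ^ (K.card - 1 - (r + 1)) * 2)
        (le_trans (by nlinarith) hJc)
      refine ⟨insert k' A, Finset.insert_subset hk' hAK, by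
        rw [Finset.card_insert_of_notMem hk'A, hAc], J', hJ'.trans hJ, hJ'c, fun x hx => ?_⟩
      rcases Finset.mem_insert.1 hx with rfl | hx
      · exact ⟨c', hc'⟩
      · obtain ⟨c, hc⟩ := hconst x hx
        exact ⟨c, fun j hj => hc j (hJ' hj)⟩
  have hKpos : 1 ≤ K.card := Finset.card_pos.2 ⟨k0, hk0⟩
  obtain ⟨A, hAK, hAc, J, hJ, hJc, hconst⟩ := main (K.card - 1) (by omega)
  have hAK' : A = K := Finset.eq_of_subset_of_card_le hAK (by omega)
  subst hAK'
  rw [Nat.sub_self, pow_zero, one_mul] at hJc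
  obtain ⟨i, hi, j, hj, hij⟩ := Finset.one_lt_card.1 (by omega : 1 < J.card)
  refine ⟨i, hJ hi, j, hJ hj, hij, fun k hk => ?_⟩
  obtain ⟨c, hc⟩ := hconst k hk
  rw [hc i hi, hc j hj]

end Pigeonhole

/-- The number of copies suffices: the first step of the pigeonhole argument leaves one part in
`t + 2`, as does each of the further `k - 1` steps, two copies have to remain, and one copy may be
lost at the start. The second inequality bounds the number of maps between sets of size `k`. -/
theorem pow_le_largeThreshold {p t k : ℕ} (hk : 1 ≤ k) (hkp : k ≤ p) (ht : 2 * t < p) :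
    (t + 2) * ((t + 2) ^ (k - 1) * 2) + 1 ≤ largeThreshold p ∧ k ^ k ≤ largeThreshold p := by
  have hp : 1 ≤ p := hk.trans hkp
  have h1 : t + 2 ≤ 2 ^ p := le_trans (by omega) (Nat.lt_two_pow_self (n := p))
  have h2 : p ≤ 2 ^ p := (Nat.lt_two_pow_self (n := p)).le
  have e : (t + 2) * ((t + 2) ^ (k - 1) * 2) = (t + 2) ^ k * 2 := by
    rw [← mul_assoc, ← pow_succ', Nat.sub_add_cancel hk]
  have h3 : ∀ x, x ≤ 2 ^ p → x ^ k ≤ 2 ^ (p * p) := by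
    intro x hx
    calc x ^ k ≤ (2 ^ p) ^ k := Nat.pow_le_pow_left hx k
      _ = 2 ^ (p * k) := (pow_mul _ _ _).symm
      _ ≤ 2 ^ (p * p) := Nat.pow_le_pow_right (by norm_num) (Nat.mul_le_mul_left p hkp)
  have h4 : 2 ^ (p * p + 2) ≤ largeThreshold p := by
    unfold largeThreshold
    refine Nat.pow_le_pow_right (by norm_num) ?_
    have : p * p * 1 ≤ p * p * p := Nat.mul_le_mul_left _ hp
    have : 1 ≤ p * p * p := Nat.mul_pos (Nat.mul_pos hp hp) hp
    have : p ^ 3 = p * p * p := by ring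
    omega
  have h5 : 1 ≤ 2 ^ (p * p) := Nat.one_le_two_pow
  rw [pow_add] at h4
  rw [e]
  have := h3 _ h1
  have := h3 k (hkp.trans h2)
  constructor <;> omega

section Exists

variable {V : Type*} [Fintype V] [DecidableEq V] {G : SimpleGraph V} {S W : Finset V}
  {comp : V → ℕ} {p t : ℕ} {C : List (V × V)}

/-- The copies in `W` of a component off `W`. The index `H` of a copy is its vertex set. -/
theorem IsReducedVertexSet.exists_copies (hW : IsReducedVertexSet G S p W)
    (hcomp : IsComponentLabel G S comp) {x : V} (hx : x ∉ W) :
    ∃ (I : Finset (Finset V)) (a : Finset V → V → V), I.card = largeThreshold p ∧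
      ∀ H ∈ I, (∃ h ∈ W, h ∉ S ∧ H = block S comp (comp h)) ∧
        (∀ k ∈ block S comp (comp x), a H k ∈ H) ∧
        (∀ k ∈ block S comp (comp x), ∀ k' ∈ block S comp (comp x),
          G.Adj k k' ↔ G.Adj (a H k) (a H k')) ∧
        (∀ k ∈ block S comp (comp x), ∀ k' ∈ block S comp (comp x), a H k = a H k' → k = k') ∧
        (∀ k ∈ block S comp (comp x), ∀ s ∈ S, G.Adj k s ↔ G.Adj (a H k) s) ∧
        H.card = (block S comp (comp x)).card := by
  classical
  have hxS : x ∉ S := fun h => hx (hW.1 h)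
  set K := block S comp (comp x) with hK
  have hKoff : (K : Set V) ∈ componentsOff G S := hcomp.mem_componentsOff_iff.2 ⟨x, hxS, rfl⟩
  have hself : (K : Set V) ∈ twinClass G S K :=
    ⟨hKoff, SimpleGraph.Iso.refl, fun _ _ _ => Iff.rfl⟩
  have hKW : ¬ (K : Set V) ⊆ W := fun h => hx (h (Finset.mem_coe.2 (mem_block.2 ⟨hxS, rfl⟩)))
  obtain ⟨h1, h2⟩ := hW.2.2 _ hKoff
  have hlarge : largeThreshold p ≤ (twinClass G S (K : Set V)).ncard := by
    by_contra hlt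
    exact hKW (h2 (not_le.1 hlt) _ hself)
  have hcard := h1 hlarge
  have hex : ∀ H : Finset V, ∃ f : V → V,
      (H : Set V) ∈ {L | L ∈ twinClass G S (K : Set V) ∧ L ⊆ (W : Set V)} →
        (∀ k ∈ K, f k ∈ H) ∧ (∀ k ∈ K, ∀ k' ∈ K, G.Adj k k' ↔ G.Adj (f k) (f k')) ∧
        (∀ k ∈ K, ∀ k' ∈ K, f k = f k' → k = k') ∧
        (∀ k ∈ K, ∀ s ∈ S, G.Adj k s ↔ G.Adj (f k) s) ∧ H.card = K.card := by
    intro H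
    by_cases hH : (H : Set V) ∈ {L | L ∈ twinClass G S (K : Set V) ∧ L ⊆ (W : Set V)}
    · obtain ⟨⟨-, α, hα⟩, -⟩ := hH
      refine ⟨fun k => if hk : k ∈ (K : Set V) then α ⟨k, hk⟩ else k, fun _ => ⟨?_, ?_, ?_, ?_, ?_⟩⟩
      · intro k hk
        have hk' : k ∈ (K : Set V) := hk
        simp only [hk', dif_pos]
        exact (α ⟨k, hk'⟩).2
      · intro k hk k' hk'
        have h3 : k ∈ (K : Set V) := hk
        have h4 : k' ∈ (K : Set V) := hk'
        simp only [h3, h4, dif_pos]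
        exact (α.map_adj_iff (v := ⟨k, h3⟩) (w := ⟨k', h4⟩)).symm
      · intro k hk k' hk' heq
        have h3 : k ∈ (K : Set V) := hk
        have h4 : k' ∈ (K : Set V) := hk'
        simp only [h3, h4, dif_pos] at heq
        exact congrArg Subtype.val (α.injective (Subtype.ext heq))
      · intro k hk s hs
        have h3 : k ∈ (K : Set V) := hk
        simp only [h3, dif_pos]
        exact hα ⟨k, h3⟩ s hs
      · have := Nat.card_congr α.toEquiv
        rw [Nat.card_coe_set_eq, Nat.card_coe_set_eq, Set.ncard_coe_finset,
          Set.ncard_coe_finset] at this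
        exact this.symm
    · exact ⟨id, fun h => (hH h).elim⟩
  choose a ha using hex
  refine ⟨Finset.univ.filter fun H : Finset V =>
    (H : Set V) ∈ {L | L ∈ twinClass G S (K : Set V) ∧ L ⊆ (W : Set V)}, a, ?_, ?_⟩
  · rw [← hcard, ← Set.ncard_coe_finset,
      ← Set.ncard_image_of_injective _ (Finset.coe_injective (α := V))]
    congr 1
    ext L
    simp only [Finset.coe_filter, Finset.mem_univ, true_and, Set.mem_image]
    constructor
    · rintro ⟨H, hH, rfl⟩
      exact hH
    · intro hL
      exact ⟨L.toFinite.toFinset, by simpa using hL, by simp⟩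
  · intro H hH
    have hH' := (Finset.mem_filter.1 hH).2
    refine ⟨?_, ha H hH'⟩
    obtain ⟨h, hh, hHh⟩ := hcomp.mem_componentsOff_iff.1 hH'.1.1
    have hHh' : H = block S comp (comp h) := Finset.coe_injective hHh
    refine ⟨h, hH'.2 ?_, hh, hHh'⟩
    rw [hHh]
    exact Finset.mem_coe.2 (mem_block.2 ⟨hh, rfl⟩)

/-- If `2 * t < p`, every component off `W` can be absorbed at some time: at the last time at which
it is homogeneous to all parts. In the next step the copies of one of its vertices get into few
parts, for otherwise a part that meets `S` would have a large red degree; hence so do the copies of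
all vertices, and two copies of the component lie in the same parts.

The bound by the number of vertices makes it feasible to try all maps between two components. -/
theorem exists_absorbable (hS : IntegrityWitness G S p) (hW : IsReducedVertexSet G S p W)
    (hcomp : IsComponentLabel G S comp) (hC : Steps G W t id C)
    (hfin : (W.image (mergeAll id C)).card = 1) (ht : 2 * t < p) {x : V} (hx : x ∉ W) :
    (block S comp (comp x)).card ^ (block S comp (comp x)).card ≤ Fintype.card V ∧
    ∃ i ≤ C.length, ∃ h ∈ W, h ∉ S ∧
      (block S comp (comp h)).card = (block S comp (comp x)).card ∧
      ∃ ψ : V → V, (∀ k ∈ block S comp (comp x), comp (ψ k) = comp h) ∧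
        Absorbable G S W comp (mergeAll id (C.take i)) (block S comp (comp x)) ψ := by
  classical
  obtain ⟨I, a, hIc, hI⟩ := hW.exists_copies hcomp hx
  have hL := hW.layout hcomp
  have hxS : x ∉ S := fun h => hx (hW.1 h)
  set K := block S comp (comp x) with hK
  have hxK : x ∈ K := mem_block.2 ⟨hxS, rfl⟩
  have hKW : ∀ k ∈ K, k ∉ W := fun k hk h =>
    hx ((hL.mem k x (mem_block.1 hk).1 hxS (mem_block.1 hk).2).1 h)
  have hKpos : 1 ≤ K.card := Finset.card_pos.2 ⟨x, hxK⟩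
  have hKp : K.card ≤ p := le_trans (Finset.card_le_card Finset.subset_union_left)
    (hS.card_block_union_le hcomp (comp x))
  obtain ⟨hnum, hpow⟩ := pow_le_largeThreshold hKpos hKp ht
  rw [← hIc] at hnum hpow
  -- each vertex lies in at most one copy
  have hdisj : ∀ H ∈ I, ∀ H' ∈ I, ∀ y, y ∈ H → y ∈ H' → H = H' := by
    intro H hH H' hH' y hy hy'
    obtain ⟨⟨h, -, -, rfl⟩, -⟩ := hI H hH
    obtain ⟨⟨h', -, -, rfl⟩, -⟩ := hI H' hH'
    rw [(mem_block.1 hy).2.symm.trans (mem_block.1 hy').2]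
  have hW' : ∀ H ∈ I, ∀ y ∈ H, y ∈ W ∧ y ∉ S := by
    intro H hH y hy
    obtain ⟨⟨h, h1, h2, rfl⟩, -⟩ := hI H hH
    obtain ⟨h3, h4⟩ := mem_block.1 hy
    exact ⟨(hL.mem y h h3 h2 h4).2 h1, h3⟩
  have hcompH : ∀ H ∈ I, ∀ y ∈ H, ∀ z, z ∉ S → comp z = comp y → z ∈ H := by
    intro H hH y hy z hzS hz
    obtain ⟨⟨h, h1, h2, rfl⟩, -⟩ := hI H hH
    exact mem_block.2 ⟨hzS, hz.trans (mem_block.1 hy).2⟩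
  have hadjH : ∀ H ∈ I, ∀ y ∈ H, ∀ z, z ∉ S → G.Adj y z → z ∈ H := by
    intro H hH y hy z hzS hz
    exact hcompH H hH y hy z hzS (hcomp.of_adj (hW' H hH y hy).2 hzS hz).symm
  refine ⟨hpow.trans ?_, ?_⟩
  · -- distinct copies contain distinct vertices
    refine Finset.card_le_card_of_injOn (fun H => a H x) (fun _ _ => Finset.mem_univ _) ?_
    intro H hH H' hH' heq
    exact hdisj H hH H' hH' (a H x) ((hI H hH).2.1 x hxK)
      (by simp only at heq; rw [heq]; exact (hI H' hH').2.1 x hxK)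
  have htake : ∀ i, Steps G W t id (C.take i) := by
    intro i
    rw [← List.take_append_drop i C, steps_append] at hC
    exact hC.1
  have hlab : ∀ i, IsLabelling W (mergeAll id (C.take i)) := fun i =>
    (IsLabelling.id W).mergeAll (htake i)
  -- two copies in the same parts suffice
  have finish : ∀ i ≤ C.length, (∀ k ∈ K, Homogeneous G W (mergeAll id (C.take i)) k) →
      (∃ H ∈ I, ∃ H' ∈ I, H ≠ H' ∧ ∀ k ∈ K, mergeAll id (C.take i) (a H k) =
        mergeAll id (C.take i) (a H' k)) →
      ∃ i ≤ C.length, ∃ h ∈ W, h ∉ S ∧ (block S comp (comp h)).card = K.card ∧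
        ∃ ψ : V → V, (∀ k ∈ K, comp (ψ k) = comp h) ∧
          Absorbable G S W comp (mergeAll id (C.take i)) K ψ := by
    rintro i hi hhom ⟨H, hH, H', hH', hne, heq⟩
    obtain ⟨⟨h, h1, h2, h3⟩, h4, h5, h6, h7, h8⟩ := hI H hH
    refine ⟨i, hi, h, h1, h2, by rw [← h3, h8], a H, ?_, ?_⟩
    · intro k hk
      exact (mem_block.1 ((Finset.ext_iff.1 h3 _).1 (h4 k hk))).2
    · refine ⟨fun k hk => hW' H hH _ (h4 k hk), h5, h6, h7, fun k hk => ?_, hhom⟩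
      have hk' := (hI H' hH').2.1 k hk
      obtain ⟨h9, h10⟩ := hW' H' hH' _ hk'
      refine ⟨a H' k, h9, h10, fun hc => hne ?_, (heq k hk).symm⟩
      exact hdisj H hH H' hH' _ (hcompH H hH _ (h4 k hk) _ h10 hc) hk'
  have hhom0 : ∀ k ∈ K, Homogeneous G W (mergeAll id (C.take 0)) k := fun k _ y _ => Iff.rfl
  by_cases hall : ∀ k ∈ K, Homogeneous G W (mergeAll id (C.take C.length)) k
  · -- at the end there is a single part
    refine finish C.length le_rfl hall ?_
    have h2 : 1 < I.card := by
      have : 1 ≤ (t + 2) ^ (K.card - 1) := Nat.one_le_pow _ _ (by omega)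
      nlinarith
    obtain ⟨H, hH, H', hH', hne⟩ := Finset.one_lt_card.1 h2
    refine ⟨H, hH, H', hH', hne, fun k hk => ?_⟩
    rw [List.take_length]
    refine Finset.card_le_one.1 hfin.le _ (Finset.mem_image_of_mem _ ?_) _
      (Finset.mem_image_of_mem _ ?_)
    · exact (hW' H hH _ ((hI H hH).2.1 k hk)).1
    · exact (hW' H' hH' _ ((hI H' hH').2.1 k hk)).1
  · -- the last time of homogeneity
    obtain ⟨i, hi, hhom, hnext⟩ : ∃ i < C.length,
        (∀ k ∈ K, Homogeneous G W (mergeAll id (C.take i)) k) ∧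
        ¬ ∀ k ∈ K, Homogeneous G W (mergeAll id (C.take (i + 1))) k := by
      by_contra hcon
      push Not at hcon
      refine hall ?_
      have : ∀ i ≤ C.length, ∀ k ∈ K, Homogeneous G W (mergeAll id (C.take i)) k := by
        intro i
        induction i with
        | zero => exact fun _ => hhom0
        | succ i ih => exact fun hi => hcon i (by omega) (ih (by omega))
      exact this _ le_rfl
    refine finish i hi.le hhom ?_
    set π := mergeAll id (C.take i) with hπ
    have hstep : mergeAll id (C.take (i + 1)) = merge π (C[i]).1 (C[i]).2 := by
      rw [List.take_succ_eq_append_getElem hi, mergeAll_append]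
      rfl
    have hlab' := hlab (i + 1)
    have hthin' := (htake (i + 1)).thin_mergeAll
    rw [hstep] at hnext hlab' hthin'
    set π' := merge π (C[i]).1 (C[i]).2 with hπ'
    -- the next contraction joins a neighbour `y` of some `k` in the component to a non-neighbour
    -- `z`; then `y` is in `S`, hence adjacent to all copies of `k`, and `z` is adjacent to none of
    -- them, except perhaps to the one in the component of `z`
    obtain ⟨k, hk, y, hy, z, hz, hyz, hky, hkz⟩ : ∃ k ∈ K, ∃ y ∈ W, ∃ z ∈ W, π' y = π' z ∧
        G.Adj k y ∧ ¬ G.Adj k z := by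
      push Not at hnext
      obtain ⟨k, hk, hn⟩ := hnext
      unfold Homogeneous at hn
      push Not at hn
      obtain ⟨y, hy, hn⟩ := hn
      rcases hn with ⟨h1, h2⟩ | ⟨h1, h2⟩
      · exact ⟨k, hk, y, hy, π' y, hlab'.mem y hy, (hlab'.idem y).symm, h1, h2⟩
      · exact ⟨k, hk, π' y, hlab'.mem y hy, y, hy, hlab'.idem y, h2, h1⟩
    have hyS := hL.mem_S_of_adj (hKW k hk) hy hky
    set J := I.filter fun H => z ∉ H with hJ
    have hJI : J ⊆ I := Finset.filter_subset _ _
    have hJc : I.card ≤ J.card + 1 := by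
      have h1 : J.card + (I.filter fun H => ¬ z ∉ H).card = I.card :=
        Finset.card_filter_add_card_filter_not (fun H => z ∉ H)
      have h2 : (I.filter fun H => ¬ z ∉ H).card ≤ 1 := by
        refine Finset.card_le_one.2 fun H hH H' hH' => ?_
        obtain ⟨h3, h4⟩ := Finset.mem_filter.1 hH
        obtain ⟨h5, h6⟩ := Finset.mem_filter.1 hH'
        exact hdisj H h3 H' h5 z (not_not.1 h4) (not_not.1 h6)
      omega
    have hF : ((J.image fun H => π' (a H k)).erase (π' y)).card ≤ t := by
      refine hthin' (π' y) _ fun d hd => ?_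
      obtain ⟨hdc, hd⟩ := Finset.mem_erase.1 hd
      obtain ⟨H, hH, rfl⟩ := Finset.mem_image.1 hd
      obtain ⟨hHI, hzH⟩ := Finset.mem_filter.1 hH
      have hkH := (hI H hHI).2.1 k hk
      have hkW := hW' H hHI _ hkH
      refine ⟨hdc.symm, ⟨y, hy, a H k, hkW.1, rfl, rfl,
        (((hI H hHI).2.2.2.2.1 k hk y hyS).1 hky).symm⟩, ⟨z, hz, a H k, hkW.1, hyz.symm, rfl,
        fun hzk => ?_⟩⟩
      by_cases hzS : z ∈ S
      · exact hkz (((hI H hHI).2.2.2.2.1 k hk z hzS).2 hzk.symm)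
      · exact hzH (hadjH H hHI _ hkH z hzS hzk.symm)
    -- before that contraction, the copies of `k` may also have been in the part that vanishes in it
    obtain ⟨J0, hJ0, hJ0c, c, hc⟩ := exists_constant_subset (J := J) (f := fun H => π (a H k))
      (F := insert (C[i]).2 (insert (π' y) ((J.image fun H => π' (a H k)).erase (π' y))))
      (m := t + 2) (n := (t + 2) ^ (K.card - 1) * 2) (fun H hH => by
        by_cases h1 : π (a H k) = (C[i]).2
        · exact Finset.mem_insert.2 (Or.inl h1)
        · refine Finset.mem_insert_of_mem ?_
          have h2 : π (a H k) = π' (a H k) := by rw [hπ']; unfold merge; rw [if_neg h1]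
          rw [h2]
          by_cases h3 : π' (a H k) = π' y
          · exact Finset.mem_insert.2 (Or.inl h3)
          · exact Finset.mem_insert_of_mem
              (Finset.mem_erase.2 ⟨h3, Finset.mem_image_of_mem (fun H => π' (a H k)) hH⟩))
      ((Finset.card_insert_le _ _).trans
        (Nat.succ_le_succ ((Finset.card_insert_le _ _).trans (Nat.succ_le_succ hF))))
      (Finset.insert_nonempty _ _) (by omega)
    refine exists_pair_of_many_copies (htake i).thin_mergeAll (I := I) (a := a) (K := K) ?_ ?_ ?_ ?_
      hk (hJ0.trans hJI) hJ0c hc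
    · exact fun H hH k hk => (hW' H hH _ ((hI H hH).2.1 k hk)).1
    · exact fun H hH k hk k' hk' => ((hI H hH).2.2.1 k hk k' hk').1
    · intro H hH H' hH' hne k hk k' hk' hadj
      have h1 := (hI H' hH').2.1 k' hk'
      exact hne (hdisj H hH H' hH' _ (hadjH H hH _ ((hI H hH).2.1 k hk) _ (hW' H' hH' _ h1).2 hadj)
        h1)
    · exact fun A hA hAne hAK => hcomp.exists_adj hA hAne hAK

end Exists

/-! ### Reasoning about programs -/

namespace RAM

theorem setReg_reg (s : State) (r x r' : ℕ) :
    (s.setReg r x).reg r' = if r' = r then x else s.reg r' := by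
  simp [State.setReg, Function.update_apply]

theorem setReg_mem (s : State) (r x : ℕ) : (s.setReg r x).mem = s.mem := rfl

theorem setMem_reg (s : State) (a i x : ℕ) : (s.setMem a i x).reg = s.reg := rfl

theorem setMem_mem (s : State) (a i x a' j : ℕ) :
    (s.setMem a i x).mem a' j = if a' = a ∧ j = i then x else s.mem a' j := by
  simp only [State.setMem, Function.update_apply]
  by_cases h : a' = a
  · subst h
    by_cases h' : j = i <;> simp [h']
  · simp [h]

/-- `wp N c Q s`: started in `s`, the program `c` halts in a state with property `Q`, and each of
its loops makes at most `N` iterations whenever it is entered. A loop comes with an invariant that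
may depend on the number of iterations so far. -/
def wp (N : ℕ) : Cmd → (State → Prop) → State → Prop
  | .skip, Q, s => Q s
  | .assign r e, Q, s => Q (s.setReg r (e.eval s))
  | .store a i e, Q, s => Q (s.setMem a (i.eval s) (e.eval s))
  | .seq c d, Q, s => wp N c (wp N d Q) s
  | .ite e c d, Q, s => (e.eval s ≠ 0 → wp N c Q s) ∧ (e.eval s = 0 → wp N d Q s)
  | .loop e c, Q, s => ∃ I : ℕ → State → Prop, I 0 s ∧ ∀ i s, I i s →
      (e.eval s ≠ 0 → i < N ∧ wp N c (I (i + 1)) s) ∧ (e.eval s = 0 → Q s)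

/-- A bound on the number of steps of a program each of whose loops makes at most `N` iterations. -/
def stepBound (N : ℕ) : Cmd → ℕ
  | .skip => 1
  | .assign _ e => e.cost + 1
  | .store _ i e => i.cost + e.cost + 1
  | .seq c d => stepBound N c + stepBound N d
  | .ite e c d => e.cost + 1 + (stepBound N c + stepBound N d)
  | .loop e c => N * (e.cost + 1 + stepBound N c) + (e.cost + 1)

theorem exists_exec_of_wp {N : ℕ} {c : Cmd} {Q : State → Prop} {s : State} (h : wp N c Q s) :
    ∃ s' k, Exec c s s' k ∧ k ≤ stepBound N c ∧ Q s' := by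
  induction c generalizing Q s with
  | skip => exact ⟨s, 1, .skip s, le_rfl, h⟩
  | assign r e => exact ⟨_, _, .assign s r e, le_rfl, h⟩
  | store a i e => exact ⟨_, _, .store s a i e, le_rfl, h⟩
  | seq c d ihc ihd =>
    obtain ⟨s1, k1, h1, hk1, h2⟩ := ihc h
    obtain ⟨s2, k2, h3, hk2, h4⟩ := ihd h2
    exact ⟨s2, _, .seq h1 h3, Nat.add_le_add hk1 hk2, h4⟩
  | ite e c d ihc ihd =>
    by_cases he : e.eval s = 0
    · obtain ⟨s1, k1, h1, hk1, h2⟩ := ihd (h.2 he)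
      refine ⟨s1, _, .ite_false he h1, ?_, h2⟩
      simp only [stepBound]
      omega
    · obtain ⟨s1, k1, h1, hk1, h2⟩ := ihc (h.1 he)
      refine ⟨s1, _, .ite_true he h1, ?_, h2⟩
      simp only [stepBound]
      omega
  | loop e c ih =>
    obtain ⟨I, h0, hI⟩ := h
    have main : ∀ j i s, i + j = N → I i s → ∃ s' k, Exec (.loop e c) s s' k ∧
        k ≤ j * (e.cost + 1 + stepBound N c) + (e.cost + 1) ∧ Q s' := by
      intro j
      induction j with
      | zero =>
        intro i s hij hs
        by_cases he : e.eval s = 0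
        · exact ⟨s, _, .loop_done he, by omega, (hI i s hs).2 he⟩
        · have := ((hI i s hs).1 he).1
          omega
      | succ j ihj =>
        intro i s hij hs
        by_cases he : e.eval s = 0
        · exact ⟨s, _, .loop_done he, by omega, (hI i s hs).2 he⟩
        · obtain ⟨s1, k1, h1, hk1, h2⟩ := ih ((hI i s hs).1 he).2
          obtain ⟨s2, k2, h3, hk2, h4⟩ := ihj (i + 1) s1 (by omega) h2
          refine ⟨s2, _, .loop_step he h1 h3, ?_, h4⟩
          rw [Nat.succ_mul]
          omega
    exact main N 0 s (Nat.zero_add N) h0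

theorem exists_polynomial_stepBound (c : Cmd) :
    ∃ q : Polynomial ℕ, ∀ n, stepBound (n + 1) c = q.eval n := by
  induction c with
  | skip => exact ⟨1, by simp [stepBound]⟩
  | assign r e => exact ⟨Polynomial.C (e.cost + 1), by simp [stepBound]⟩
  | store a i e => exact ⟨Polynomial.C (i.cost + e.cost + 1), by simp [stepBound]⟩
  | seq c d ihc ihd =>
    obtain ⟨q, hq⟩ := ihc
    obtain ⟨q', hq'⟩ := ihd
    exact ⟨q + q', fun n => by rw [Polynomial.eval_add, ← hq, ← hq', stepBound]⟩
  | ite e c d ihc ihd =>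
    obtain ⟨q, hq⟩ := ihc
    obtain ⟨q', hq'⟩ := ihd
    refine ⟨Polynomial.C (e.cost + 1) + (q + q'), fun n => ?_⟩
    rw [Polynomial.eval_add, Polynomial.eval_add, Polynomial.eval_C, ← hq, ← hq', stepBound]
  | loop e c ih =>
    obtain ⟨q, hq⟩ := ih
    refine ⟨(Polynomial.X + 1) * (Polynomial.C (e.cost + 1) + q) + Polynomial.C (e.cost + 1),
      fun n => ?_⟩
    simp only [Polynomial.eval_add, Polynomial.eval_mul, Polynomial.eval_C, Polynomial.eval_X,
      Polynomial.eval_one, ← hq, stepBound]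

/-- Whether a program may write into the register `r`. -/
def modReg : Cmd → ℕ → Bool
  | .skip, _ => false
  | .assign r _, r' => r' == r
  | .store _ _ _, _ => false
  | .seq c d, r' => modReg c r' || modReg d r'
  | .ite _ c d, r' => modReg c r' || modReg d r'
  | .loop _ c, r' => modReg c r'

/-- Whether a program may write into the array `a`. -/
def modMem : Cmd → ℕ → Bool
  | .skip, _ => false
  | .assign _ _, _ => false
  | .store a _ _, a' => a' == a
  | .seq c d, a' => modMem c a' || modMem d a'
  | .ite _ c d, a' => modMem c a' || modMem d a'
  | .loop _ c, a' => modMem c a'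

/-- The states agree in all registers and arrays that the program does not write. -/
structure Agree (c : Cmd) (s s' : State) : Prop where
  reg : ∀ r, modReg c r = false → s'.reg r = s.reg r
  mem : ∀ a, modMem c a = false → s'.mem a = s.mem a

theorem wp_mono {N : ℕ} {c : Cmd} {Q Q' : State → Prop} {s : State} (h : wp N c Q s)
    (hQ : ∀ s', Q s' → Q' s') : wp N c Q' s := by
  induction c generalizing Q Q' s with
  | skip => exact hQ _ h
  | assign r e => exact hQ _ h
  | store a i e => exact hQ _ h
  | seq c d ihc ihd => exact ihc h fun s' hs' => ihd hs' hQ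
  | ite e c d ihc ihd => exact ⟨fun he => ihc (h.1 he) hQ, fun he => ihd (h.2 he) hQ⟩
  | loop e c ih =>
    obtain ⟨I, h0, hI⟩ := h
    exact ⟨I, h0, fun i s hs => ⟨(hI i s hs).1, fun he => hQ _ ((hI i s hs).2 he)⟩⟩

theorem wp_agree {N : ℕ} {c c₀ : Cmd} {Q : State → Prop} {s s₀ : State} (h : wp N c Q s)
    (hr : ∀ r, modReg c₀ r = false → modReg c r = false)
    (hm : ∀ a, modMem c₀ a = false → modMem c a = false) (hs : Agree c₀ s₀ s) :
    wp N c (fun s' => Q s' ∧ Agree c₀ s₀ s') s := by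
  induction c generalizing Q s with
  | skip => exact ⟨h, hs⟩
  | assign r e =>
    refine ⟨h, fun r' hr' => ?_, fun a ha => hs.mem a ha⟩
    have := hr r' hr'
    simp only [modReg, beq_eq_false_iff_ne] at this
    rw [setReg_reg, if_neg this, hs.reg r' hr']
  | store a i e =>
    refine ⟨h, fun r' hr' => hs.reg r' hr', fun a' ha' => ?_⟩
    have := hm a' ha'
    simp only [modMem, beq_eq_false_iff_ne] at this
    funext j
    rw [setMem_mem, if_neg (fun h => this h.1), hs.mem a' ha']
  | seq c d ihc ihd =>
    simp only [modReg, modMem, Bool.or_eq_false_iff] at hr hm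
    change wp N c (wp N d _) s
    refine wp_mono (ihc h (fun r h => (hr r h).1) (fun a h => (hm a h).1) hs) ?_
    rintro s' ⟨h1, h2⟩
    exact ihd h1 (fun r h => (hr r h).2) (fun a h => (hm a h).2) h2
  | ite e c d ihc ihd =>
    simp only [modReg, modMem, Bool.or_eq_false_iff] at hr hm
    exact ⟨fun he => ihc (h.1 he) (fun r h => (hr r h).1) (fun a h => (hm a h).1) hs,
      fun he => ihd (h.2 he) (fun r h => (hr r h).2) (fun a h => (hm a h).2) hs⟩
  | loop e c ih =>
    obtain ⟨I, h0, hI⟩ := h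
    refine ⟨fun i s => I i s ∧ Agree c₀ s₀ s, ⟨h0, hs⟩, fun i s hs => ⟨fun he => ?_, fun he => ?_⟩⟩
    · obtain ⟨h1, h2⟩ := (hI i s hs.1).1 he
      exact ⟨h1, ih h2 hr hm hs.2⟩
    · exact ⟨(hI i s hs.1).2 he, hs.2⟩

theorem Agree.refl (c : Cmd) (s : State) : Agree c s s := ⟨fun _ _ => rfl, fun _ _ => rfl⟩

/-- Besides its specification, a program may be used with the fact that it changes nothing that it
does not write. -/
theorem wp_conseq {N : ℕ} {c : Cmd} {Q Q' : State → Prop} {s : State} (h : wp N c Q s)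
    (hQ : ∀ s', Agree c s s' → Q s' → Q' s') : wp N c Q' s :=
  wp_mono (wp_agree h (fun _ h => h) (fun _ h => h) (Agree.refl c s)) fun s' h => hQ s' h.2 h.1

/-- The program that runs `c` for the values `0, 1, …` of the register `r`, up to the value of the
register `m`, which is excluded. -/
def forUpTo (r m : ℕ) (c : Cmd) : Cmd :=
  .seq (.assign r (.lit 0))
    (.loop (.lt (.reg r) (.reg m)) (.seq c (.assign r (.add (.reg r) (.lit 1)))))

/-- The rule for counting loops. The invariant may not depend on the counter, and it may be used
that nothing else has been changed since the start of the loop. -/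
theorem wp_forUpTo {N r m n : ℕ} {c : Cmd} {s : State} (I : ℕ → State → Prop)
    (hrm : m ≠ r) (hrc : modReg c r = false) (hmc : modReg c m = false)
    (hn : n ≤ N) (hm : s.reg m = n) (h0 : I 0 s)
    (hI : ∀ i s v, I i s → I i (s.setReg r v))
    (step : ∀ i s', i < n → s'.reg r = i → s'.reg m = n → Agree (forUpTo r m c) s s' → I i s' →
      wp N c (I (i + 1)) s') : wp N (forUpTo r m c) (I n) s := by
  have hmod : ∀ r', modReg (forUpTo r m c) r' = false ↔ r' ≠ r ∧ modReg c r' = false := by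
    intro r'
    simp only [forUpTo, modReg, Bool.or_eq_false_iff, beq_eq_false_iff_ne]
    tauto
  have hmodm : ∀ a, modMem (forUpTo r m c) a = modMem c a := by
    intro a
    simp [forUpTo, modMem]
  refine ⟨fun i s' => (i ≤ n ∧ s'.reg r = i ∧ s'.reg m = n ∧ Agree (forUpTo r m c) s s') ∧ I i s',
    ?_, ?_⟩
  · refine ⟨⟨Nat.zero_le n, ?_, ?_, fun r' hr' => ?_, fun a _ => rfl⟩, hI _ _ _ h0⟩
    · simp [setReg_reg, Expr.eval]
    · simp [setReg_reg, hrm, hm]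
    · rw [setReg_reg, if_neg ((hmod r').1 hr').1]
  · rintro i s' ⟨⟨hin, hr, hm', ha⟩, hIi⟩
    have hev : (Expr.lt (.reg r) (.reg m)).eval s' = if i < n then 1 else 0 := by
      simp [Expr.eval, hr, hm']
    rw [hev]
    refine ⟨fun he => ?_, fun he => ?_⟩
    · have hlt : i < n := by
        by_contra h
        simp [h] at he
      refine ⟨lt_of_lt_of_le hlt hn, ?_⟩
      have h1 := step i s' hlt hr hm' ha hIi
      change wp N c (wp N _ _) s'
      refine wp_conseq h1 fun s'' ha' hI' => ?_
      have hr'' : s''.reg r = i := (ha'.reg r hrc).trans hr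
      refine ⟨⟨hlt, ?_, ?_, fun r' hr' => ?_, fun a h => ?_⟩, hI _ _ _ hI'⟩
      · simp [setReg_reg, Expr.eval, hr'']
      · rw [setReg_reg, if_neg hrm, ha'.reg m hmc, hm']
      · rw [setReg_reg, if_neg ((hmod r').1 hr').1, ha'.reg r' ((hmod r').1 hr').2, ha.reg r' hr']
      · rw [setReg_mem, ha'.mem a (hmodm a ▸ h), ha.mem a h]
    · have : i = n := by
        by_contra h
        have : i < n := by omega
        simp [this] at he
      subst this
      exact hIi

end RAM

/-! ### Registers, arrays and elementary programs -/

namespace RAM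

/-! The input occupies the registers and the arrays up to number 4. The array 0, which holds the
number of vertices at the start, and the register 0 are also those of the output. All other
registers and arrays are 0 at the start. -/

notation "regN" => (10 : ℕ)
notation "regM" => (11 : ℕ)
notation "regN1" => (12 : ℕ)
notation "regX" => (13 : ℕ)
notation "regY" => (14 : ℕ)
notation "regZ" => (15 : ℕ)
notation "regU" => (16 : ℕ)
notation "regV" => (17 : ℕ)
notation "regL" => (18 : ℕ)
notation "regCount" => (19 : ℕ)
notation "regTime" => (20 : ℕ)
notation "regC" => (21 : ℕ)
notation "regD" => (22 : ℕ)
notation "regCode" => (23 : ℕ)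
notation "regLC" => (24 : ℕ)
notation "regSizeC" => (25 : ℕ)
notation "regSizeD" => (26 : ℕ)
notation "regQ" => (27 : ℕ)
notation "regOk" => (28 : ℕ)
notation "regFound" => (29 : ℕ)
notation "regH" => (30 : ℕ)
notation "regP" => (31 : ℕ)
notation "regR" => (32 : ℕ)
notation "arrOut" => (0 : ℕ)
notation "arrAdj" => (1 : ℕ)
notation "arrS" => (2 : ℕ)
notation "arrW" => (3 : ℕ)
notation "arrC" => (4 : ℕ)
notation "arrRow" => (5 : ℕ)
notation "arrComp" => (6 : ℕ)
notation "arrPart" => (7 : ℕ)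
notation "arrDone" => (8 : ℕ)
notation "arrList" => (9 : ℕ)
notation "arrPhi" => (10 : ℕ)
notation "arrTab" => (11 : ℕ)

/-- Negation of a test. -/
def Expr.not (e : Expr) : Expr := .eq e (.lit 0)

/-- Disjunction of tests. -/
def Expr.or (e f : Expr) : Expr := .add e f

/-- Implication of tests. -/
def Expr.imp (e f : Expr) : Expr := .or (.not e) f

/-- Conjunction of tests. -/
def Expr.and (e f : Expr) : Expr := .not (.or (.not e) (.not f))

/-- Equivalence of tests. -/
def Expr.iff (e f : Expr) : Expr := .and (.imp e f) (.imp f e)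

/-- The test succeeds in the state `s`. -/
def Expr.Holds (e : Expr) (s : State) : Prop := e.eval s ≠ 0

theorem Expr.holds_not {e : Expr} {s : State} : e.not.Holds s ↔ ¬ e.Holds s := by
  by_cases h : e.eval s = 0 <;> simp [Expr.Holds, Expr.not, Expr.eval, h]

theorem Expr.holds_or {e f : Expr} {s : State} : (e.or f).Holds s ↔ e.Holds s ∨ f.Holds s := by
  simp only [Expr.Holds, Expr.or, Expr.eval]
  omega

theorem Expr.holds_imp {e f : Expr} {s : State} :
    (e.imp f).Holds s ↔ (e.Holds s → f.Holds s) := by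
  rw [Expr.imp, Expr.holds_or, Expr.holds_not, imp_iff_not_or]

theorem Expr.holds_and {e f : Expr} {s : State} : (e.and f).Holds s ↔ e.Holds s ∧ f.Holds s := by
  rw [Expr.and, Expr.holds_not, Expr.holds_or, Expr.holds_not, Expr.holds_not]
  tauto

theorem Expr.holds_iff {e f : Expr} {s : State} :
    (e.iff f).Holds s ↔ (e.Holds s ↔ f.Holds s) := by
  rw [Expr.iff, Expr.holds_and, Expr.holds_imp, Expr.holds_imp]
  tauto

theorem Expr.holds_eq {e f : Expr} {s : State} :
    (Expr.eq e f).Holds s ↔ e.eval s = f.eval s := by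
  simp [Expr.Holds, Expr.eval]

theorem Expr.holds_lt {e f : Expr} {s : State} :
    (Expr.lt e f).Holds s ↔ e.eval s < f.eval s := by
  simp [Expr.Holds, Expr.eval]

theorem wp_ite_iff {N : ℕ} {e : Expr} {c d : Cmd} {Q : State → Prop} {s : State} :
    wp N (.ite e c d) Q s ↔ (e.Holds s → wp N c Q s) ∧ (¬ e.Holds s → wp N d Q s) := by
  simp only [wp, Expr.Holds, ne_eq, not_not]

/-- The cell `a[e]`. -/
def at' (a r : ℕ) : Expr := .load a (.reg r)

/-- The entry of the adjacency matrix in the row `e` and the column `f`. -/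
def adjE (e f : Expr) : Expr := .load arrAdj (.add (.load arrRow e) f)

/-- The program `c`, if the test succeeds. -/
def whenever (e : Expr) (c : Cmd) : Cmd := .ite e c .skip

theorem wp_whenever_iff {N : ℕ} {e : Expr} {c : Cmd} {Q : State → Prop} {s : State} :
    wp N (whenever e c) Q s ↔ (e.Holds s → wp N c Q s) ∧ (¬ e.Holds s → Q s) :=
  wp_ite_iff

section Elementary

variable {n N : ℕ}

/-- The output so far consists of the contractions `out`. -/
def OutIs (s : State) (out : List (Fin n × Fin n)) : Prop :=
  s.output = encodeContractions out

theorem OutIs.of_eq {s s' : State} {out : List (Fin n × Fin n)} (h : OutIs s out)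
    (hr : s'.reg 0 = s.reg 0) (hm : s'.mem arrOut = s.mem arrOut) : OutIs s' out := by
  unfold OutIs State.output
  rw [hr, hm]
  exact h

/-- Append the contraction of `regU` and `regV` to the output. -/
def emit : Cmd :=
  .seq (.store arrOut (.reg 0) (.reg regU)) <| .seq
    (.store arrOut (.add (.reg 0) (.lit 1)) (.reg regV)) (.assign 0 (.add (.reg 0) (.lit 2)))

theorem wp_emit {s : State} {out : List (Fin n × Fin n)} (h : OutIs s out) {u v : Fin n}
    (hu : s.reg regU = u) (hv : s.reg regV = v) :
    wp N emit (fun s' => OutIs s' (out ++ [(u, v)])) s := by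
  unfold OutIs State.output at h
  simp only [emit, wp, OutIs, State.output, setReg_reg, setReg_mem, setMem_reg, Expr.eval, if_true,
    hu, hv, encodeContractions, List.flatMap_append] at h ⊢
  rw [← h, List.range_succ, List.range_succ]
  simp only [List.map_append, List.map_cons, List.map_nil, List.append_assoc, setMem_mem]
  congr 1
  · refine List.map_congr_left fun j hj => ?_
    rw [List.mem_range] at hj
    rw [setMem_mem, if_neg (by omega), setMem_mem, if_neg (by omega)]
  · simp

/-- Replace all values `regV` in the array by `regU`. -/
def relabel (arr : ℕ) : Cmd :=
  forUpTo regZ regN (whenever (.eq (at' arr regZ) (.reg regV)) (.store arr (.reg regZ) (.reg regU)))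

theorem wp_relabel (hN : n ≤ N) {arr u v : ℕ} {f : Fin n → ℕ} {s : State} (hn : s.reg regN = n)
    (hu : s.reg regU = u) (hv : s.reg regV = v) (hf : ∀ x : Fin n, s.mem arr x = f x) :
    wp N (relabel arr)
      (fun s' => ∀ x : Fin n, s'.mem arr x = if f x = v then u else f x) s := by
  refine wp_conseq (wp_forUpTo (n := n)
    (fun i s' => ∀ x : Fin n, s'.mem arr x = if (x : ℕ) < i ∧ f x = v then u else f x)
    (by decide) rfl rfl hN hn (by simpa using hf) (fun _ _ _ h => h) ?_) ?_
  · intro i s' hi hr _ ha hI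
    have hu' : s'.reg regU = u := (ha.reg regU rfl).trans hu
    have hv' : s'.reg regV = v := (ha.reg regV rfl).trans hv
    have hx : s'.mem arr i = f ⟨i, hi⟩ := by simpa using hI ⟨i, hi⟩
    rw [wp_whenever_iff, Expr.holds_eq]
    simp only [at', Expr.eval, hr, hv', hx, wp, setMem_mem, true_and, hu']
    constructor
    · intro h x
      by_cases hxi : (x : ℕ) = i
      · have : x = ⟨i, hi⟩ := Fin.ext hxi
        subst this
        simp [h]
      · have : (x : ℕ) < i + 1 ↔ (x : ℕ) < i := by omega
        simp only [hxi, if_false, this]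
        exact hI x
    · intro h x
      rw [hI x]
      by_cases hxi : (x : ℕ) = i
      · have : x = ⟨i, hi⟩ := Fin.ext hxi
        subst this
        simp [h]
      · have : (x : ℕ) < i + 1 ↔ (x : ℕ) < i := by omega
        simp only [this]
  · intro s' _ h x
    simpa using h x

/-- The vertices with label `l`, in their order. -/
def blockList (f : Fin n → ℕ) (l : ℕ) : List (Fin n) := (List.finRange n).filter fun x => f x = l

theorem take_succ_finRange {i : ℕ} (hi : i < n) :
    (List.finRange n).take (i + 1) = (List.finRange n).take i ++ [⟨i, hi⟩] := by
  rw [List.take_succ_eq_append_getElem (by simpa using hi)]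
  simp

theorem take_length_finRange : (List.finRange n).take n = List.finRange n := by
  rw [List.take_of_length_le (by simp)]

/-- List the vertices with label `regL` in `arrList`, and count them in `regCount`. -/
def listBlock : Cmd :=
  .seq (.assign regCount (.lit 0)) <| forUpTo regZ regN <|
    whenever (.eq (at' arrComp regZ) (.reg regL)) <|
      .seq (.store arrList (.reg regCount) (.reg regZ))
        (.assign regCount (.add (.reg regCount) (.lit 1)))

/-- The list `L` stands in the array `arrList`. -/
def ListIs (s : State) (L : List (Fin n)) : Prop :=
  ∀ j (hj : j < L.length), s.mem arrList j = L[j]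

theorem wp_listBlock (hN : n ≤ N) {l : ℕ} {f : Fin n → ℕ} {s : State} (hn : s.reg regN = n)
    (hl : s.reg regL = l) (hf : ∀ x : Fin n, s.mem arrComp x = f x) :
    wp N listBlock (fun s' => s'.reg regCount = (blockList f l).length ∧
      ListIs s' (blockList f l)) s := by
  rw [listBlock]
  change wp N (forUpTo _ _ _) _ _
  refine wp_conseq (wp_forUpTo (n := n)
    (fun i s' => s'.reg regCount = (((List.finRange n).take i).filter fun x => f x = l).length ∧
      ListIs s' (((List.finRange n).take i).filter fun x => f x = l))
    (by decide) rfl rfl hN (by simpa [setReg_reg] using hn) ?_ ?_ ?_) ?_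
  · simp [setReg_reg, Expr.eval, ListIs]
  · intro i s v h
    simpa [setReg_reg, setReg_mem, ListIs] using h
  · intro i s' hi hr _ ha ⟨hI1, hI2⟩
    have hl' : s'.reg regL = l := by
      rw [ha.reg regL rfl]
      simpa [setReg_reg] using hl
    have hx : s'.mem arrComp i = f ⟨i, hi⟩ := by
      rw [ha.mem arrComp rfl]
      exact hf ⟨i, hi⟩
    rw [wp_whenever_iff, Expr.holds_eq, take_succ_finRange hi, List.filter_append]
    simp only [at', Expr.eval, hr, hl', hx]
    constructor
    · intro h
      simp only [wp, setReg_reg, setReg_mem, setMem_reg, Expr.eval, hr, ListIs, setMem_mem]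
      simp only [h, decide_true, List.filter_cons, List.filter_nil, if_true, List.length_append,
        List.length_singleton, true_and, hI1]
      intro j hj
      by_cases hje : j = (((List.finRange n).take i).filter fun x => f x = l).length
      · subst hje
        simp
      · rw [if_neg hje, List.getElem_append_left (by omega)]
        exact hI2 j (by omega)
    · intro h
      simpa [h] using ⟨hI1, hI2⟩
  · rintro s' - h
    simpa [take_length_finRange, blockList] using h

end Elementary

end RAM

/-! ### The search for an embedding of a component -/

namespace RAM

/-- The input, the offsets of the rows of the adjacency matrix, and the labels of the components. -/
structure Static {n : ℕ} (G : SimpleGraph (Fin n)) (S W : Finset (Fin n))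
    (C : List (Fin n × Fin n)) (comp : Fin n → ℕ) (s : State) : Prop where
  n_eq : s.reg regN = n
  m_eq : s.reg regM = C.length
  adj : ∀ x y : Fin n, s.mem arrAdj (s.mem arrRow x + y) ≠ 0 ↔ G.Adj x y
  memS : ∀ x : Fin n, s.mem arrS x ≠ 0 ↔ x ∈ S
  memW : ∀ x : Fin n, s.mem arrW x ≠ 0 ↔ x ∈ W
  con : ∀ i (hi : i < C.length), s.mem arrC (i + i) = C[i].1 ∧ s.mem arrC (i + i + 1) = C[i].2
  comp : ∀ x : Fin n, s.mem arrComp x = comp x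

section Search

variable {n N : ℕ} {G : SimpleGraph (Fin n)} {S W : Finset (Fin n)} {C : List (Fin n × Fin n)}
  {comp : Fin n → ℕ} {π ψ : Fin n → Fin n}

theorem Static.of_eq {s s' : State} (h : Static G S W C comp s)
    (hn : s'.reg regN = s.reg regN) (hm : s'.reg regM = s.reg regM)
    (h1 : s'.mem arrAdj = s.mem arrAdj) (h2 : s'.mem arrS = s.mem arrS)
    (h3 : s'.mem arrW = s.mem arrW) (h4 : s'.mem arrC = s.mem arrC)
    (h5 : s'.mem arrRow = s.mem arrRow) (h6 : s'.mem arrComp = s.mem arrComp) :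
    Static G S W C comp s' := by
  constructor
  · rw [hn]; exact h.n_eq
  · rw [hm]; exact h.m_eq
  · rw [h1, h5]; exact h.adj
  · rw [h2]; exact h.memS
  · rw [h3]; exact h.memW
  · rw [h4]; exact h.con
  · rw [h6]; exact h.comp

theorem Static.of_agree {c : Cmd} {s s' : State} (h : Static G S W C comp s) (ha : Agree c s s')
    (hc : (modReg c regN || modReg c regM || modMem c arrAdj || modMem c arrS || modMem c arrW ||
      modMem c arrC || modMem c arrRow || modMem c arrComp) = false) :
    Static G S W C comp s' := by
  simp only [Bool.or_eq_false_iff] at hc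
  obtain ⟨⟨⟨⟨⟨⟨⟨h1, h2⟩, h3⟩, h4⟩, h5⟩, h6⟩, h7⟩, h8⟩ := hc
  exact h.of_eq (ha.reg _ h1) (ha.reg _ h2) (ha.mem _ h3) (ha.mem _ h4) (ha.mem _ h5)
    (ha.mem _ h6) (ha.mem _ h7) (ha.mem _ h8)

/-- The number of vertices before `x` that have the label of `x`. -/
def rank (f : Fin n → ℕ) (x : Fin n) : ℕ :=
  (((List.finRange n).take x).filter fun y => f y = f x).length

/-- The map from the class of a vertex to the list `H` that the number `code` describes: its digits,
to the base that is the length of `H`, are positions in `H`. -/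
def decodeMap (f : Fin n → ℕ) (H : List (Fin n)) (code : ℕ) (x : Fin n) : Fin n :=
  H.getD (code / H.length ^ rank f x % H.length) x

/-- Divide `regQ` by `regSizeC`, by repeated subtraction: the quotient is `regCount`, the remainder
is left in `regQ`. -/
def divide : Cmd :=
  .seq (.assign regCount (.lit 0)) <| forUpTo regY regN <|
    whenever (.not (.lt (.reg regQ) (.reg regSizeC))) <|
      .seq (.assign regQ (.sub (.reg regQ) (.reg regSizeC)))
        (.assign regCount (.add (.reg regCount) (.lit 1)))

theorem wp_divide (hN : n ≤ N) {s : State} {a q : ℕ} (ha : 0 < a) (hq : q < n)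
    (hn : s.reg regN = n) (hsa : s.reg regSizeC = a) (hsq : s.reg regQ = q) :
    wp N divide (fun s' => s'.reg regCount = q / a ∧ s'.reg regQ = q % a) s := by
  rw [divide]
  change wp N (forUpTo _ _ _) _ _
  refine wp_conseq (wp_forUpTo (n := n)
    (fun i s' => s'.reg regCount * a + s'.reg regQ = q ∧
      (s'.reg regQ < a ∨ i ≤ s'.reg regCount))
    (by decide) rfl rfl hN (by simpa [setReg_reg] using hn) ?_ ?_ ?_) ?_
  · simp [setReg_reg, Expr.eval, hsq]
  · intro i s v h
    simpa [setReg_reg] using h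
  · intro i s' hi hr _ hag ⟨h1, h2⟩
    have hsa' : s'.reg regSizeC = a := by
      rw [hag.reg regSizeC rfl]
      simpa [setReg_reg] using hsa
    rw [wp_whenever_iff, Expr.holds_not, Expr.holds_lt]
    simp only [wp, Expr.eval, setReg_reg, hsa']
    constructor
    · intro h
      norm_num
      constructor
      · rw [Nat.succ_mul]
        omega
      · omega
    · intro h
      rw [not_not] at h
      exact ⟨h1, Or.inl h⟩
  · rintro s' - ⟨h1, h2⟩
    have hlt : s'.reg regQ < a := by
      rcases h2 with h2 | h2
      · exact h2
      · have := Nat.mul_le_mul h2 ha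
        omega
    constructor
    · rw [← h1, Nat.add_comm, Nat.add_mul_div_right _ _ ha, Nat.div_eq_of_lt hlt, Nat.zero_add]
    · rw [← h1, Nat.add_comm, Nat.add_mul_mod_self_right, Nat.mod_eq_of_lt hlt]

/-- Decode `regCode` to a map on the vertices with label `regLC`, in `arrPhi`. -/
def decode : Cmd :=
  .seq (.assign regQ (.reg regCode)) <| forUpTo regX regN <|
    whenever (.eq (at' arrComp regX) (.reg regLC)) <| .seq divide <|
      .seq (.store arrPhi (.reg regX) (at' arrList regQ)) (.assign regQ (.reg regCount))

theorem wp_decode (hN : n ≤ N) {s : State} {H : List (Fin n)} {l code : ℕ} (hcode : code < n)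
    (hH : 0 < H.length) (hs : Static G S W C comp s) (hl : s.reg regLC = l)
    (hc : s.reg regCode = code) (ha : s.reg regSizeC = H.length) (hL : ListIs s H) :
    wp N decode (fun s' => ∀ x, comp x = l → s'.mem arrPhi x = decodeMap comp H code x) s := by
  rw [decode]
  change wp N (forUpTo _ _ _) _ _
  refine wp_conseq (wp_forUpTo (n := n)
    (fun i s' => s'.reg regQ =
        code / H.length ^ (((List.finRange n).take i).filter fun y => comp y = l).length ∧
      ∀ x : Fin n, (x : ℕ) < i → comp x = l → s'.mem arrPhi x = decodeMap comp H code x)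
    (by decide) rfl rfl hN (by simpa [setReg_reg] using hs.n_eq) ?_ ?_ ?_) ?_
  · simp [setReg_reg, Expr.eval, hc]
  · intro i s v h
    simpa [setReg_reg, setReg_mem] using h
  · intro i s' hi hr hn' hag ⟨h1, h2⟩
    have hs' : Static G S W C comp s' :=
      (hs.of_eq (s' := s.setReg regQ _) rfl rfl rfl rfl rfl rfl rfl rfl).of_agree hag rfl
    have hl' : s'.reg regLC = l := by
      rw [hag.reg regLC rfl]
      simpa [setReg_reg] using hl
    have ha' : s'.reg regSizeC = H.length := by
      rw [hag.reg regSizeC rfl]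
      simpa [setReg_reg] using ha
    have hL' : ListIs s' H := by
      intro j hj
      rw [hag.mem arrList rfl]
      exact hL j hj
    have hx := hs'.comp ⟨i, hi⟩
    simp only at hx
    rw [wp_whenever_iff, Expr.holds_eq, take_succ_finRange hi, List.filter_append]
    simp only [at', Expr.eval, hr, hl', hx]
    constructor
    · intro h
      change wp N divide (wp N _ _) _
      refine wp_conseq (wp_divide hN hH (lt_of_le_of_lt (Nat.div_le_self _ _) hcode) hn' ha' h1) ?_
      intro s'' hag' ⟨h3, h4⟩
      have hr'' : s''.reg regX = i := (hag'.reg regX rfl).trans hr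
      have hmem : s''.mem arrPhi = s'.mem arrPhi := hag'.mem arrPhi rfl
      have hL'' : ListIs s'' H := by
        intro j hj
        rw [hag'.mem arrList rfl]
        exact hL' j hj
      simp only [wp, setReg_reg, setReg_mem, setMem_reg, Expr.eval, if_true, hr'', h3, h4,
        setMem_mem, true_and]
      constructor
      · simp only [h, decide_true, List.filter_cons, List.filter_nil, if_true, List.length_append,
          List.length_singleton, pow_succ]
        rw [Nat.div_div_eq_div_mul]
      · intro x hxi hxl
        by_cases hxe : (x : ℕ) = i
        · have hxe' : x = ⟨i, hi⟩ := Fin.ext hxe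
          subst hxe'
          have hlt := Nat.mod_lt (code / H.length ^ (((List.finRange n).take i).filter
            fun y => comp y = l).length) hH
          rw [if_pos rfl, hL'' _ hlt, decodeMap, rank, List.getD_eq_getElem _ _ (by
            rw [hxl]; exact hlt)]
          simp only [hxl]
        · rw [if_neg hxe, hmem]
          exact h2 x (by omega) hxl
    · intro h
      simp only [h, decide_false, List.filter_cons, List.filter_nil]
      refine ⟨by simpa using h1, fun x hxi hxl => ?_⟩
      refine h2 x ?_ hxl
      rcases Nat.lt_succ_iff_lt_or_eq.1 hxi with h3 | h3
      · exact h3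
      · have hxe' : x = ⟨i, hi⟩ := Fin.ext h3
        rw [hxe'] at hxl
        exact (h hxl).elim
  · rintro s' - ⟨-, h⟩ x hx
    exact h x x.2 hx

/-- The test for the vertex `regX`, its image `regH`, and a further vertex `regY`. -/
def pairTest : Expr :=
  .and (.imp (.eq (at' arrComp regY) (.reg regLC))
      (.and (.iff (adjE (.reg regX) (.reg regY)) (adjE (.reg regH) (at' arrPhi regY)))
        (.imp (.eq (.reg regH) (at' arrPhi regY)) (.eq (.reg regX) (.reg regY)))))
    (.and (.imp (at' arrS regY)
        (.iff (adjE (.reg regX) (.reg regY)) (adjE (.reg regH) (.reg regY))))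
      (.imp (at' arrW regY)
        (.iff (adjE (.reg regX) (.reg regY)) (adjE (.reg regX) (at' arrPart regY)))))

/-- The vertex `regY` is a vertex of another component in the part of `regH`. -/
def otherTest : Expr :=
  .and (.and (at' arrW regY) (.not (at' arrS regY)))
    (.and (.not (.eq (at' arrComp regY) (at' arrComp regH)))
      (.eq (at' arrPart regY) (at' arrPart regH)))

/-- Set `regOk` to the truth value of its conjunction with a test. -/
def require (e : Expr) : Cmd := .assign regOk (.and (.reg regOk) e)

/-- Decide whether the vertices with label `regLC` can be absorbed through the map in `arrPhi`. -/
def check : Cmd :=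
  .seq (.assign regOk (.lit 1)) <| forUpTo regX regN <|
    whenever (.eq (at' arrComp regX) (.reg regLC)) <|
      .seq (.assign regH (at' arrPhi regX)) <|
      .seq (require (.and (at' arrW regH) (.not (at' arrS regH)))) <|
      .seq (.assign regFound (.lit 0)) <|
      .seq (forUpTo regY regN (.seq (require pairTest)
        (.assign regFound (.or (.reg regFound) otherTest)))) <|
      require (.reg regFound)

/-- The condition that `pairTest` decides. -/
def PairCondition (G : SimpleGraph (Fin n)) (S W : Finset (Fin n)) (comp : Fin n → ℕ)
    (π ψ : Fin n → Fin n) (l : ℕ) (k y : Fin n) : Prop :=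
  (comp y = l → (G.Adj k y ↔ G.Adj (ψ k) (ψ y)) ∧ (ψ k = ψ y → k = y)) ∧
  (y ∈ S → (G.Adj k y ↔ G.Adj (ψ k) y)) ∧ (y ∈ W → (G.Adj k y ↔ G.Adj k (π y)))

/-- The condition that `otherTest` decides. -/
def OtherCondition (S W : Finset (Fin n)) (comp : Fin n → ℕ) (π ψ : Fin n → Fin n)
    (k z : Fin n) : Prop :=
  (z ∈ W ∧ z ∉ S) ∧ comp z ≠ comp (ψ k) ∧ π z = π (ψ k)

theorem absorbable_iff {l : ℕ} (hl : ∀ x, comp x = l → x ∉ S) :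
    Absorbable G S W comp π (block S comp l) ψ ↔ ∀ k, comp k = l → (ψ k ∈ W ∧ ψ k ∉ S) ∧
      (∀ y, PairCondition G S W comp π ψ l k y) ∧ ∃ z, OtherCondition S W comp π ψ k z := by
  have hb : ∀ x, x ∈ block S comp l ↔ comp x = l := fun x =>
    ⟨fun h => (mem_block.1 h).2, fun h => mem_block.2 ⟨hl x h, h⟩⟩
  constructor
  · intro h k hk
    refine ⟨h.mem k ((hb k).2 hk), fun y => ⟨fun hy => ⟨h.adj k ((hb k).2 hk) y ((hb y).2 hy),
      h.inj k ((hb k).2 hk) y ((hb y).2 hy)⟩, h.adjS k ((hb k).2 hk) y,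
      h.homog k ((hb k).2 hk) y⟩, ?_⟩
    obtain ⟨z, h1, h2, h3, h4⟩ := h.other k ((hb k).2 hk)
    exact ⟨z, ⟨h1, h2⟩, h3, h4⟩
  · intro h
    constructor
    · exact fun k hk => (h k ((hb k).1 hk)).1
    · exact fun k hk y hy => (((h k ((hb k).1 hk)).2.1 y).1 ((hb y).1 hy)).1
    · exact fun k hk y hy => (((h k ((hb k).1 hk)).2.1 y).1 ((hb y).1 hy)).2
    · exact fun k hk y hy => ((h k ((hb k).1 hk)).2.1 y).2.1 hy
    · intro k hk
      obtain ⟨z, ⟨h1, h2⟩, h3, h4⟩ := (h k ((hb k).1 hk)).2.2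
      exact ⟨z, h1, h2, h3, h4⟩
    · exact fun k hk y hy => ((h k ((hb k).1 hk)).2.1 y).2.2 hy

theorem Static.holds_adj {s : State} (hs : Static G S W C comp s) {e f : Expr} {x y : Fin n}
    (hx : e.eval s = x) (hy : f.eval s = y) : (adjE e f).Holds s ↔ G.Adj x y := by
  simp only [Expr.Holds, adjE, Expr.eval, hx, hy]
  exact hs.adj x y

theorem Static.holds_pairTest {s : State} (hs : Static G S W C comp s) {l : ℕ} {k y : Fin n}
    (hl : s.reg regLC = l) (hk : s.reg regX = k) (hy : s.reg regY = y) (hh : s.reg regH = ψ k)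
    (hψ : ∀ x, comp x = l → s.mem arrPhi x = ψ x) (hπ : ∀ x : Fin n, s.mem arrPart x = π x) :
    pairTest.Holds s ↔ PairCondition G S W comp π ψ l k y := by
  have e1 : (adjE (.reg regX) (.reg regY)).Holds s ↔ G.Adj k y := hs.holds_adj hk hy
  have e2 : (adjE (.reg regH) (.reg regY)).Holds s ↔ G.Adj (ψ k) y := hs.holds_adj hh hy
  have e3 : (adjE (.reg regX) (at' arrPart regY)).Holds s ↔ G.Adj k (π y) :=
    hs.holds_adj hk (by simp only [at', Expr.eval, hy, hπ])
  have e4 : (at' arrS regY).Holds s ↔ y ∈ S := by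
    simp only [Expr.Holds, at', Expr.eval, hy]
    exact hs.memS y
  have e5 : (at' arrW regY).Holds s ↔ y ∈ W := by
    simp only [Expr.Holds, at', Expr.eval, hy]
    exact hs.memW y
  have e6 : (Expr.eq (at' arrComp regY) (.reg regLC)).Holds s ↔ comp y = l := by
    rw [Expr.holds_eq]
    simp only [at', Expr.eval, hy, hl, hs.comp]
  have e7 : (Expr.eq (.reg regX) (.reg regY)).Holds s ↔ k = y := by
    rw [Expr.holds_eq]
    simp only [Expr.eval, hk, hy, Fin.ext_iff]
  simp only [pairTest, PairCondition, Expr.holds_and, Expr.holds_imp, Expr.holds_iff, e1, e2, e3,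
    e4, e5, e6, e7]
  refine and_congr_left fun _ => forall_congr' fun hyl => ?_
  have e8 : (at' arrPhi regY).eval s = ψ y := by
    simp only [at', Expr.eval, hy, hψ y hyl]
  rw [hs.holds_adj (e := .reg regH) (x := ψ k) (y := ψ y) hh e8, Expr.holds_eq, e8]
  simp only [Expr.eval, hh, Fin.ext_iff]

theorem Static.holds_otherTest {s : State} (hs : Static G S W C comp s) {k y : Fin n}
    (hy : s.reg regY = y) (hh : s.reg regH = ψ k) (hπ : ∀ x : Fin n, s.mem arrPart x = π x) :
    otherTest.Holds s ↔ OtherCondition S W comp π ψ k y := by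
  have e4 : (at' arrS regY).Holds s ↔ y ∈ S := by
    simp only [Expr.Holds, at', Expr.eval, hy]
    exact hs.memS y
  have e5 : (at' arrW regY).Holds s ↔ y ∈ W := by
    simp only [Expr.Holds, at', Expr.eval, hy]
    exact hs.memW y
  simp only [otherTest, OtherCondition, Expr.holds_and, Expr.holds_not, Expr.holds_eq, e4, e5]
  simp only [at', Expr.eval, hy, hh, hs.comp, hπ, Fin.ext_iff, ne_eq]

theorem wp_require_iff {e : Expr} {Q : State → Prop} {s : State} :
    wp N (require e) Q s ↔ Q (s.setReg regOk ((Expr.and (.reg regOk) e).eval s)) := Iff.rfl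

theorem and_regOk_ne_zero {e : Expr} {s : State} :
    (Expr.and (.reg regOk) e).eval s ≠ 0 ↔ s.reg regOk ≠ 0 ∧ e.Holds s :=
  Expr.holds_and (e := .reg regOk)

theorem wp_check (hN : n ≤ N) {s : State} {l : ℕ} (hs : Static G S W C comp s)
    (hl : s.reg regLC = l) (hψ : ∀ x, comp x = l → s.mem arrPhi x = ψ x)
    (hπ : ∀ x : Fin n, s.mem arrPart x = π x) (hlS : ∀ x, comp x = l → x ∉ S) :
    wp N check (fun s' => s'.reg regOk ≠ 0 ↔ Absorbable G S W comp π (block S comp l) ψ) s := by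
  rw [check]
  change wp N (forUpTo _ _ _) _ _
  refine wp_conseq (wp_forUpTo (n := n)
    (fun i s' => s'.reg regOk ≠ 0 ↔ ∀ k : Fin n, (k : ℕ) < i → comp k = l →
      (ψ k ∈ W ∧ ψ k ∉ S) ∧
      (∀ y, PairCondition G S W comp π ψ l k y) ∧ ∃ z, OtherCondition S W comp π ψ k z)
    (by decide) rfl rfl hN (by simpa [setReg_reg] using hs.n_eq) ?_ ?_ ?_) ?_
  · simp [setReg_reg, Expr.eval]
  · intro i s v h
    simpa [setReg_reg] using h
  · intro i s' hi hr hn' hag hI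
    have hs' : Static G S W C comp s' :=
      (hs.of_eq (s' := s.setReg regOk _) rfl rfl rfl rfl rfl rfl rfl rfl).of_agree hag rfl
    have hl' : s'.reg regLC = l := by
      rw [hag.reg regLC rfl]
      simpa [setReg_reg] using hl
    have hψ' : ∀ x, comp x = l → s'.mem arrPhi x = ψ x := by
      rw [hag.mem arrPhi rfl]
      exact hψ
    have hπ' : ∀ x : Fin n, s'.mem arrPart x = π x := by
      rw [hag.mem arrPart rfl]
      exact hπ
    have hx := hs'.comp ⟨i, hi⟩
    simp only at hx
    have hsplit : ∀ P : Fin n → Prop, (∀ k : Fin n, (k : ℕ) < i + 1 → comp k = l → P k) ↔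
        (∀ k : Fin n, (k : ℕ) < i → comp k = l → P k) ∧ (comp ⟨i, hi⟩ = l → P ⟨i, hi⟩) := by
      intro P
      constructor
      · exact fun h => ⟨fun k hk => h k (by omega), h ⟨i, hi⟩ (Nat.lt_succ_self i)⟩
      · rintro ⟨h1, h2⟩ k hk
        rcases Nat.lt_succ_iff_lt_or_eq.1 hk with h3 | h3
        · exact h1 k h3
        · have : k = ⟨i, hi⟩ := Fin.ext h3
          rw [this]
          exact h2
    rw [wp_whenever_iff, Expr.holds_eq]
    simp only [at', Expr.eval, hr, hl', hx]
    constructor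
    · intro h
      have hpsi := hψ' ⟨i, hi⟩ h
      simp only at hpsi
      change wp N (forUpTo _ _ _) (wp N (require _) _)
        (((s'.setReg regH _).setReg regOk _).setReg regFound 0)
      simp only [Expr.eval, hr, hpsi]
      set s₁ := s'.setReg regH (ψ ⟨i, hi⟩) with hs₁
      set e₁ := Expr.and (.load arrW (.reg regH)) (Expr.not (.load arrS (.reg regH))) with he₁
      have hst₁ : Static G S W C comp s₁ := hs'.of_eq rfl rfl rfl rfl rfl rfl rfl rfl
      have hok₁ : (Expr.and (.reg regOk) e₁).eval s₁ ≠ 0 ↔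
          s'.reg regOk ≠ 0 ∧ (ψ ⟨i, hi⟩ ∈ W ∧ ψ ⟨i, hi⟩ ∉ S) := by
        rw [and_regOk_ne_zero]
        refine and_congr Iff.rfl ?_
        rw [he₁, Expr.holds_and, Expr.holds_not]
        exact and_congr (hst₁.memW _) (not_congr (hst₁.memS _))
      set s₂ := (s₁.setReg regOk ((Expr.and (.reg regOk) e₁).eval s₁)).setReg regFound 0 with hs₂
      have hst₂ : Static G S W C comp s₂ := hst₁.of_eq rfl rfl rfl rfl rfl rfl rfl rfl
      refine wp_conseq (wp_forUpTo (n := n)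
        (fun j s'' => (s''.reg regOk ≠ 0 ↔ (s'.reg regOk ≠ 0 ∧ (ψ ⟨i, hi⟩ ∈ W ∧ ψ ⟨i, hi⟩ ∉ S)) ∧
            ∀ y : Fin n, (y : ℕ) < j → PairCondition G S W comp π ψ l ⟨i, hi⟩ y) ∧
          (s''.reg regFound ≠ 0 ↔ ∃ z : Fin n, (z : ℕ) < j ∧
            OtherCondition S W comp π ψ ⟨i, hi⟩ z))
        (by decide) rfl rfl hN hst₂.n_eq ?_ ?_ ?_) ?_
      · constructor
        · rw [hs₂]
          simp only [setReg_reg, Nat.not_lt_zero, false_imp_iff, imp_true_iff, and_true]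
          norm_num
          simpa using hok₁
        · simp [hs₂, setReg_reg]
      · intro i s v h
        simpa [setReg_reg] using h
      · intro j s'' hj hrj _ hag' ⟨h1, h2⟩
        have hst : Static G S W C comp s'' := hst₂.of_agree hag' rfl
        have hk' : s''.reg regX = (⟨i, hi⟩ : Fin n) := by
          rw [hag'.reg regX rfl]
          simpa [hs₂, hs₁, setReg_reg] using hr
        have hh' : s''.reg regH = ψ ⟨i, hi⟩ := by
          rw [hag'.reg regH rfl]
          simp [hs₂, hs₁, setReg_reg]
        have hlc : s''.reg regLC = l := by
          rw [hag'.reg regLC rfl]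
          simpa [hs₂, hs₁, setReg_reg] using hl'
        have hψ'' : ∀ x, comp x = l → s''.mem arrPhi x = ψ x := by
          rw [hag'.mem arrPhi rfl]
          exact hψ'
        have hπ'' : ∀ x : Fin n, s''.mem arrPart x = π x := by
          rw [hag'.mem arrPart rfl]
          exact hπ'
        have hp := hst.holds_pairTest (y := ⟨j, hj⟩) hlc hk' hrj hh' hψ'' hπ''
        change _ ∧ _
        have hst' : Static G S W C comp
            (s''.setReg regOk ((Expr.and (.reg regOk) pairTest).eval s'')) :=
          hst.of_eq rfl rfl rfl rfl rfl rfl rfl rfl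
        have ho := hst'.holds_otherTest (y := ⟨j, hj⟩) (π := π) (ψ := ψ) (k := ⟨i, hi⟩)
          (by simpa [setReg_reg] using hrj) (by simpa [setReg_reg] using hh') hπ''
        constructor
        · have e1 : ∀ (a b : ℕ) (s : State), ((s.setReg regOk a).setReg regFound b).reg regOk = a :=
            fun a b s => by simp [setReg_reg]
          rw [e1, and_regOk_ne_zero, hp, h1, and_assoc]
          refine and_congr_right fun _ =>
            ⟨?_, fun h3 => ⟨fun y hy => h3 y (by omega), h3 _ (by simp)⟩⟩
          rintro ⟨h3, h4⟩ y hy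
          rcases Nat.lt_succ_iff_lt_or_eq.1 hy with h5 | h5
          · exact h3 y h5
          · have : y = ⟨j, hj⟩ := Fin.ext h5
            rw [this]
            exact h4
        · have e1 : ∀ (a b : ℕ) (s : State),
              ((s.setReg regOk a).setReg regFound b).reg regFound = b :=
            fun a b s => by simp [setReg_reg]
          rw [e1]
          have e2 := Expr.holds_or (e := .reg regFound) (f := otherTest)
            (s := s''.setReg regOk ((Expr.and (.reg regOk) pairTest).eval s''))
          rw [ho] at e2
          refine e2.trans ?_
          have e3 : (Expr.reg regFound).Holds
              (s''.setReg regOk ((Expr.and (.reg regOk) pairTest).eval s'')) ↔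
              s''.reg regFound ≠ 0 := by
            simp [Expr.Holds, Expr.eval, setReg_reg]
          rw [e3, h2]
          constructor
          · rintro (⟨z, hz, h3⟩ | h3)
            · exact ⟨z, by omega, h3⟩
            · exact ⟨_, by simp, h3⟩
          · rintro ⟨z, hz, h3⟩
            rcases Nat.lt_succ_iff_lt_or_eq.1 hz with h5 | h5
            · exact Or.inl ⟨z, h5, h3⟩
            · have : z = ⟨j, hj⟩ := Fin.ext h5
              rw [this] at h3
              exact Or.inr h3
      · rintro s'' - ⟨h1, h2⟩
        rw [wp_require_iff]
        have e1 : ∀ (a : ℕ) (s : State), (s.setReg regOk a).reg regOk = a :=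
            fun a s => by simp [setReg_reg]
        rw [e1, and_regOk_ne_zero, h1, hsplit, hI, and_assoc, and_assoc]
        have e3 : (Expr.reg regFound).Holds s'' ↔ s''.reg regFound ≠ 0 := Iff.rfl
        rw [e3, h2]
        refine and_congr_right fun _ => ⟨?_, ?_⟩
        · rintro ⟨h3, h4, z, -, h5⟩ -
          exact ⟨h3, fun y => h4 y y.2, z, h5⟩
        · intro h3
          obtain ⟨h4, h5, z, h6⟩ := h3 h
          exact ⟨h4, fun y _ => h5 y, z, z.2, h6⟩
    · intro h
      rw [hsplit, hI]
      exact ⟨fun h3 => ⟨h3, fun h4 => (h h4).elim⟩, fun h3 => h3.1⟩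
  · intro s' _ h
    rw [h, absorbable_iff hlS]
    exact ⟨fun h1 k => h1 k k.2, fun h1 k _ => h1 k⟩

end Search

end RAM

namespace RAM

section Codes

variable {n : ℕ} {f : Fin n → ℕ}

theorem exists_digits {a : ℕ} (ha : 0 < a) (r : ℕ) (g : ℕ → ℕ) (hg : ∀ i, g i < a) :
    ∃ code < a ^ r, ∀ i < r, code / a ^ i % a = g i := by
  induction r generalizing g with
  | zero => exact ⟨0, by simp, by simp⟩
  | succ r ih =>
    obtain ⟨c, hc, h⟩ := ih (fun i => g (i + 1)) fun i => hg (i + 1)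
    have h0 := hg 0
    refine ⟨g 0 + a * c, ?_, fun i hi => ?_⟩
    · rw [pow_succ]
      nlinarith
    · cases i with
      | zero => simp [Nat.mod_eq_of_lt h0]
      | succ i =>
        rw [pow_succ', ← Nat.div_div_eq_div_mul, Nat.add_mul_div_left _ _ ha,
          Nat.div_eq_of_lt h0, Nat.zero_add]
        exact h i (by omega)

theorem mem_blockList {l : ℕ} {x : Fin n} : x ∈ blockList f l ↔ f x = l := by
  simp [blockList]

theorem blockList_rank (x : Fin n) :
    ∃ h : rank f x < (blockList f (f x)).length, (blockList f (f x))[rank f x] = x := by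
  have hsplit : List.finRange n =
      (List.finRange n).take x ++ x :: (List.finRange n).drop (x + 1) := by
    have h1 : (List.finRange n).drop x = x :: (List.finRange n).drop (x + 1) := by
      rw [List.drop_eq_getElem_cons (by simp)]
      simp
    rw [← h1, List.take_append_drop]
  have hb : blockList f (f x) = ((List.finRange n).take x).filter (fun y => f y = f x) ++
      x :: ((List.finRange n).drop (x + 1)).filter fun y => f y = f x := by
    unfold blockList
    conv_lhs => rw [hsplit]
    rw [List.filter_append, List.filter_cons, if_pos (by simp)]
  have hlen : rank f x < (blockList f (f x)).length := by
    rw [hb, List.length_append, List.length_cons, rank]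
    omega
  refine ⟨hlen, ?_⟩
  have : (blockList f (f x))[rank f x]? = some x := by
    rw [hb, List.getElem?_append_right (by rfl), rank, Nat.sub_self]
    rfl
  rw [List.getElem?_eq_getElem hlen] at this
  exact Option.some_injective _ this

/-- Every map from one class to another of the same size is described by a code. -/
theorem exists_decodeMap {l l' : ℕ} (hlen : (blockList f l').length = (blockList f l).length)
    (hpos : 0 < (blockList f l).length) {ψ : Fin n → Fin n} (hψ : ∀ k, f k = l → f (ψ k) = l') :
    ∃ code < (blockList f l).length ^ (blockList f l).length,
      ∀ k, f k = l → decodeMap f (blockList f l') code k = ψ k := by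
  obtain ⟨c, hc, h⟩ := exists_digits hpos (blockList f l).length
    (fun i => if hi : i < (blockList f l).length then
      (blockList f l').idxOf (ψ (blockList f l)[i]) else 0) (fun i => by
        split_ifs with hi
        · rw [← hlen]
          refine List.idxOf_lt_length_iff.2 (mem_blockList.2 (hψ _ (mem_blockList.1 ?_)))
          exact List.getElem_mem hi
        · exact hpos)
  refine ⟨c, hc, fun k hk => ?_⟩
  obtain ⟨h1, h2⟩ := blockList_rank (f := f) k
  have h1' : rank f k < (blockList f l).length := by rw [← hk]; exact h1
  have h2' : (blockList f l)[rank f k] = k := by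
    simp only [← hk]
    exact h2
  have h3 := h _ h1'
  rw [dif_pos h1', h2'] at h3
  have h4 : (blockList f l').idxOf (ψ k) < (blockList f l').length :=
    List.idxOf_lt_length_iff.2 (mem_blockList.2 (hψ k hk))
  rw [decodeMap, hlen, h3, List.getD_eq_getElem _ _ h4, List.getElem_idxOf]

end Codes

/-! ### The program that absorbs a component -/

section AbsorbProgram

variable {n N : ℕ} {G : SimpleGraph (Fin n)} {S W : Finset (Fin n)} {C : List (Fin n × Fin n)}
  {comp : Fin n → ℕ} {ψ : Fin n → Fin n}

/-- The array `arrTab` holds the table `R`; the entries are shifted by one, and `0` stands for no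
entry. -/
def TabIs (s : State) (R : Fin n → Option (Fin n)) : Prop :=
  ∀ u : Fin n, s.mem arrTab u = (R u).elim 0 fun k => (k : ℕ) + 1

theorem TabIs.update {s s' : State} {R : Fin n → Option (Fin n)} (h : TabIs s R) (u : Fin n)
    (o : Option (Fin n)) (hs : ∀ j, s'.mem arrTab j =
      if j = u then o.elim 0 fun k => (k : ℕ) + 1 else s.mem arrTab j) :
    TabIs s' (Function.update R u o) := by
  intro w
  rw [hs, Function.update_apply, h w]
  by_cases hw : w = u
  · simp [hw]
  · have : ¬ (w : ℕ) = u := fun h => hw (Fin.ext h)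
    simp [hw, this]

/-- Set up the table for the class with label `regLC`, and mark its vertices as done. -/
def setTable : Cmd :=
  .seq (forUpTo regX regN (.store arrTab (.reg regX) (.lit 0))) <|
    forUpTo regX regN <| whenever (.eq (at' arrComp regX) (.reg regLC)) <|
      .seq (.store arrTab (at' arrPhi regX) (.add (.reg regX) (.lit 1)))
        (.store arrDone (.reg regX) (.lit 1))

theorem wp_setTable (hN : n ≤ N) {s : State} {l : ℕ} {f : Fin n → ℕ}
    (hs : Static G S W C comp s) (hl : s.reg regLC = l)
    (hψ : ∀ x, comp x = l → s.mem arrPhi x = ψ x)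
    (hinj : ∀ x y, comp x = l → comp y = l → ψ x = ψ y → x = y)
    (hf : ∀ x : Fin n, s.mem arrDone x = f x) :
    wp N setTable (fun s' => (∃ R, (∀ u k, R u = some k ↔ k ∈ blockList comp l ∧ ψ k = u) ∧
      TabIs s' R) ∧ ∀ x : Fin n, s'.mem arrDone x = if comp x = l then 1 else f x) s := by
  change wp N (forUpTo _ _ _) (wp N _ _) _
  refine wp_conseq (wp_forUpTo (n := n)
    (fun i s' => ∀ x : Fin n, (x : ℕ) < i → s'.mem arrTab x = 0)
    (by decide) rfl rfl hN hs.n_eq (by simp) (fun _ _ _ h => h) ?_) ?_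
  · intro i s' hi hr _ _ hI x hx
    simp only [Expr.eval, hr, setMem_mem, true_and]
    split_ifs with h
    · rfl
    · exact hI x (by omega)
  · intro s₁ ha₁ h0
    have hs₁ : Static G S W C comp s₁ := hs.of_agree ha₁ rfl
    refine wp_conseq (wp_forUpTo (n := n)
      (fun i s' => (∃ R : Fin n → Option (Fin n),
        (∀ u k : Fin n, R u = some k ↔ ((k : ℕ) < i ∧ comp k = l) ∧ ψ k = u) ∧
        TabIs s' R) ∧ ∀ x : Fin n, s'.mem arrDone x = if (x : ℕ) < i ∧ comp x = l then 1 else f x)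
      (by decide) rfl rfl hN hs₁.n_eq ?_ (fun _ _ _ h => h) ?_) ?_
    · refine ⟨⟨fun _ => none, by simp, fun u => ?_⟩, fun x => ?_⟩
      · simpa using h0 u u.2
      · simpa [ha₁.mem arrDone rfl] using hf x
    · rintro i s' hi hr - ha ⟨⟨R, hR, hT⟩, hD⟩
      have hs' : Static G S W C comp s' := hs₁.of_agree ha rfl
      have hl' : s'.reg regLC = l := ((ha.reg regLC rfl).trans (ha₁.reg regLC rfl)).trans hl
      have hx := hs'.comp ⟨i, hi⟩
      simp only at hx
      have hlt : ∀ x : Fin n, (x : ℕ) < i + 1 ↔ (x : ℕ) < i ∨ x = ⟨i, hi⟩ := by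
        intro x
        rw [Fin.ext_iff]
        simp only
        omega
      have hlt' : ∀ x : Fin n, (x : ℕ) = i ↔ x = ⟨i, hi⟩ := by
        intro x
        rw [Fin.ext_iff]
      rw [wp_whenever_iff, Expr.holds_eq]
      simp only [at', Expr.eval, hr, hl', hx]
      constructor
      · intro h
        have hpsi : s'.mem arrPhi i = ψ ⟨i, hi⟩ := by
          rw [ha.mem arrPhi rfl, ha₁.mem arrPhi rfl]
          exact hψ ⟨i, hi⟩ h
        change _ ∧ _
        simp only [Expr.eval, setMem_mem, setMem_reg, hr, hpsi]
        refine ⟨⟨Function.update R (ψ ⟨i, hi⟩) (some ⟨i, hi⟩), fun u k => ?_,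
          hT.update _ _ fun j => ?_⟩, fun x => ?_⟩
        · rw [Function.update_apply]
          split_ifs with hu
          · rw [Option.some.injEq]
            constructor
            · rintro rfl
              exact ⟨⟨(hlt _).2 (Or.inr rfl), h⟩, hu.symm⟩
            · rintro ⟨⟨-, h1⟩, h2⟩
              exact hinj _ _ h h1 (hu.symm.trans h2.symm)
          · rw [hR, hlt]
            constructor
            · rintro ⟨⟨h1, h2⟩, h3⟩
              exact ⟨⟨Or.inl h1, h2⟩, h3⟩
            · rintro ⟨⟨h1 | h1, h2⟩, h3⟩
              · exact ⟨⟨h1, h2⟩, h3⟩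
              · rw [h1] at h3
                exact (hu h3.symm).elim
        · simp [setMem_mem]
        · simp only [hD, hlt, true_and, hlt']
          by_cases hxi : x = ⟨i, hi⟩
          · subst hxi
            simp [h]
          · simp [hxi]
      · intro h
        have hne : ∀ x : Fin n, ((x : ℕ) < i + 1 ∧ comp x = l) ↔ ((x : ℕ) < i ∧ comp x = l) := by
          intro x
          rw [hlt]
          constructor
          · rintro ⟨h1 | h1, h2⟩
            · exact ⟨h1, h2⟩
            · rw [h1] at h2
              exact (h h2).elim
          · rintro ⟨h1, h2⟩
            exact ⟨Or.inl h1, h2⟩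
        simp only [hne]
        exact ⟨⟨R, hR, hT⟩, hD⟩
    · rintro s' - ⟨⟨R, hR, hT⟩, hD⟩
      refine ⟨⟨R, fun u k => ?_, hT⟩, fun x => ?_⟩
      · rw [hR, mem_blockList]
        simp [k.2]
      · rw [hD]
        simp [x.2]

/-- Repeat the first `regTime` contractions of the input on the parts in the table. -/
def mimicLoop : Cmd :=
  forUpTo regX regTime <|
    .seq (.assign regP (.load arrC (.add (.reg regX) (.reg regX)))) <|
    .seq (.assign regR (.load arrC (.add (.add (.reg regX) (.reg regX)) (.lit 1)))) <|
    whenever (at' arrTab regR) <|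
      .seq (.ite (at' arrTab regP)
        (.seq (.assign regU (.sub (at' arrTab regP) (.lit 1))) <|
          .seq (.assign regV (.sub (at' arrTab regR) (.lit 1))) emit)
        (.store arrTab (.reg regP) (at' arrTab regR)))
      (.store arrTab (.reg regR) (.lit 0))

theorem mimicList_append {V : Type*} [DecidableEq V] (R : V → Option V) (C D : List (V × V)) :
    mimicList R (C ++ D) = mimicList R C ++ mimicList (C.foldl mimicTable R) D := by
  induction C generalizing R with
  | nil => rfl
  | cons c C ih => simp [mimicList, ih]

theorem wp_mimicLoop {s : State} {R : Fin n → Option (Fin n)} {out : List (Fin n × Fin n)} {τ : ℕ}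
    (hτN : τ ≤ N) (hτ : τ ≤ C.length) (hs : Static G S W C comp s) (ht : s.reg regTime = τ)
    (hR : TabIs s R) (hout : OutIs s out) :
    wp N mimicLoop (fun s' => TabIs s' ((C.take τ).foldl mimicTable R) ∧
      OutIs s' (out ++ mimicList R (C.take τ))) s := by
  refine wp_conseq (wp_forUpTo (n := τ)
    (fun i s' => TabIs s' ((C.take i).foldl mimicTable R) ∧
      OutIs s' (out ++ mimicList R (C.take i)))
    (by decide) rfl rfl hτN ht ?_ (fun _ _ _ h => ⟨h.1, h.2.of_eq rfl rfl⟩) ?_) fun _ _ h => h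
  · simpa [mimicList] using ⟨hR, hout⟩
  · rintro i s' hi hr - ha ⟨hT, hO⟩
    have hs' : Static G S W C comp s' := hs.of_agree ha rfl
    have hiC : i < C.length := lt_of_lt_of_le hi hτ
    obtain ⟨hc1, hc2⟩ := hs'.con i hiC
    rw [List.take_succ_eq_append_getElem hiC, List.foldl_append, mimicList_append]
    set R' := (C.take i).foldl mimicTable R with hR'
    set u := (C[i]).1 with hu
    set v := (C[i]).2 with hv
    simp only [List.foldl_cons, List.foldl_nil, mimicList, List.append_nil, ← List.append_assoc]
    set out' := out ++ mimicList R (C.take i) with hout'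
    change wp N (whenever _ _) _ ((s'.setReg regP _).setReg regR _)
    simp only [Expr.eval, setReg_reg, setReg_mem, hr]
    norm_num
    simp only [hc1, hc2]
    set s₁ := (s'.setReg regP u).setReg regR v with hs₁
    have hp₁ : s₁.reg regP = u := by simp [hs₁, setReg_reg]
    have hr₁ : s₁.reg regR = v := by simp [hs₁, setReg_reg]
    have hT₁ : TabIs s₁ R' := hT
    have hO₁ : OutIs s₁ out' := hO.of_eq rfl rfl
    have htab : ∀ (w : Fin n) (r : ℕ), s₁.reg r = w →
        ((at' arrTab r).Holds s₁ ↔ (R' w).isSome) := by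
      intro w r hw
      simp only [Expr.Holds, at', Expr.eval, hw, hT₁ w]
      cases R' w <;> simp
    rw [wp_whenever_iff, htab v regR hr₁]
    constructor
    · intro h
      obtain ⟨b, hb⟩ := Option.isSome_iff_exists.1 h
      change wp N (.ite _ _ _) (wp N _ _) _
      rw [wp_ite_iff, htab u regP hp₁]
      constructor
      · intro h'
        obtain ⟨a, ha⟩ := Option.isSome_iff_exists.1 h'
        have hta := hT₁ u
        have htb := hT₁ v
        rw [ha] at hta
        rw [hb] at htb
        simp only [Option.elim_some] at hta htb
        change wp N emit _ ((s₁.setReg regU _).setReg regV _)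
        refine wp_conseq (wp_emit (u := a) (v := b) (out := out') ?_ ?_ ?_) ?_
        · exact hO₁.of_eq rfl rfl
        · simp [setReg_reg, at', Expr.eval, hp₁, hta]
        · simp [setReg_reg, setReg_mem, at', Expr.eval, hr₁, htb]
        intro s₂ ha₂ hO₂
        have hr₂ : s₂.reg regR = v := by
          rw [ha₂.reg regR rfl]
          simpa [setReg_reg] using hr₁
        change _ ∧ _
        refine ⟨?_, ?_⟩
        · have : mimicTable R' C[i] = Function.update R' v none := by
            unfold mimicTable
            rw [← hu, ← hv, ha, Option.some_or, ← ha, Function.update_eq_self]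
          rw [this]
          refine TabIs.update hT₁ v none fun j => ?_
          simp only [Expr.eval, hr₂, setMem_mem, true_and, ha₂.mem arrTab rfl, setReg_mem,
            Option.elim_none]
        · have : mimicStep R' C[i] = [(a, b)] := by
            unfold mimicStep
            rw [← hu, ← hv, ha, hb]
          rw [this]
          exact hO₂.of_eq rfl (by funext j; simp [setMem_mem])
      · intro h'
        have ha : R' u = none := by simpa using h'
        have htb := hT₁ v
        rw [hb] at htb
        simp only [Option.elim_some] at htb
        change _ ∧ _
        simp only [at', Expr.eval, setMem_reg, hp₁, hr₁, htb]
        refine ⟨?_, ?_⟩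
        · unfold mimicTable
          rw [← hu, ← hv, ha, Option.none_or, hb]
          refine TabIs.update (s := s₁.setMem arrTab u (b + 1)) (hT₁.update u (some b) fun j => ?_)
            v none fun j => ?_
          · simp [setMem_mem]
          · simp [setMem_mem]
        · have : mimicStep R' C[i] = [] := by
            unfold mimicStep
            rw [← hu, ← hv, ha]
          rw [this, List.append_nil]
          exact hO₁.of_eq rfl (by funext j; simp [setMem_mem])
    · intro h
      have hb : R' v = none := by simpa using h
      have h1 : mimicTable R' C[i] = R' := by
        unfold mimicTable
        rw [← hu, ← hv, hb, Option.or_none, Function.update_eq_self, ← hb, Function.update_eq_self]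
      have h2 : mimicStep R' C[i] = [] := by
        unfold mimicStep
        rw [← hu, ← hv, hb]
        cases R' u <;> rfl
      rw [h1, h2, List.append_nil]
      exact ⟨hT₁, hO₁⟩

/-- Join the parts in the table to the parts that they correspond to. -/
def joinLoop : Cmd :=
  forUpTo regX regN <| whenever (at' arrTab regX) <|
    .seq (.assign regU (.reg regX)) <|
    .seq (.assign regV (.sub (at' arrTab regX) (.lit 1))) emit

theorem joinList_eq_flatMap {V : Type*} [DecidableEq V] (R : V → Option V) {l : List V}
    (hl : l.Nodup) : joinList R l = l.flatMap (joinStep R) := by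
  induction l generalizing R with
  | nil => rfl
  | cons u l ih =>
    obtain ⟨h1, h2⟩ := List.nodup_cons.1 hl
    rw [joinList, List.flatMap_cons, ih _ h2]
    congr 1
    rw [List.flatMap_def, List.flatMap_def]
    congr 1
    refine List.map_congr_left fun w hw => ?_
    have : w ≠ u := fun h => h1 (h ▸ hw)
    simp [joinStep, this]

theorem wp_joinLoop (hN : n ≤ N) {s : State} {R : Fin n → Option (Fin n)}
    {out : List (Fin n × Fin n)} (hn : s.reg regN = n) (hR : TabIs s R) (hout : OutIs s out) :
    wp N joinLoop (fun s' => OutIs s' (out ++ joinList R (List.finRange n))) s := by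
  rw [joinList_eq_flatMap R (List.nodup_finRange n)]
  refine wp_conseq (wp_forUpTo (n := n)
    (fun i s' => OutIs s' (out ++ ((List.finRange n).take i).flatMap (joinStep R)))
    (by decide) rfl rfl hN hn (by simpa using hout) (fun _ _ _ h => h.of_eq rfl rfl) ?_) ?_
  · intro i s' hi hr _ ha hO
    have hT : s'.mem arrTab i = (R ⟨i, hi⟩).elim 0 fun k => (k : ℕ) + 1 := by
      rw [ha.mem arrTab rfl]
      exact hR ⟨i, hi⟩
    rw [wp_whenever_iff, take_succ_finRange hi, List.flatMap_append, ← List.append_assoc]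
    simp only [Expr.Holds, at', Expr.eval, hr, hT, List.flatMap_singleton]
    cases h : R ⟨i, hi⟩ with
    | none =>
      have hj : joinStep R ⟨i, hi⟩ = [] := by simp [joinStep, h]
      rw [hj]
      simpa using hO
    | some k =>
      have hj : joinStep R ⟨i, hi⟩ = [(⟨i, hi⟩, k)] := by simp [joinStep, h]
      rw [hj]
      rw [h] at hT
      refine ⟨fun _ => ?_, fun h => by simp at h⟩
      simp only [wp]
      refine wp_emit (u := ⟨i, hi⟩) (v := k) ?_ ?_ ?_
      · exact hO.of_eq rfl rfl
      · simp [setReg_reg, Expr.eval, hr]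
      · simp [setReg_reg, setReg_mem, Expr.eval, hr, hT]
  · intro s' _ h
    rwa [take_length_finRange] at h

/-- Absorb the class with label `regLC` through the map in `arrPhi`. -/
def absorb : Cmd := .seq setTable (.seq mimicLoop joinLoop)

theorem wp_absorb (hN : n ≤ N) {s : State} {l τ : ℕ} {f : Fin n → ℕ} {out : List (Fin n × Fin n)}
    (hs : Static G S W C comp s) (hl : s.reg regLC = l)
    (hψ : ∀ x, comp x = l → s.mem arrPhi x = ψ x)
    (hinj : ∀ x y, comp x = l → comp y = l → ψ x = ψ y → x = y)
    (hf : ∀ x : Fin n, s.mem arrDone x = f x) (hτN : τ ≤ N) (hτ : τ ≤ C.length)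
    (ht : s.reg regTime = τ) (hout : OutIs s out) :
    wp N absorb (fun s' => (∃ R : Fin n → Option (Fin n),
        (∀ u k, R u = some k ↔ comp k = l ∧ ψ k = u) ∧
        OutIs s' (out ++ absorbList R (C.take τ) (List.finRange n))) ∧
      ∀ x : Fin n, s'.mem arrDone x = if comp x = l then 1 else f x) s := by
  change wp N setTable (wp N mimicLoop (wp N joinLoop _)) s
  refine wp_conseq (wp_setTable hN hs hl hψ hinj hf) ?_
  rintro s₁ ha₁ ⟨⟨R, hR, hT⟩, hD⟩
  refine wp_conseq (wp_mimicLoop hτN hτ (hs.of_agree ha₁ rfl) ((ha₁.reg regTime rfl).trans ht) hT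
    (hout.of_eq (ha₁.reg 0 rfl) (ha₁.mem arrOut rfl))) ?_
  rintro s₂ ha₂ ⟨hT₂, hO₂⟩
  refine wp_conseq (wp_joinLoop hN ((hs.of_agree ha₁ rfl).of_agree ha₂ rfl).n_eq hT₂ hO₂) ?_
  intro s₃ ha₃ hO₃
  refine ⟨⟨R, fun u k => by rw [hR, mem_blockList], ?_⟩, fun x => ?_⟩
  · rw [absorbList, ← List.append_assoc]
    exact hO₃
  · rw [ha₃.mem arrDone rfl, ha₂.mem arrDone rfl]
    exact hD x

end AbsorbProgram

end RAM

/-! ### Reading the input and labelling the components -/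

namespace RAM

section Prepare

variable {n N : ℕ} {G : SimpleGraph (Fin n)} {S W : Finset (Fin n)} {C : List (Fin n × Fin n)}

theorem getD_flatMap_of_length {α : Type*} (l : List α) (f : α → List ℕ) (m : ℕ)
    (hf : ∀ a, (f a).length = m) (i j : ℕ) (hi : i < l.length) (hj : j < m) :
    (l.flatMap f).getD (i * m + j) 0 = (f l[i]).getD j 0 := by
  induction l generalizing i with
  | nil => simp at hi
  | cons a l ih =>
    rw [List.flatMap_cons]
    cases i with
    | zero =>
      rw [Nat.zero_mul, Nat.zero_add, List.getD_append _ _ _ _ (by rw [hf]; exact hj)]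
      rfl
    | succ i =>
      have : (i + 1) * m + j = (f a).length + (i * m + j) := by rw [hf]; ring
      rw [this, List.getD_append_right _ _ _ _ (by omega), Nat.add_sub_cancel_left]
      exact ih i (by simpa using hi)

theorem getD_encodeGraph (G : SimpleGraph (Fin n)) (x y : Fin n) :
    (encodeGraph G).getD (x * n + y) 0 ≠ 0 ↔ G.Adj x y := by
  classical
  unfold encodeGraph
  rw [getD_flatMap_of_length _ _ n (by simp) _ _ (by simp) y.2]
  simp only [List.getElem_finRange, Fin.cast_mk, Fin.eta]
  rw [List.getD_eq_getElem _ _ (by simp)]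
  simp

theorem getD_encodeSet (U : Finset (Fin n)) (x : Fin n) :
    (encodeSet U).getD x 0 ≠ 0 ↔ x ∈ U := by
  unfold encodeSet
  rw [List.getD_eq_getElem _ _ (by simp)]
  simp

theorem getD_encodeContractions (C : List (Fin n × Fin n)) (i : ℕ) (hi : i < C.length) :
    (encodeContractions C).getD (i + i) 0 = C[i].1 ∧
      (encodeContractions C).getD (i + i + 1) 0 = C[i].2 := by
  unfold encodeContractions
  have h0 := getD_flatMap_of_length C (fun c => [c.1.val, c.2.val]) 2 (by simp) i 0 hi (by simp)
  have h1 := getD_flatMap_of_length C (fun c => [c.1.val, c.2.val]) 2 (by simp) i 1 hi (by simp)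
  rw [show i * 2 + 0 = i + i by ring] at h0
  rw [show i * 2 + 1 = i + i + 1 by ring] at h1
  exact ⟨h0, h1⟩

theorem length_encodeContractions (C : List (Fin n × Fin n)) :
    (encodeContractions C).length = 2 * C.length := by
  unfold encodeContractions
  induction C with
  | nil => rfl
  | cons c C ih =>
    rw [List.flatMap_cons, List.length_append, ih, List.length_cons]
    simp only [List.length_cons, List.length_nil]
    ring

/-- Read `n`, compute the offsets of the rows of the adjacency matrix (by addition, as there is no
multiplication) and the number of contractions (half the length of their list, which is the number
of `i < n` with `2 * i` below that length), and give every vertex its own label. -/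
def prepare : Cmd :=
  .seq (.assign regN (.load arrOut (.lit 0))) <|
  .seq (.assign 0 (.lit 0)) <|
  .seq (.assign regN1 (.add (.reg regN) (.lit 1))) <|
  forUpTo regX regN <|
    .seq (.store arrRow (.reg regX) (.reg regQ)) <|
    .seq (.assign regQ (.add (.reg regQ) (.reg regN))) <|
    .seq (.store arrComp (.reg regX) (.reg regX)) <|
    .seq (.store arrPart (.reg regX) (.reg regX)) <|
    whenever (.lt (.add (.reg regX) (.reg regX)) (.reg 4))
      (.assign regM (.add (.reg regX) (.lit 1)))

theorem wp_prepare (hN : n ≤ N) (hC : C.length ≤ n) :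
    wp N prepare (fun s' => Static G S W C (fun x => (x : ℕ)) s' ∧ s'.reg regN1 = n + 1 ∧
      (∀ x : Fin n, s'.mem arrPart x = x) ∧ (∀ x : Fin n, s'.mem arrDone x = 0) ∧
      s'.reg 0 = 0) (State.init (encodeInput G S W C)) := by
  set s := State.init (encodeInput G S W C) with hs
  have h4 : s.reg 4 = 2 * C.length := length_encodeContractions C
  change wp N (forUpTo _ _ _) _ _
  have hn : s.mem arrOut 0 = n := rfl
  simp only [Expr.eval, hn, setReg_reg]
  norm_num
  set s₀ := ((s.setReg regN n).setReg 0 0).setReg regN1 (n + 1) with hs₀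
  refine wp_conseq (wp_forUpTo (n := n)
    (fun i s' => (∀ x : Fin n, (x : ℕ) < i → s'.mem arrRow x = x * n ∧ s'.mem arrComp x = x ∧
      s'.mem arrPart x = x) ∧ s'.reg regQ = i * n ∧ s'.reg regM = min i C.length)
    (by decide) rfl rfl hN (by simp [hs₀, setReg_reg]) ?_ ?_ ?_) ?_
  · refine ⟨by simp, ?_, ?_⟩
    · simp [hs₀, setReg_reg, hs, State.init, encodeInput]
    · simp [hs₀, setReg_reg, hs, State.init, encodeInput]
  · intro i s v h
    simpa [setReg_reg, setReg_mem] using h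
  · rintro i s' hi hr hn' ha ⟨h1, h2, h3⟩
    have h4' : s'.reg 4 = 2 * C.length := by
      rw [ha.reg 4 rfl]
      simpa [hs₀, setReg_reg] using h4
    simp only [wp]
    rw [wp_whenever_iff, Expr.holds_lt]
    simp only [wp, Expr.eval, setReg_reg, setReg_mem, setMem_reg, setMem_mem, hr, h4', h2, h3, hn']
    norm_num
    refine ⟨fun h5 => ⟨fun x hx => ?_, by ring, by omega⟩, fun h5 => ⟨fun x hx => ?_, by ring,
      by omega⟩⟩
    all_goals
      rcases Nat.lt_or_eq_of_le hx with hxi | hxi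
      · have hne : (x : ℕ) ≠ i := by omega
        simpa [hne] using h1 x hxi
      · simp [hxi]
  · rintro s' ha ⟨h1, -, h3⟩
    have m1 : s'.mem arrAdj = s.mem arrAdj := ha.mem arrAdj rfl
    have m2 : s'.mem arrS = s.mem arrS := ha.mem arrS rfl
    have m3 : s'.mem arrW = s.mem arrW := ha.mem arrW rfl
    have m4 : s'.mem arrC = s.mem arrC := ha.mem arrC rfl
    refine ⟨⟨?_, ?_, fun x y => ?_, fun x => ?_, fun x => ?_, fun i hi => ?_, fun x => ?_⟩, ?_,
      fun x => (h1 x x.2).2.2, fun x => ?_, ?_⟩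
    · rw [ha.reg regN rfl]
      simp [hs₀, setReg_reg]
    · rw [h3]
      omega
    · rw [m1, (h1 x x.2).1]
      exact getD_encodeGraph G x y
    · rw [m2]
      exact getD_encodeSet S x
    · rw [m3]
      exact getD_encodeSet W x
    · rw [m4]
      exact getD_encodeContractions C i hi
    · exact (h1 x x.2).2.1
    · rw [ha.reg regN1 rfl]
      simp [hs₀, setReg_reg]
    · rw [ha.mem arrDone rfl]
      simp [hs₀, setReg_mem, hs, State.init, encodeInput]
    · rw [ha.reg 0 rfl]
      simp [hs₀, setReg_reg]

/-- Give equal labels to the ends of each edge off `S`, and then the label `n`, which is above those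
of the components, to the vertices of `S`. -/
def labelComponents : Cmd :=
  .seq (forUpTo regX regN <| forUpTo regY regN <|
    whenever (.and (adjE (.reg regX) (.reg regY))
        (.and (.not (at' arrS regX)) (.not (at' arrS regY)))) <|
      .seq (.assign regU (at' arrComp regX)) <|
      .seq (.assign regV (at' arrComp regY)) <| relabel arrComp) <|
  forUpTo regX regN <| whenever (at' arrS regX) <| .store arrComp (.reg regX) (.reg regN)

/-- The graph `G` without the edges at `S`. -/
def edgesOff {V : Type*} (G : SimpleGraph V) (S : Finset V) : SimpleGraph V where
  Adj x y := G.Adj x y ∧ x ∉ S ∧ y ∉ S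
  symm := ⟨fun _ _ h => ⟨h.1.symm, h.2.2, h.2.1⟩⟩
  loopless := ⟨fun _ h => h.1.ne rfl⟩

theorem reachable_edgesOff_iff {V : Type*} {G : SimpleGraph V} {S : Finset V}
    (x y : ((S : Set V)ᶜ : Set V)) :
    (edgesOff G S).Reachable x y ↔ (G.induce ((S : Set V)ᶜ)).Reachable x y := by
  constructor
  · rintro ⟨w⟩
    have aux : ∀ u v : V, (edgesOff G S).Walk u v → ∀ (hu : u ∈ ((S : Set V)ᶜ : Set V))
        (hv : v ∈ ((S : Set V)ᶜ : Set V)), (G.induce ((S : Set V)ᶜ)).Reachable ⟨u, hu⟩ ⟨v, hv⟩ := by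
      intro u v w
      induction w with
      | nil => exact fun _ _ => SimpleGraph.Reachable.refl _
      | @cons u v w huv _ ih =>
        intro hu hw
        have hv : v ∈ ((S : Set V)ᶜ : Set V) := fun h => huv.2.2 (Finset.mem_coe.1 h)
        have hadj : (G.induce ((S : Set V)ᶜ)).Adj ⟨u, hu⟩ ⟨v, hv⟩ := huv.1
        exact hadj.reachable.trans (ih hv hw)
    exact aux x y w x.2 y.2
  · rintro ⟨w⟩
    induction w with
    | nil => exact SimpleGraph.Reachable.refl _
    | @cons u v w huv _ ih =>
      have hadj : (edgesOff G S).Adj u v :=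
        ⟨huv, fun h => u.2 (Finset.mem_coe.2 h), fun h => v.2 (Finset.mem_coe.2 h)⟩
      exact hadj.reachable.trans ih

/-- The labels are below `n`, equal labels occur only in one component, and the edges off `S` that
satisfy `P` have ends with equal labels. -/
structure PartialLabel (G : SimpleGraph (Fin n)) (S : Finset (Fin n)) (P : Fin n → Fin n → Prop)
    (f : Fin n → ℕ) : Prop where
  lt : ∀ x, f x < n
  reach : ∀ x y, f x = f y → (edgesOff G S).Reachable x y
  eq : ∀ x y, (edgesOff G S).Adj x y → P x y → f x = f y

theorem PartialLabel.relabel {P : Fin n → Fin n → Prop} {f : Fin n → ℕ}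
    (h : PartialLabel G S P f) {a b : Fin n} (hab : (edgesOff G S).Adj a b) :
    PartialLabel G S (fun x y => P x y ∨ (x = a ∧ y = b))
      (fun x => if f x = f b then f a else f x) := by
  refine ⟨fun x => ?_, fun x y hxy => ?_, fun x y hxy hP => ?_⟩
  · split_ifs
    · exact h.lt a
    · exact h.lt x
  · split_ifs at hxy with h1 h2 h2
    · exact h.reach x y (h1.trans h2.symm)
    · exact ((h.reach x b h1).trans hab.symm.reachable).trans (h.reach a y hxy)
    · exact ((h.reach x a hxy).trans hab.reachable).trans (h.reach b y h2.symm)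
    · exact h.reach x y hxy
  · rcases hP with hP | ⟨rfl, rfl⟩
    · simp only [h.eq x y hxy hP]
    · simp

theorem PartialLabel.mono {P P' : Fin n → Fin n → Prop} {f : Fin n → ℕ}
    (h : PartialLabel G S P f) (hP : ∀ x y, (edgesOff G S).Adj x y → P' x y → P x y) :
    PartialLabel G S P' f :=
  ⟨h.lt, h.reach, fun x y hxy hp => h.eq x y hxy (hP x y hxy hp)⟩

theorem Static.congr_comp {comp comp' : Fin n → ℕ} {s s' : State} (h : Static G S W C comp s)
    (hc : ∀ x : Fin n, s'.mem arrComp x = comp' x)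
    (hn : s'.reg regN = s.reg regN) (hm : s'.reg regM = s.reg regM)
    (h1 : s'.mem arrAdj = s.mem arrAdj) (h2 : s'.mem arrS = s.mem arrS)
    (h3 : s'.mem arrW = s.mem arrW) (h4 : s'.mem arrC = s.mem arrC)
    (h5 : s'.mem arrRow = s.mem arrRow) : Static G S W C comp' s' := by
  constructor
  · rw [hn]; exact h.n_eq
  · rw [hm]; exact h.m_eq
  · rw [h1, h5]; exact h.adj
  · rw [h2]; exact h.memS
  · rw [h3]; exact h.memW
  · rw [h4]; exact h.con
  · exact hc

theorem wp_labelComponents (hN : n ≤ N) {s : State}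
    (hs : Static G S W C (fun x => (x : ℕ)) s) :
    wp N labelComponents (fun s' => ∃ comp, Static G S W C comp s' ∧ IsComponentLabel G S comp ∧
      (∀ x ∈ S, comp x = n) ∧ ∀ x, x ∉ S → comp x < n) s := by
  change wp N (forUpTo _ _ _) (wp N _ _) _
  refine wp_conseq (wp_forUpTo (n := n)
    (fun i s' => ∃ f, PartialLabel G S (fun x _ => (x : ℕ) < i) f ∧
      ∀ x : Fin n, s'.mem arrComp x = f x)
    (by decide) rfl rfl hN hs.n_eq ?_ (fun _ _ _ h => h) ?_) ?_
  · refine ⟨fun x => x, ⟨fun x => x.2, fun x y hxy => ?_, fun x y _ h => by simp at h⟩, hs.comp⟩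
    rw [Fin.ext hxy]
  · rintro i s₁ hi hr hn₁ ha₁ ⟨f₁, hf₁, hm₁⟩
    refine wp_conseq (wp_forUpTo (n := n)
      (fun j s' => ∃ f, PartialLabel G S
          (fun x y => (x : ℕ) < i ∨ ((x : ℕ) = i ∧ (y : ℕ) < j)) f ∧
        ∀ x : Fin n, s'.mem arrComp x = f x)
      (by decide) rfl rfl hN hn₁ ?_ (fun _ _ _ h => h) ?_) ?_
    · exact ⟨f₁, hf₁.mono fun x y _ h => by simpa using h, hm₁⟩
    · rintro j s₂ hj hrj hn₂ ha₂ ⟨f, hf, hm⟩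
      have hst : Static G S W C f s₂ := hs.congr_comp hm
        (by rw [ha₂.reg regN rfl, ha₁.reg regN rfl])
        (by rw [ha₂.reg regM rfl, ha₁.reg regM rfl])
        (by rw [ha₂.mem arrAdj rfl, ha₁.mem arrAdj rfl])
        (by rw [ha₂.mem arrS rfl, ha₁.mem arrS rfl])
        (by rw [ha₂.mem arrW rfl, ha₁.mem arrW rfl])
        (by rw [ha₂.mem arrC rfl, ha₁.mem arrC rfl])
        (by rw [ha₂.mem arrRow rfl, ha₁.mem arrRow rfl])
      have hri : s₂.reg regX = i := (ha₂.reg regX rfl).trans hr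
      have htest : (Expr.and (adjE (.reg regX) (.reg regY))
          (.and (.not (at' arrS regX)) (.not (at' arrS regY)))).Holds s₂ ↔
          (edgesOff G S).Adj ⟨i, hi⟩ ⟨j, hj⟩ := by
        rw [Expr.holds_and, Expr.holds_and, Expr.holds_not, Expr.holds_not,
          hst.holds_adj (e := .reg regX) (f := .reg regY) (x := ⟨i, hi⟩) (y := ⟨j, hj⟩) hri hrj]
        refine and_congr Iff.rfl (and_congr (not_congr ?_) (not_congr ?_))
        · simp only [Expr.Holds, at', Expr.eval, hri]
          exact hst.memS ⟨i, hi⟩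
        · simp only [Expr.Holds, at', Expr.eval, hrj]
          exact hst.memS ⟨j, hj⟩
      have hP : ∀ x y : Fin n, ((x : ℕ) < i ∨ ((x : ℕ) = i ∧ (y : ℕ) < j + 1)) →
          ((x : ℕ) < i ∨ ((x : ℕ) = i ∧ (y : ℕ) < j)) ∨ (x = ⟨i, hi⟩ ∧ y = ⟨j, hj⟩) := by
        intro x y h
        simp only [Fin.ext_iff]
        omega
      rw [wp_whenever_iff, htest]
      constructor
      · intro hadj
        simp only [wp, Expr.eval, at', hri]
        have hfi := hm ⟨i, hi⟩
        have hfj := hm ⟨j, hj⟩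
        simp only at hfi hfj
        refine wp_conseq (wp_relabel hN (u := f ⟨i, hi⟩) (v := f ⟨j, hj⟩) (f := f) ?_ ?_ ?_ ?_) ?_
        · simpa [setReg_reg] using hn₂
        · simp [setReg_reg, hfi]
        · simp [setReg_reg, setReg_mem, hrj, hfj]
        · exact hm
        · intro s₃ _ h₃
          exact ⟨_, (hf.relabel hadj).mono fun x y _ h => hP x y h, h₃⟩
      · intro hadj
        refine ⟨f, hf.mono fun x y hxy h => ?_, hm⟩
        rcases hP x y h with h | ⟨rfl, rfl⟩
        · exact h
        · exact (hadj hxy).elim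
    · rintro s₂ - ⟨f, hf, hm⟩
      refine ⟨f, hf.mono fun x y _ h => ?_, hm⟩
      have := y.2
      omega
  · rintro s₁ ha₁ ⟨f, hf, hm⟩
    have hst : Static G S W C f s₁ := hs.congr_comp hm (ha₁.reg regN rfl) (ha₁.reg regM rfl)
      (ha₁.mem arrAdj rfl) (ha₁.mem arrS rfl) (ha₁.mem arrW rfl) (ha₁.mem arrC rfl)
      (ha₁.mem arrRow rfl)
    refine wp_conseq (wp_forUpTo (n := n)
      (fun i s' => ∀ x : Fin n, s'.mem arrComp x = if (x : ℕ) < i ∧ x ∈ S then n else f x)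
      (by decide) rfl rfl hN hst.n_eq (by simpa using hm) (fun _ _ _ h => h) ?_) ?_
    · intro i s₂ hi hr hn₂ ha₂ hI
      have hiS : (at' arrS regX).Holds s₂ ↔ (⟨i, hi⟩ : Fin n) ∈ S := by
        simp only [Expr.Holds, at', Expr.eval, hr]
        rw [ha₂.mem arrS rfl]
        exact hst.memS ⟨i, hi⟩
      have hx : ∀ x : Fin n, (x : ℕ) < i + 1 ↔ (x : ℕ) < i ∨ x = ⟨i, hi⟩ := by
        intro x
        simp only [Fin.ext_iff]
        omega
      have hx' : ∀ x : Fin n, (x : ℕ) = i ↔ x = ⟨i, hi⟩ := fun x => by simp only [Fin.ext_iff]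
      rw [wp_whenever_iff, hiS]
      constructor
      · intro h x
        simp only [Expr.eval, hr, hn₂, setMem_mem, true_and, hx, hx', hI]
        by_cases hxi : x = ⟨i, hi⟩
        · subst hxi
          simp [h]
        · simp [hxi]
      · intro h x
        simp only [hx, hI]
        by_cases hxi : x = ⟨i, hi⟩
        · subst hxi
          simp [h]
        · simp [hxi]
    · intro s₂ ha₂ hI
      refine ⟨fun x => if x ∈ S then n else f x, hst.congr_comp (fun x => ?_) (ha₂.reg regN rfl)
        (ha₂.reg regM rfl) (ha₂.mem arrAdj rfl) (ha₂.mem arrS rfl) (ha₂.mem arrW rfl)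
        (ha₂.mem arrC rfl) (ha₂.mem arrRow rfl), fun x y => ?_, fun x hx => if_pos hx,
        fun x hx => ?_⟩
      · simpa using hI x
      · have hxS : (x : Fin n) ∉ S := fun h => x.2 (Finset.mem_coe.2 h)
        have hyS : (y : Fin n) ∉ S := fun h => y.2 (Finset.mem_coe.2 h)
        simp only [hxS, hyS, if_false]
        rw [← reachable_edgesOff_iff]
        refine ⟨hf.reach x y, ?_⟩
        rintro ⟨w⟩
        have aux : ∀ u v : Fin n, (edgesOff G S).Walk u v → f u = f v := by
          intro u v w
          induction w with
          | nil => rfl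
          | @cons u v w huv _ ih => exact (hf.eq u v huv u.2).trans ih
        exact aux _ _ w
      · simp only [hx, if_false]
        exact hf.lt x

end Prepare

end RAM

/-! ### The main loop -/

namespace RAM

/-- Try to absorb the component of `regC` through the map with number `regCode`. -/
def attempt : Cmd :=
  whenever (.not (at' arrDone regC)) <| .seq decode <| .seq check <| whenever (.reg regOk) absorb

/-- Try all maps from the component of `regC` to the component of `regD`. -/
def tryTarget : Cmd :=
  .seq (.assign regL (at' arrComp regD)) <| .seq listBlock <|
    .seq (.assign regSizeD (.reg regCount)) <|
    whenever (.eq (.reg regSizeC) (.reg regSizeD)) <| forUpTo regCode regN attempt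

/-- Try all maps from the component of `regC`, unless it is in `W` or has been absorbed. -/
def tryComponent : Cmd :=
  whenever (.and (.not (at' arrW regC)) (.not (at' arrDone regC))) <|
    .seq (.assign regLC (at' arrComp regC)) <|
    .seq (.assign regL (.reg regLC)) <| .seq listBlock <|
    .seq (.assign regSizeC (.reg regCount)) <| forUpTo regD regN tryTarget

/-- Absorb all components that can be absorbed at the time `regTime`. -/
def absorbAll : Cmd := forUpTo regC regN tryComponent

/-- The contraction number `regTime` of the input. -/
def contractNext : Cmd :=
  .seq (.assign regU (.load arrC (.add (.reg regTime) (.reg regTime)))) <|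
  .seq (.assign regV (.load arrC (.add (.add (.reg regTime) (.reg regTime)) (.lit 1)))) <|
  .seq emit (relabel arrPart)

/-- Run through the contractions of the input, and absorb components at every time, the last one
included. -/
def mainLoop : Cmd :=
  .seq (forUpTo regTime regM (.seq absorbAll contractNext)) <|
  .seq (.assign regTime (.reg regM)) absorbAll

section Main

variable {n N : ℕ} {G : SimpleGraph (Fin n)} {S W : Finset (Fin n)} {C : List (Fin n × Fin n)}
  {comp : Fin n → ℕ} {t : ℕ}

/-- The standing assumptions on the input and on the labels of the components. By the last one, the
label of a component is not used in `S`. -/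
structure Setting (G : SimpleGraph (Fin n)) (S W : Finset (Fin n)) (C : List (Fin n × Fin n))
    (comp : Fin n → ℕ) (t : ℕ) : Prop where
  layout : Layout G S W comp
  steps : Steps G W t id C
  compS : ∀ x y, comp x = comp y → (x ∈ S ↔ y ∈ S)

/-- The labelling of the parts of `W` at the time `τ`. -/
def partsAt (C : List (Fin n × Fin n)) (τ : ℕ) : Fin n → Fin n := mergeAll id (C.take τ)

/-- The component of `x` can be absorbed at the time `τ`, through the map with number `code` to the
component of `d`. -/
def Succeeds (G : SimpleGraph (Fin n)) (S W : Finset (Fin n)) (C : List (Fin n × Fin n))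
    (comp : Fin n → ℕ) (x : Fin n) (τ : ℕ) (d : Fin n) (code : ℕ) : Prop :=
  (blockList comp (comp d)).length = (blockList comp (comp x)).length ∧
    Absorbable G S W comp (partsAt C τ) (block S comp (comp x))
      (decodeMap comp (blockList comp (comp d)) code)

/-- The invariant at the time `τ`, after the attempts in `T`. The red degrees are bounded only under
the condition that the components that are not absorbed yet are homogeneous: a component that is
absorbed later is homogeneous then, hence also now. -/
structure Progress (G : SimpleGraph (Fin n)) (S W : Finset (Fin n)) (C : List (Fin n × Fin n))
    (comp : Fin n → ℕ) (t τ : ℕ) (T : Fin n → ℕ → Fin n → ℕ → Prop) (φ : Fin n → Fin n)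
    (out : List (Fin n × Fin n)) : Prop where
  shadow : IsShadow G S W comp (partsAt C τ) φ
  block : ∀ x y, x ∉ W → y ∉ W → comp x = comp y → φ x = x → φ y = y
  steps : (∀ x, φ x ∉ W → Homogeneous G W (partsAt C τ) x) →
    Steps G Finset.univ (2 * t) id out ∧ mergeAll id out = partsAt C τ ∘ φ
  tried : ∀ x, x ∉ W → φ x = x → ∀ τ' d code, T x τ' d code → ¬ Succeeds G S W C comp x τ' d code

/-- The state `s` satisfies the invariant: `arrPart` holds the labelling at the time `τ`, and
`arrDone` marks the vertices off `W` that have been absorbed. -/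
structure Describes (G : SimpleGraph (Fin n)) (S W : Finset (Fin n)) (C : List (Fin n × Fin n))
    (comp : Fin n → ℕ) (t τ : ℕ) (T : Fin n → ℕ → Fin n → ℕ → Prop) (s : State) : Prop where
  static : Static G S W C comp s
  part : ∀ x : Fin n, s.mem arrPart x = partsAt C τ x
  ex : ∃ φ out, Progress G S W C comp t τ T φ out ∧ OutIs s out ∧
    ∀ x, x ∉ W → (s.mem arrDone x = 0 ↔ φ x = x)

theorem Describes.of_eq {τ : ℕ} {T : Fin n → ℕ → Fin n → ℕ → Prop} {s s' : State}
    (h : Describes G S W C comp t τ T s) (hs : Static G S W C comp s')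
    (h1 : s'.mem arrPart = s.mem arrPart) (h2 : s'.mem arrDone = s.mem arrDone)
    (h3 : s'.mem arrOut = s.mem arrOut) (h4 : s'.reg 0 = s.reg 0) :
    Describes G S W C comp t τ T s' := by
  obtain ⟨φ, out, hp, ho, hd⟩ := h.ex
  exact ⟨hs, by rw [h1]; exact h.part, φ, out, hp, ho.of_eq h4 h3, by rw [h2]; exact hd⟩

theorem Describes.setReg {τ : ℕ} {T : Fin n → ℕ → Fin n → ℕ → Prop} {s : State}
    (h : Describes G S W C comp t τ T s) {r v : ℕ} (h0 : 0 ≠ r) (h1 : regN ≠ r) (h2 : regM ≠ r) :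
    Describes G S W C comp t τ T (s.setReg r v) :=
  h.of_eq (h.static.of_eq (by rw [setReg_reg, if_neg h1]) (by rw [setReg_reg, if_neg h2])
    rfl rfl rfl rfl rfl rfl) rfl rfl rfl (by rw [setReg_reg, if_neg h0])

theorem Describes.of_agree {τ : ℕ} {T : Fin n → ℕ → Fin n → ℕ → Prop} {s s' : State} {c : Cmd}
    (h : Describes G S W C comp t τ T s) (ha : Agree c s s')
    (hc : (modReg c regN || modReg c regM || modMem c arrAdj || modMem c arrS || modMem c arrW ||
      modMem c arrC || modMem c arrRow || modMem c arrComp) = false)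
    (hc' : (modMem c arrPart || modMem c arrDone || modMem c arrOut || modReg c 0) = false) :
    Describes G S W C comp t τ T s' := by
  simp only [Bool.or_eq_false_iff] at hc'
  obtain ⟨⟨⟨h1, h2⟩, h3⟩, h4⟩ := hc'
  exact h.of_eq (h.static.of_agree ha (by simpa only [Bool.or_eq_false_iff] using hc))
    (ha.mem _ h1) (ha.mem _ h2) (ha.mem _ h3) (ha.reg _ h4)

theorem Describes.mono {τ : ℕ} {T T' : Fin n → ℕ → Fin n → ℕ → Prop} {s : State}
    (h : Describes G S W C comp t τ T s) (hT : ∀ x τ d code, T' x τ d code → T x τ d code) :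
    Describes G S W C comp t τ T' s := by
  obtain ⟨φ, out, hp, ho, hd⟩ := h.ex
  exact ⟨h.static, h.part, φ, out, ⟨hp.shadow, hp.block, hp.steps,
    fun x hx hφ τ d code hh => hp.tried x hx hφ τ d code (hT _ _ _ _ hh)⟩, ho, hd⟩

theorem Setting.steps_take (hS : Setting G S W C comp t) (τ : ℕ) :
    Steps G W t id (C.take τ) := by
  have := hS.steps
  rw [← List.take_append_drop τ C, steps_append] at this
  exact this.1

theorem Setting.labelling (hS : Setting G S W C comp t) (τ : ℕ) :
    IsLabelling W (partsAt C τ) :=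
  (IsLabelling.id W).mergeAll (hS.steps_take τ)

theorem Setting.thin (hS : Setting G S W C comp t) (τ : ℕ) : Thin G W t (partsAt C τ) :=
  (hS.steps_take τ).thin_mergeAll

theorem Setting.mem_block_iff (hS : Setting G S W C comp t) {c x : Fin n} (hc : c ∉ W) :
    x ∈ _root_.block S comp (comp c) ↔ comp x = comp c := by
  rw [mem_block]
  refine ⟨fun h => h.2, fun h => ⟨fun hx => hc (hS.layout.sub ((hS.compS x c h).1 hx)), h⟩⟩

theorem Setting.notMem_of_comp_eq (hS : Setting G S W C comp t) {c x : Fin n} (hc : c ∉ W)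
    (h : comp x = comp c) : x ∉ W := by
  have hcS : c ∉ S := fun h => hc (hS.layout.sub h)
  have hxS : x ∉ S := fun hx => hcS ((hS.compS x c h).1 hx)
  exact fun hx => hc ((hS.layout.mem x c hxS hcS h).1 hx)

/-- The invariant after the absorption of the component of `c`. -/
theorem Progress.absorb (hS : Setting G S W C comp t) {τ : ℕ}
    {T T' : Fin n → ℕ → Fin n → ℕ → Prop} {φ ψ : Fin n → Fin n} {out : List (Fin n × Fin n)}
    {c : Fin n} (h : Progress G S W C comp t τ T φ out) (hc : c ∉ W) (hφc : φ c = c)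
    (hψ : Absorbable G S W comp (partsAt C τ) (_root_.block S comp (comp c)) ψ)
    {R : Fin n → Option (Fin n)} (hR : ∀ u k, R u = some k ↔ comp k = comp c ∧ ψ k = u)
    (hT : ∀ x τ' d code, T' x τ' d code → x = c ∨ T x τ' d code) :
    Progress G S W C comp t τ T' (override (_root_.block S comp (comp c)) ψ φ)
      (out ++ absorbList R (C.take τ) (List.finRange n)) := by
  set K := _root_.block S comp (comp c) with hK
  have hKW : ∀ k ∈ K, k ∉ W := fun k hk => hS.notMem_of_comp_eq hc (mem_block.1 hk).2
  have hclosed : ∀ k ∈ K, ∀ y, y ∉ W → G.Adj k y → y ∈ K := by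
    intro k hk y hy hadj
    obtain ⟨hkS, hkc⟩ := mem_block.1 hk
    have hyS : y ∉ S := fun h => hy (hS.layout.sub h)
    exact mem_block.2 ⟨hyS, (hS.layout.adj k y hkS hyS hadj).symm.trans hkc⟩
  have hfix : ∀ k ∈ K, φ k = k := fun k hk =>
    h.block c k hc (hKW k hk) (mem_block.1 hk).2.symm hφc
  have hin : ∀ x ∈ K, override K ψ φ x = ψ x := fun x hx => if_pos hx
  have hout : ∀ x, x ∉ K → override K ψ φ x = φ x := fun x hx => if_neg hx
  have hmoved : ∀ x, x ∈ K → override K ψ φ x ≠ x := by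
    intro x hx h
    rw [hin x hx] at h
    exact hKW x hx (h ▸ (hψ.mem x hx).1)
  refine ⟨h.shadow.override hKW hclosed hψ, fun x y hx hy hxy hφx => ?_, fun hhom => ?_,
    fun x hx hφx τ' d code hT' => ?_⟩
  · have hxK : x ∉ K := fun hxK => hmoved x hxK hφx
    have hyK : y ∉ K := fun hyK => hxK ((hS.mem_block_iff hc).2
      (hxy.trans ((hS.mem_block_iff hc).1 hyK)))
    rw [hout x hxK] at hφx
    rw [hout y hyK]
    exact h.block x y hx hy hxy hφx
  · have hrest : ∀ x, φ x ∉ W → x ∉ K → Homogeneous G W (partsAt C τ) x := by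
      intro x hx hxK
      exact hhom x (by rw [hout x hxK]; exact hx)
    obtain ⟨h1, h2⟩ := h.steps fun x hx => by
      by_cases hxK : x ∈ K
      · exact hψ.homog x hxK
      · exact hrest x hx hxK
    have hca : CanAbsorb G S W comp t (partsAt C τ) φ K ψ :=
      ⟨hS.layout, hS.labelling τ, h.shadow, hKW, hfix, hclosed, hψ, hrest, hS.thin τ⟩
    obtain ⟨h3, h4⟩ := hca.steps_absorbList (R := R) (hS.steps_take τ) rfl
      (fun u k => by rw [hR, hK, hS.mem_block_iff hc]) (l := List.finRange n)
      (fun u => List.mem_finRange u)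
    rw [steps_append, mergeAll_append, h2]
    exact ⟨⟨h1, h3⟩, h4⟩
  · have hxK : x ∉ K := fun hxK => hmoved x hxK hφx
    rw [hout x hxK] at hφx
    rcases hT x τ' d code hT' with rfl | hT'
    · exact (hxK ((hS.mem_block_iff hc).2 rfl)).elim
    · exact h.tried x hx hφx τ' d code hT'

theorem wp_attempt (hN : n ≤ N) (hS : Setting G S W C comp t) {τ code : ℕ}
    {T T' : Fin n → ℕ → Fin n → ℕ → Prop} {s : State} {c d : Fin n}
    (h : Describes G S W C comp t τ T s) (hτN : τ ≤ N) (hτ : τ ≤ C.length) (hcode : code < n)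
    (hc : c ∉ W) (hrt : s.reg regTime = τ) (hrc : s.reg regC = c) (hrk : s.reg regCode = code)
    (hrl : s.reg regLC = comp c) (hra : s.reg regSizeC = (blockList comp (comp d)).length)
    (hL : ListIs s (blockList comp (comp d)))
    (hlen : (blockList comp (comp d)).length = (blockList comp (comp c)).length)
    (hT : ∀ x τ' d' code', T' x τ' d' code' →
      T x τ' d' code' ∨ (x = c ∧ τ' = τ ∧ d' = d ∧ code' = code)) :
    wp N attempt (Describes G S W C comp t τ T') s := by
  obtain ⟨φ, out, hp, ho, hd⟩ := h.ex
  have hdone : (at' arrDone regC).Holds s ↔ φ c ≠ c := by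
    simp only [Expr.Holds, at', Expr.eval, hrc]
    exact not_congr (hd c hc)
  -- an attempt without success may be recorded
  have hfail : (φ c = c → ¬ Succeeds G S W C comp c τ d code) →
      Progress G S W C comp t τ T' φ out := by
    intro hf
    refine ⟨hp.shadow, hp.block, hp.steps, fun x hx hφx τ' d' code' hT' => ?_⟩
    rcases hT _ _ _ _ hT' with h1 | ⟨rfl, rfl, rfl, rfl⟩
    · exact hp.tried x hx hφx _ _ _ h1
    · exact hf hφx
  rw [attempt, wp_whenever_iff, Expr.holds_not, hdone, not_not]
  constructor
  · intro hφc
    change wp N decode (wp N check (wp N (whenever _ _) _)) s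
    have hpos : 0 < (blockList comp (comp d)).length :=
      List.length_pos_of_mem (mem_blockList.2 rfl : d ∈ _)
    refine wp_conseq (wp_decode hN hcode hpos h.static hrl hrk hra hL) ?_
    intro s₁ ha₁ hphi
    have hst₁ : Static G S W C comp s₁ := h.static.of_agree ha₁ rfl
    refine wp_conseq (wp_check hN (π := partsAt C τ)
      (ψ := decodeMap comp (blockList comp (comp d)) code) hst₁ ((ha₁.reg regLC rfl).trans hrl) hphi
      (by rw [ha₁.mem arrPart rfl]; exact h.part)
      (fun x hx => (mem_block.1 ((hS.mem_block_iff hc).2 hx)).1)) ?_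
    intro s₂ ha₂ hok
    have hst₂ : Static G S W C comp s₂ := hst₁.of_agree ha₂ rfl
    have ho₂ : OutIs s₂ out := ho.of_eq ((ha₂.reg 0 rfl).trans (ha₁.reg 0 rfl))
      ((ha₂.mem arrOut rfl).trans (ha₁.mem arrOut rfl))
    have hd₂ : s₂.mem arrDone = s.mem arrDone := (ha₂.mem arrDone rfl).trans (ha₁.mem arrDone rfl)
    have hpart₂ : ∀ x : Fin n, s₂.mem arrPart x = partsAt C τ x := by
      rw [ha₂.mem arrPart rfl, ha₁.mem arrPart rfl]
      exact h.part
    rw [wp_whenever_iff]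
    have hok' : (Expr.reg regOk).Holds s₂ ↔ _ := hok
    rw [hok']
    constructor
    · intro habs
      have hinj : ∀ x y, comp x = comp c → comp y = comp c →
          decodeMap comp (blockList comp (comp d)) code x =
            decodeMap comp (blockList comp (comp d)) code y → x = y := fun x y hx hy =>
        habs.inj x ((hS.mem_block_iff hc).2 hx) y ((hS.mem_block_iff hc).2 hy)
      refine wp_conseq (wp_absorb hN hst₂
        (((ha₂.reg regLC rfl).trans (ha₁.reg regLC rfl)).trans hrl)
        (fun x hx => by rw [ha₂.mem arrPhi rfl]; exact hphi x hx) hinj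
        (f := fun x => s.mem arrDone x) (fun x => by rw [hd₂]) hτN hτ
        (((ha₂.reg regTime rfl).trans (ha₁.reg regTime rfl)).trans hrt) ho₂) ?_
      rintro s₃ ha₃ ⟨⟨R, hR, ho₃⟩, hd₃⟩
      refine ⟨hst₂.of_agree ha₃ rfl, by rw [ha₃.mem arrPart rfl]; exact hpart₂, _, _,
        hp.absorb hS hc hφc habs hR fun x τ' d' code' hT' => ?_, ho₃, fun x hx => ?_⟩
      · rcases hT _ _ _ _ hT' with h1 | h1
        · exact Or.inr h1
        · exact Or.inl h1.1
      · rw [hd₃]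
        by_cases hxc : comp x = comp c
        · have hxK := (hS.mem_block_iff (x := x) hc).2 hxc
          simp only [hxc, if_true, override, hxK]
          refine ⟨fun h => by simp at h, fun h1 => (hx ?_).elim⟩
          have := (habs.mem x hxK).1
          rwa [h1] at this
        · have hxK : x ∉ _root_.block S comp (comp c) := fun h =>
            hxc ((hS.mem_block_iff hc).1 h)
          simp only [hxc, if_false, override, hxK]
          exact hd x hx
    · intro habs
      exact ⟨hst₂, hpart₂, φ, out, hfail fun _ hsucc => habs hsucc.2, ho₂, by rw [hd₂]; exact hd⟩
  · intro hφc
    exact ⟨h.static, h.part, φ, out, hfail fun h1 => (hφc h1).elim, ho, hd⟩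

theorem wp_tryTarget (hN : n ≤ N) (hS : Setting G S W C comp t) {τ : ℕ}
    {T T' : Fin n → ℕ → Fin n → ℕ → Prop} {s : State} {c d : Fin n}
    (h : Describes G S W C comp t τ T s) (hτN : τ ≤ N) (hτ : τ ≤ C.length)
    (hc : c ∉ W) (hrt : s.reg regTime = τ) (hrc : s.reg regC = c) (hrd : s.reg regD = d)
    (hrl : s.reg regLC = comp c) (hra : s.reg regSizeC = (blockList comp (comp c)).length)
    (hT : ∀ x τ' d' code', T' x τ' d' code' →
      T x τ' d' code' ∨ (x = c ∧ τ' = τ ∧ d' = d ∧ code' < n)) :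
    wp N tryTarget (Describes G S W C comp t τ T') s := by
  change wp N listBlock (wp N (.seq _ _) _) _
  refine wp_conseq (wp_listBlock hN (l := comp d) (f := comp) ?_ ?_ h.static.comp) ?_
  · simpa [setReg_reg] using h.static.n_eq
  · simp only [at', Expr.eval, hrd, setReg_reg, if_true, h.static.comp]
  · rintro s₁ ha₁ ⟨hcount, hL⟩
    have h₁ : Describes G S W C comp t τ T s₁ :=
      (h.setReg (r := regL) (by decide) (by decide) (by decide)).of_agree ha₁ rfl rfl
    have hregs : ∀ r, r ≠ regL → modReg listBlock r = false → s₁.reg r = s.reg r := by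
      intro r hr hm
      rw [ha₁.reg r hm, setReg_reg, if_neg hr]
    change wp N (whenever _ _) _ _
    set s₂ := s₁.setReg regSizeD ((Expr.reg regCount).eval s₁) with hs₂
    have h₂ : Describes G S W C comp t τ T s₂ := h₁.setReg (by decide) (by decide) (by decide)
    have hregs₂ : ∀ r, r ≠ regSizeD → s₂.reg r = s₁.reg r := by
      intro r hr
      rw [hs₂, setReg_reg, if_neg hr]
    have htest : (Expr.eq (.reg regSizeC) (.reg regSizeD)).Holds s₂ ↔
        (blockList comp (comp d)).length = (blockList comp (comp c)).length := by
      rw [Expr.holds_eq]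
      simp only [Expr.eval]
      rw [hregs₂ regSizeC (by decide), hregs regSizeC (by decide) rfl, hra]
      have : s₂.reg regSizeD = (blockList comp (comp d)).length := by
        simp [hs₂, setReg_reg, Expr.eval, hcount]
      rw [this, eq_comm]
    rw [wp_whenever_iff, htest]
    constructor
    · intro hlen
      refine wp_conseq (wp_forUpTo (n := n)
        (fun k s' => Describes G S W C comp t τ
          (fun x τ' d' code' => T x τ' d' code' ∨ (x = c ∧ τ' = τ ∧ d' = d ∧ code' < k)) s')
        (by decide) rfl rfl hN h₂.static.n_eq ?_
        (fun _ _ _ h => h.setReg (by decide) (by decide) (by decide)) ?_) ?_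
      · exact h₂.mono fun x τ d code hh => by
          rcases hh with hh | ⟨-, -, -, hh⟩
          · exact hh
          · exact (Nat.not_lt_zero _ hh).elim
      · intro k s₃ hk hrk _ ha₃ hI
        refine wp_attempt hN hS (code := k) hI hτN hτ hk hc ?_ ?_ hrk ?_ ?_ ?_ hlen ?_
        · rw [ha₃.reg regTime rfl, hregs₂ _ (by decide), hregs _ (by decide) rfl, hrt]
        · rw [ha₃.reg regC rfl, hregs₂ _ (by decide), hregs _ (by decide) rfl, hrc]
        · rw [ha₃.reg regLC rfl, hregs₂ _ (by decide), hregs _ (by decide) rfl, hrl]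
        · rw [ha₃.reg regSizeC rfl, hregs₂ _ (by decide), hregs _ (by decide) rfl, hra, hlen]
        · intro j hj
          rw [ha₃.mem arrList rfl]
          exact hL j hj
        · rintro x τ' d' code' (h1 | ⟨h1, h2, h3, h4⟩)
          · exact Or.inl (Or.inl h1)
          · rcases Nat.lt_succ_iff_lt_or_eq.1 h4 with h5 | h5
            · exact Or.inl (Or.inr ⟨h1, h2, h3, h5⟩)
            · exact Or.inr ⟨h1, h2, h3, h5⟩
      · intro s₃ _ h₃
        exact h₃.mono hT
    · intro hlen
      obtain ⟨φ, out, hp, ho, hd⟩ := h₂.ex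
      refine ⟨h₂.static, h₂.part, φ, out, ⟨hp.shadow, hp.block, hp.steps, ?_⟩, ho, hd⟩
      intro x hx hφx τ' d' code' hT'
      rcases hT _ _ _ _ hT' with h1 | ⟨rfl, rfl, rfl, -⟩
      · exact hp.tried x hx hφx _ _ _ h1
      · exact fun hsucc => hlen hsucc.1

theorem wp_tryComponent (hN : n ≤ N) (hS : Setting G S W C comp t) {τ : ℕ}
    {T T' : Fin n → ℕ → Fin n → ℕ → Prop} {s : State} {c : Fin n}
    (h : Describes G S W C comp t τ T s) (hτN : τ ≤ N) (hτ : τ ≤ C.length)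
    (hrt : s.reg regTime = τ) (hrc : s.reg regC = c)
    (hT : ∀ x τ' d' code', T' x τ' d' code' →
      T x τ' d' code' ∨ (x = c ∧ τ' = τ ∧ code' < n)) :
    wp N tryComponent (Describes G S W C comp t τ T') s := by
  obtain ⟨φ, out, hp, ho, hd⟩ := h.ex
  have hW : (at' arrW regC).Holds s ↔ c ∈ W := by
    simp only [Expr.Holds, at', Expr.eval, hrc]
    exact h.static.memW c
  rw [tryComponent, wp_whenever_iff, Expr.holds_and, Expr.holds_not, Expr.holds_not, hW]
  constructor
  · rintro ⟨hc, -⟩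
    change wp N listBlock (wp N (.seq _ _) _) ((s.setReg regLC _).setReg regL _)
    have h₀ : Describes G S W C comp t τ T
        ((s.setReg regLC ((at' arrComp regC).eval s)).setReg regL
          ((Expr.reg regLC).eval (s.setReg regLC ((at' arrComp regC).eval s)))) :=
      (h.setReg (by decide) (by decide) (by decide)).setReg (by decide) (by decide) (by decide)
    have hl : (at' arrComp regC).eval s = comp c := by
      simp only [at', Expr.eval, hrc, h.static.comp]
    rw [hl] at h₀ ⊢
    refine wp_conseq (wp_listBlock hN (l := comp c) (f := comp) h₀.static.n_eq ?_
      h₀.static.comp) ?_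
    · simp [setReg_reg, Expr.eval]
    · rintro s₁ ha₁ ⟨hcount, -⟩
      have h₁ : Describes G S W C comp t τ T s₁ := h₀.of_agree ha₁ rfl rfl
      change wp N (forUpTo _ _ _) _ _
      set s₂ := s₁.setReg regSizeC ((Expr.reg regCount).eval s₁) with hs₂
      have h₂ : Describes G S W C comp t τ T s₂ := h₁.setReg (by decide) (by decide) (by decide)
      have hsize : s₂.reg regSizeC = (blockList comp (comp c)).length := by
        simp [hs₂, setReg_reg, Expr.eval, hcount]
      have hlab : s₂.reg regLC = comp c := by
        rw [hs₂, setReg_reg, if_neg (by decide), ha₁.reg regLC rfl]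
        simp [setReg_reg]
      have ht₂ : s₂.reg regTime = τ := by
        rw [hs₂, setReg_reg, if_neg (by decide), ha₁.reg regTime rfl]
        simpa [setReg_reg] using hrt
      have hc₂ : s₂.reg regC = c := by
        rw [hs₂, setReg_reg, if_neg (by decide), ha₁.reg regC rfl]
        simpa [setReg_reg] using hrc
      refine wp_conseq (wp_forUpTo (n := n)
        (fun k s' => Describes G S W C comp t τ
          (fun x τ' d' code' => T x τ' d' code' ∨ (x = c ∧ τ' = τ ∧ (d' : ℕ) < k ∧ code' < n)) s')
        (by decide) rfl rfl hN h₂.static.n_eq ?_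
        (fun _ _ _ h => h.setReg (by decide) (by decide) (by decide)) ?_) ?_
      · exact h₂.mono fun x τ d code hh => by
          rcases hh with hh | ⟨-, -, hh, -⟩
          · exact hh
          · exact (Nat.not_lt_zero _ hh).elim
      · intro k s₃ hk hrk _ ha₃ hI
        refine wp_tryTarget hN hS (d := ⟨k, hk⟩) hI hτN hτ hc ?_ ?_ hrk ?_ ?_ ?_
        · rw [ha₃.reg regTime rfl, ht₂]
        · rw [ha₃.reg regC rfl, hc₂]
        · rw [ha₃.reg regLC rfl, hlab]
        · rw [ha₃.reg regSizeC rfl, hsize]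
        · rintro x τ' d' code' (h1 | ⟨h1, h2, h3, h4⟩)
          · exact Or.inl (Or.inl h1)
          · rcases Nat.lt_succ_iff_lt_or_eq.1 h3 with h5 | h5
            · exact Or.inl (Or.inr ⟨h1, h2, h5, h4⟩)
            · exact Or.inr ⟨h1, h2, Fin.ext h5, h4⟩
      · intro s₃ _ h₃
        refine h₃.mono fun x τ' d' code' hT' => ?_
        rcases hT _ _ _ _ hT' with h1 | ⟨h1, h2, h3⟩
        · exact Or.inl h1
        · exact Or.inr ⟨h1, h2, d'.2, h3⟩
  · intro hnot
    refine ⟨h.static, h.part, φ, out, ⟨hp.shadow, hp.block, hp.steps, ?_⟩, ho, hd⟩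
    intro x hx hφx τ' d' code' hT'
    rcases hT _ _ _ _ hT' with h1 | ⟨rfl, rfl, -⟩
    · exact hp.tried x hx hφx _ _ _ h1
    · refine (hnot ⟨hx, ?_⟩).elim
      simp only [Expr.Holds, at', Expr.eval, hrc, (hd x hx).2 hφx]
      simp

theorem wp_absorbAll (hN : n ≤ N) (hS : Setting G S W C comp t) {τ : ℕ}
    {T T' : Fin n → ℕ → Fin n → ℕ → Prop} {s : State}
    (h : Describes G S W C comp t τ T s) (hτN : τ ≤ N) (hτ : τ ≤ C.length)
    (hrt : s.reg regTime = τ)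
    (hT : ∀ x τ' d' code', T' x τ' d' code' → T x τ' d' code' ∨ (τ' = τ ∧ code' < n)) :
    wp N absorbAll (Describes G S W C comp t τ T') s := by
  refine wp_conseq (wp_forUpTo (n := n)
    (fun k s' => Describes G S W C comp t τ
      (fun x τ' d' code' => T x τ' d' code' ∨ ((x : ℕ) < k ∧ τ' = τ ∧ code' < n)) s')
    (by decide) rfl rfl hN h.static.n_eq ?_
    (fun _ _ _ h => h.setReg (by decide) (by decide) (by decide)) ?_) ?_
  · exact h.mono fun x τ d code hh => by
      rcases hh with hh | ⟨hh, -⟩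
      · exact hh
      · exact (Nat.not_lt_zero _ hh).elim
  · intro k s₃ hk hrk _ ha₃ hI
    refine wp_tryComponent hN hS (c := ⟨k, hk⟩) hI hτN hτ ((ha₃.reg regTime rfl).trans hrt) hrk ?_
    rintro x τ' d' code' (h1 | ⟨h1, h2, h3⟩)
    · exact Or.inl (Or.inl h1)
    · rcases Nat.lt_succ_iff_lt_or_eq.1 h1 with h5 | h5
      · exact Or.inl (Or.inr ⟨h5, h2, h3⟩)
      · exact Or.inr ⟨Fin.ext h5, h2, h3⟩
  · intro s₃ _ h₃
    refine h₃.mono fun x τ' d' code' hT' => ?_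
    rcases hT _ _ _ _ hT' with h1 | ⟨h2, h3⟩
    · exact Or.inl h1
    · exact Or.inr ⟨x.2, h2, h3⟩

theorem partsAt_succ {τ : ℕ} (hτ : τ < C.length) :
    partsAt C (τ + 1) = merge (partsAt C τ) (C[τ]).1 (C[τ]).2 := by
  unfold partsAt
  rw [List.take_succ_eq_append_getElem hτ, mergeAll_append]
  rfl

/-- The quotient between two absorptions: `thin_override` with nothing being absorbed. -/
theorem Setting.thin_comp (hS : Setting G S W C comp t) {τ : ℕ} {φ : Fin n → Fin n}
    (hφ : IsShadow G S W comp (partsAt C τ) φ)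
    (hhom : ∀ x, φ x ∉ W → Homogeneous G W (partsAt C τ) x) :
    Thin G Finset.univ (2 * t) (partsAt C τ ∘ φ) := by
  have h := thin_override (K := ∅) (ψ := id) (θ := partsAt C τ) (ν := id) hS.layout
    (hS.labelling τ) hφ (by simp) (by simp)
    ⟨by simp, by simp, by simp, by simp, by simp, by simp⟩ (fun x hx _ => hhom x hx) (hS.thin τ)
    (hS.thin τ) (fun _ _ _ _ h => h) (by simp)
  convert h using 1
  funext x
  simp [override]

/-- The invariant after the next contraction of the input. -/
theorem Progress.succ (hS : Setting G S W C comp t) {τ : ℕ} {T : Fin n → ℕ → Fin n → ℕ → Prop}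
    {φ : Fin n → Fin n} {out : List (Fin n × Fin n)} (hτ : τ < C.length)
    (h : Progress G S W C comp t τ T φ out) :
    Progress G S W C comp t (τ + 1) T φ (out ++ [C[τ]]) := by
  have hsucc := partsAt_succ hτ
  have hmono : ∀ x y, partsAt C τ x = partsAt C τ y →
      partsAt C (τ + 1) x = partsAt C (τ + 1) y := by
    intro x y hxy
    simp only [hsucc, merge, hxy]
  have hshadow : IsShadow G S W comp (partsAt C (τ + 1)) φ := by
    refine ⟨h.shadow.fix, h.shadow.or, h.shadow.notMem, h.shadow.adjS, h.shadow.adj,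
      fun x hx hφx => ?_⟩
    obtain ⟨z, h1, h2, h3, h4⟩ := h.shadow.other x hx hφx
    exact ⟨z, h1, h2, h3, hmono _ _ h4⟩
  refine ⟨hshadow, h.block, fun hhom => ?_, h.tried⟩
  have hhom' : ∀ x, φ x ∉ W → Homogeneous G W (partsAt C τ) x := by
    intro x hx y hy
    refine (hhom x hx).iff hy ((hS.labelling τ).mem y hy) (hmono _ _ ?_)
    rw [(hS.labelling τ).idem]
  obtain ⟨h1, h2⟩ := h.steps hhom'
  have hvalid : Steps G W t (partsAt C τ) [C[τ]] := by
    have := hS.steps_take (τ + 1)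
    rw [List.take_succ_eq_append_getElem hτ, steps_append] at this
    exact this.2
  have himage : ∀ u ∈ W.image (partsAt C τ), u ∈ Finset.univ.image (partsAt C τ ∘ φ) := by
    intro u hu
    obtain ⟨x, hx, rfl⟩ := Finset.mem_image.1 hu
    refine Finset.mem_image.2 ⟨x, Finset.mem_univ _, ?_⟩
    simp only [Function.comp, h.shadow.fix x hx]
  obtain ⟨-, hu, hv, huv, -⟩ := hvalid
  have hmerge : merge (partsAt C τ ∘ φ) (C[τ]).1 (C[τ]).2 = partsAt C (τ + 1) ∘ φ := by
    rw [hsucc]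
    rfl
  rw [steps_append, mergeAll_append, h2]
  refine ⟨⟨h1, hS.thin_comp h.shadow hhom', himage _ hu, himage _ hv, huv, ?_⟩, hmerge⟩
  change Thin G Finset.univ (2 * t) (merge (partsAt C τ ∘ φ) (C[τ]).1 (C[τ]).2)
  rw [hmerge]
  exact hS.thin_comp hshadow hhom

theorem wp_contractNext (hN : n ≤ N) (hS : Setting G S W C comp t) {τ : ℕ}
    {T : Fin n → ℕ → Fin n → ℕ → Prop} {s : State} (h : Describes G S W C comp t τ T s)
    (hτ : τ < C.length) (hrt : s.reg regTime = τ) :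
    wp N contractNext (Describes G S W C comp t (τ + 1) T) s := by
  obtain ⟨φ, out, hp, ho, hd⟩ := h.ex
  obtain ⟨hc1, hc2⟩ := h.static.con τ hτ
  change wp N emit (wp N (relabel arrPart) _) _
  set s₁ := s.setReg regU ((Expr.load arrC (.add (.reg regTime) (.reg regTime))).eval s) with hs₁
  set s₂ := s₁.setReg regV ((Expr.load arrC (.add (.add (.reg regTime) (.reg regTime))
    (.lit 1))).eval s₁) with hs₂
  have hu : s₂.reg regU = (C[τ]).1 := by
    simp [hs₂, hs₁, setReg_reg, Expr.eval, hrt, hc1]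
  have hv : s₂.reg regV = (C[τ]).2 := by
    simp [hs₂, hs₁, setReg_reg, setReg_mem, Expr.eval, hrt, hc2]
  have hst₂ : Static G S W C comp s₂ := h.static.of_eq rfl rfl rfl rfl rfl rfl rfl rfl
  refine wp_conseq (wp_emit (out := out) ?_ hu hv) ?_
  · exact ho.of_eq rfl rfl
  · intro s₃ ha₃ ho₃
    have hst₃ : Static G S W C comp s₃ := hst₂.of_agree ha₃ rfl
    refine wp_conseq (wp_relabel hN (f := fun x => (partsAt C τ x : ℕ)) hst₃.n_eq
      ((ha₃.reg regU rfl).trans hu) ((ha₃.reg regV rfl).trans hv) ?_) ?_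
    · intro x
      rw [ha₃.mem arrPart rfl]
      exact h.part x
    · intro s₄ ha₄ hpart
      refine ⟨hst₃.of_agree ha₄ rfl, fun x => ?_, φ, _, hp.succ hS hτ,
        ho₃.of_eq (ha₄.reg 0 rfl) (ha₄.mem arrOut rfl), fun x hx => ?_⟩
      · rw [hpart, partsAt_succ hτ, merge]
        simp only [Fin.ext_iff]
        split_ifs <;> rfl
      · rw [ha₄.mem arrDone rfl, ha₃.mem arrDone rfl]
        exact hd x hx

theorem wp_mainLoop (hN : n ≤ N) (hCN : C.length ≤ N) (hS : Setting G S W C comp t) {s : State}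
    (hs : Static G S W C comp s) (hpart : ∀ x : Fin n, s.mem arrPart x = x)
    (hdone : ∀ x : Fin n, s.mem arrDone x = 0) (hout : s.reg 0 = 0) :
    wp N mainLoop (Describes G S W C comp t C.length
      (fun _ τ _ code => τ ≤ C.length ∧ code < n)) s := by
  have h0 : Describes G S W C comp t 0 (fun _ τ _ code => τ < 0 ∧ code < n) s := by
    refine ⟨hs, hpart, id, [], ⟨⟨fun _ _ => rfl, fun _ => Or.inl rfl, ?_, ?_, ?_, ?_⟩,
      fun _ _ _ _ _ _ => rfl, fun _ => ⟨?_, rfl⟩, ?_⟩, ?_, ?_⟩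
    · exact fun x hx hx' => (hx hx').elim
    · exact fun x hx hx' => (hx hx').elim
    · exact fun x hx hx' => (hx hx').elim
    · exact fun x hx hx' => (hx hx').elim
    · intro a F hF
      have : F = ∅ := by
        refine Finset.eq_empty_of_forall_notMem fun b hb => ?_
        obtain ⟨-, ⟨x, -, y, -, rfl, rfl, h1⟩, ⟨x', -, y', -, hx, hy, h2⟩⟩ := hF b hb
        simp only [id] at hx hy
        exact h2 (hx ▸ hy ▸ h1)
      simp [this]
    · intro x _ _ τ' d code h
      exact (Nat.not_lt_zero _ h.1).elim
    · simp [OutIs, State.output, hout, encodeContractions]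
    · intro x _
      simp [hdone]
  change wp N (forUpTo _ _ _) (wp N (.seq _ _) _) _
  refine wp_conseq (wp_forUpTo (n := C.length)
    (fun τ s' => Describes G S W C comp t τ (fun _ τ' _ code => τ' < τ ∧ code < n) s')
    (by decide) rfl rfl hCN hs.m_eq h0
    (fun _ _ _ h => h.setReg (by decide) (by decide) (by decide)) ?_) ?_
  · intro τ s₁ hτ hrt _ _ hI
    change wp N absorbAll (wp N contractNext _) _
    refine wp_conseq (wp_absorbAll hN hS
      (T' := fun _ τ' _ code => τ' < τ + 1 ∧ code < n) hI (hτ.le.trans hCN) hτ.le hrt ?_) ?_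
    · rintro x τ' d code ⟨h1, h2⟩
      rcases Nat.lt_succ_iff_lt_or_eq.1 h1 with h3 | h3
      · exact Or.inl ⟨h3, h2⟩
      · exact Or.inr ⟨h3, h2⟩
    · intro s₂ ha₂ h₂
      exact wp_contractNext hN hS h₂ hτ ((ha₂.reg regTime rfl).trans hrt)
  · intro s₁ ha₁ h₁
    change wp N absorbAll _ _
    refine wp_absorbAll hN hS (T := fun _ τ' _ code => τ' < C.length ∧ code < n) ?_ hCN le_rfl ?_ ?_
    · exact h₁.setReg (by decide) (by decide) (by decide)
    · simp only [setReg_reg, if_true, Expr.eval]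
      exact h₁.static.m_eq
    · rintro x τ' d code ⟨h1, h2⟩
      rcases Nat.lt_or_eq_of_le h1 with h3 | h3
      · exact Or.inl ⟨h3, h2⟩
      · exact Or.inr ⟨h3, h2⟩

end Main

end RAM

/-! ### The fallback, and the whole program -/

namespace RAM

/-- Output the contraction of the vertex `regX` into the first vertex that was visited; `regP` holds
the successor of the first vertex, or `0` if there is none yet. -/
def visit : Cmd :=
  .ite (.reg regP)
    (.seq (.assign regU (.sub (.reg regP) (.lit 1))) <| .seq (.assign regV (.reg regX)) emit)
    (.assign regP (.add (.reg regX) (.lit 1)))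

/-- Discard the output, and contract all vertices into one, in the order of their labels. -/
def fallback : Cmd :=
  .seq (.assign 0 (.lit 0)) <| .seq (.assign regP (.lit 0)) <|
    forUpTo regC regN1 <| forUpTo regX regN <|
      whenever (.eq (at' arrComp regX) (.reg regC)) visit

/-- Use the fallback if some component could not be absorbed. -/
def finish : Cmd :=
  .seq (.assign regFound (.lit 0)) <|
  .seq (forUpTo regX regN <|
    whenever (.and (.not (at' arrW regX)) (.not (at' arrDone regX))) (.assign regFound (.lit 1))) <|
  whenever (.reg regFound) fallback

/-- The algorithm. -/
def algorithm : Cmd := .seq prepare <| .seq labelComponents <| .seq mainLoop finish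

section Fallback

variable {n N : ℕ}

/-- The vertices in the order of their labels, which are at most `n`. -/
def labelOrder (f : Fin n → ℕ) : List (Fin n) := (List.range (n + 1)).flatMap (blockList f)

theorem mem_labelOrder {f : Fin n → ℕ} (hf : ∀ x, f x ≤ n) (x : Fin n) : x ∈ labelOrder f := by
  rw [labelOrder, List.mem_flatMap]
  exact ⟨f x, List.mem_range.2 (Nat.lt_succ_of_le (hf x)), mem_blockList.2 rfl⟩

theorem pairwise_labelOrder (f : Fin n → ℕ) :
    (labelOrder f).Pairwise fun x y => f x ≤ f y := by
  rw [labelOrder, List.pairwise_flatMap]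
  refine ⟨fun c _ => ?_, ?_⟩
  · refine List.pairwise_of_forall_mem_list fun x hx y hy => ?_
    rw [mem_blockList.1 hx, mem_blockList.1 hy]
  · refine List.Pairwise.imp ?_ List.pairwise_lt_range
    intro c d hcd x hx y hy
    rw [mem_blockList.1 hx, mem_blockList.1 hy]
    exact hcd.le

theorem nodup_blockList (f : Fin n → ℕ) (l : ℕ) : (blockList f l).Nodup :=
  (List.nodup_finRange n).filter _

theorem nodup_labelOrder (f : Fin n → ℕ) : (labelOrder f).Nodup := by
  rw [labelOrder, List.nodup_flatMap]
  refine ⟨fun c _ => nodup_blockList f c, List.Pairwise.imp ?_ List.pairwise_lt_range⟩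
  intro c d hcd x hx hy
  rw [mem_blockList] at hx hy
  omega

/-- The state in which the vertices of the list have been visited. -/
def Visited (s : State) (L : List (Fin n)) : Prop :=
  OutIs s (starList L) ∧ s.reg regP = L.head?.elim 0 fun b => (b : ℕ) + 1

theorem Visited.setReg {s : State} {L : List (Fin n)} (h : Visited s L) {r v : ℕ} (h0 : 0 ≠ r)
    (hr : regP ≠ r) : Visited (s.setReg r v) L :=
  ⟨h.1.of_eq (by rw [setReg_reg, if_neg h0]) rfl, by rw [setReg_reg, if_neg hr]; exact h.2⟩

theorem wp_visit {s : State} {L : List (Fin n)} {x : Fin n} (h : Visited s L)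
    (hx : s.reg regX = x) : wp N visit (fun s' => Visited s' (L ++ [x])) s := by
  obtain ⟨ho, hp⟩ := h
  rw [visit, wp_ite_iff]
  cases L with
  | nil =>
    have hp' : s.reg regP = 0 := hp
    refine ⟨fun h => (h (by simpa [Expr.eval] using hp')).elim, fun _ => ?_⟩
    refine ⟨ho.of_eq rfl rfl, ?_⟩
    simp [setReg_reg, Expr.eval, hx]
  | cons b L =>
    have hp' : s.reg regP = b + 1 := hp
    refine ⟨fun _ => ?_, fun h => (h (by simp [Expr.Holds, Expr.eval, hp'])).elim⟩
    change wp N emit (fun s' => Visited s' (b :: L ++ [x])) ((s.setReg regU _).setReg regV _)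
    refine wp_conseq (wp_emit (out := starList (b :: L)) (u := b) (v := x) ?_ ?_ ?_) ?_
    · exact ho.of_eq rfl rfl
    · simp [setReg_reg, Expr.eval, hp']
    · simp [setReg_reg, Expr.eval, hx]
    · intro s' ha ho'
      refine ⟨?_, ?_⟩
      · simpa [starList] using ho'
      · rw [ha.reg regP rfl]
        simp [setReg_reg, hp']

theorem wp_fallback (hN : n + 1 ≤ N) {f : Fin n → ℕ} {s : State} (hn : s.reg regN = n)
    (hn1 : s.reg regN1 = n + 1) (hf : ∀ x : Fin n, s.mem arrComp x = f x) :
    wp N fallback (fun s' => OutIs s' (starList (labelOrder f))) s := by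
  change wp N (forUpTo _ _ _) _ _
  refine wp_conseq (wp_forUpTo (n := n + 1)
    (fun c s' => Visited s' ((List.range c).flatMap (blockList f)))
    (by decide) rfl rfl hN ?_ ?_ (fun _ _ _ h => h.setReg (by decide) (by decide)) ?_) ?_
  · simpa [setReg_reg] using hn1
  · refine ⟨?_, ?_⟩
    · simp [OutIs, State.output, setReg_reg, Expr.eval, starList, encodeContractions]
    · simp [setReg_reg, Expr.eval]
  · intro c s₁ hc hrc _ ha₁ hI
    refine wp_conseq (wp_forUpTo (n := n)
      (fun i s' => Visited s' ((List.range c).flatMap (blockList f) ++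
        ((List.finRange n).take i).filter fun x => f x = c))
      (by decide) rfl rfl (by omega) ?_ ?_ (fun _ _ _ h => h.setReg (by decide) (by decide)) ?_) ?_
    · rw [ha₁.reg regN rfl]
      simpa [setReg_reg] using hn
    · simpa using hI
    · intro i s₂ hi hrx _ ha₂ hI₂
      have hx : s₂.mem arrComp i = f ⟨i, hi⟩ := by
        rw [ha₂.mem arrComp rfl, ha₁.mem arrComp rfl]
        exact hf ⟨i, hi⟩
      have hc₂ : s₂.reg regC = c := (ha₂.reg regC rfl).trans hrc
      rw [wp_whenever_iff, Expr.holds_eq, take_succ_finRange hi, List.filter_append]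
      simp only [at', Expr.eval, hrx, hx, hc₂]
      constructor
      · intro h
        have := wp_visit (N := N) (x := ⟨i, hi⟩) hI₂ hrx
        simpa [h] using this
      · intro h
        simpa [h] using hI₂
    · rintro s₂ - h
      rw [take_length_finRange] at h
      rw [List.range_succ, List.flatMap_append]
      simpa [blockList] using h
  · rintro s' - h
    exact h.1

theorem wp_finish (hN : n + 1 ≤ N) {G : SimpleGraph (Fin n)} {S W : Finset (Fin n)}
    {C : List (Fin n × Fin n)} {comp : Fin n → ℕ} {φ : Fin n → Fin n} {out : List (Fin n × Fin n)}
    {s : State} (hs : Static G S W C comp s) (hn1 : s.reg regN1 = n + 1) (ho : OutIs s out)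
    (hd : ∀ x, x ∉ W → (s.mem arrDone x = 0 ↔ φ x = x)) :
    wp N finish (fun s' => ((∀ x, x ∉ W → φ x ≠ x) ∧ OutIs s' out) ∨
      (∃ x, x ∉ W ∧ φ x = x) ∧ OutIs s' (starList (labelOrder comp))) s := by
  change wp N (forUpTo _ _ _) (wp N (whenever _ _) _) _
  refine wp_conseq (wp_forUpTo (n := n)
    (fun i s' => s'.reg regFound ≠ 0 ↔ ∃ x : Fin n, (x : ℕ) < i ∧ x ∉ W ∧ φ x = x)
    (by decide) rfl rfl (by omega) ?_ ?_ ?_ ?_) ?_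
  · simpa [setReg_reg] using hs.n_eq
  · simp [setReg_reg, Expr.eval]
  · intro i s' v h
    rw [setReg_reg, if_neg (by decide)]
    exact h
  · intro i s₁ hi hrx _ ha hI
    have hW : (at' arrW regX).Holds s₁ ↔ (⟨i, hi⟩ : Fin n) ∈ W := by
      simp only [Expr.Holds, at', Expr.eval, hrx]
      rw [ha.mem arrW rfl]
      exact hs.memW ⟨i, hi⟩
    have hD : (at' arrDone regX).Holds s₁ ↔ s.mem arrDone i ≠ 0 := by
      simp only [Expr.Holds, at', Expr.eval, hrx]
      rw [ha.mem arrDone rfl]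
      rfl
    rw [wp_whenever_iff, Expr.holds_and, Expr.holds_not, Expr.holds_not, hW, hD, not_not]
    constructor
    · rintro ⟨h1, h2⟩
      simp only [wp, setReg_reg, Expr.eval, if_true]
      exact ⟨fun _ => ⟨⟨i, hi⟩, Nat.lt_succ_self i, h1, (hd _ h1).1 h2⟩, fun _ => one_ne_zero⟩
    · intro h
      rw [hI]
      refine exists_congr fun x => ⟨fun h' => ⟨h'.1.trans (Nat.lt_succ_self i), h'.2⟩, fun h' => ?_⟩
      refine ⟨lt_of_le_of_ne (Nat.lt_succ_iff.1 h'.1) fun hxi => h ?_, h'.2⟩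
      have : x = ⟨i, hi⟩ := Fin.ext hxi
      subst this
      exact ⟨h'.2.1, (hd _ h'.2.1).2 h'.2.2⟩
  · intro s₁ ha h
    rw [wp_whenever_iff]
    have hfound : (Expr.reg regFound).Holds s₁ ↔ ∃ x, x ∉ W ∧ φ x = x := by
      change s₁.reg regFound ≠ 0 ↔ _
      rw [h]
      simp
    rw [hfound]
    constructor
    · intro hx
      refine wp_mono (wp_fallback hN (f := comp) ?_ ?_ ?_) fun s' h' => Or.inr ⟨hx, h'⟩
      · rw [ha.reg regN rfl]
        simpa [setReg_reg] using hs.n_eq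
      · rw [ha.reg regN1 rfl]
        simpa [setReg_reg] using hn1
      · rw [ha.mem arrComp rfl]
        exact hs.comp
    · intro hx
      refine Or.inl ⟨fun x hxW hφ => hx ⟨x, hxW, hφ⟩, ho.of_eq ?_ ?_⟩
      · rw [ha.reg 0 rfl]
        simp [setReg_reg]
      · rw [ha.mem arrOut rfl]
        rfl

end Fallback

section Correctness

variable {n : ℕ} {G : SimpleGraph (Fin n)} {S W : Finset (Fin n)} {C : List (Fin n × Fin n)}
  {comp : Fin n → ℕ} {t : ℕ}

theorem _root_.Absorbable.congr {V : Type*} {G : SimpleGraph V} {S W : Finset V} {comp : V → ℕ}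
    {π : V → V} {K : Finset V} {ψ ψ' : V → V} (h : Absorbable G S W comp π K ψ)
    (hψ : ∀ k ∈ K, ψ' k = ψ k) : Absorbable G S W comp π K ψ' := by
  refine ⟨fun k hk => ?_, fun k hk k' hk' => ?_, fun k hk k' hk' => ?_, fun k hk => ?_,
    fun k hk => ?_, h.homog⟩
  · rw [hψ k hk]
    exact h.mem k hk
  · rw [hψ k hk, hψ k' hk']
    exact h.adj k hk k' hk'
  · rw [hψ k hk, hψ k' hk']
    exact h.inj k hk k' hk'
  · rw [hψ k hk]
    exact h.adjS k hk
  · rw [hψ k hk]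
    exact h.other k hk

theorem length_blockList {c : ℕ} (hc : ∀ x, comp x = c → x ∉ S) :
    (blockList comp c).length = (_root_.block S comp c).card := by
  rw [← List.toFinset_card_of_nodup (nodup_blockList comp c)]
  congr 1
  ext x
  rw [List.mem_toFinset, mem_blockList, mem_block]
  exact ⟨fun h => ⟨hc x h, h⟩, fun h => h.2⟩

/-- The attempts of the algorithm suffice if `2 * t < p`. -/
theorem exists_succeeds {p : ℕ} (hS : Setting G S W C comp t) (hint : IntegrityWitness G S p)
    (hW : IsReducedVertexSet G S p W) (hcomp : IsComponentLabel G S comp)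
    (hfin : (W.image (mergeAll id C)).card = 1) (ht : 2 * t < p) {x : Fin n} (hx : x ∉ W) :
    ∃ τ ≤ C.length, ∃ d, ∃ code < n, Succeeds G S W C comp x τ d code := by
  obtain ⟨hsize, τ, hτ, d, hd, hdS, hcard, ψ, hψ, habs⟩ :=
    exists_absorbable hint hW hcomp hS.steps hfin ht hx
  have hxS : x ∉ S := fun h => hx (hS.layout.sub h)
  have hl : ∀ y, y ∉ S → (blockList comp (comp y)).length =
      (_root_.block S comp (comp y)).card := fun y hy =>
    length_blockList fun z hz hzS => hy ((hS.compS z y hz).1 hzS)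
  have hlen : (blockList comp (comp d)).length = (blockList comp (comp x)).length := by
    rw [hl d hdS, hl x hxS, hcard]
  obtain ⟨code, hcode, hdec⟩ := exists_decodeMap hlen
    (List.length_pos_of_mem (mem_blockList.2 rfl : x ∈ _)) (ψ := ψ)
    fun k hk => hψ k ((hS.mem_block_iff hx).2 hk)
  rw [hl x hxS] at hcode
  rw [Fintype.card_fin] at hsize
  exact ⟨τ, hτ, d, code, hcode.trans_le hsize, hlen,
    habs.congr fun k hk => hdec k ((hS.mem_block_iff hx).1 hk)⟩

end Correctness

end RAM

/-- Each contraction lowers the number of parts by one. -/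
theorem Steps.card_image {V : Type*} [DecidableEq V] {G : SimpleGraph V} {U : Finset V} {B : ℕ}
    {ρ : V → V} {C : List (V × V)} (h : Steps G U B ρ C) :
    C.length + (U.image (mergeAll ρ C)).card = (U.image ρ).card := by
  induction C generalizing ρ with
  | nil => simp [mergeAll]
  | cons c C ih =>
    obtain ⟨-, hu, hv, huv, h⟩ := h
    have h1 := ih h
    rw [image_merge hu huv, Finset.card_erase_of_mem hv] at h1
    have : 0 < (U.image ρ).card := Finset.card_pos.2 ⟨_, hv⟩
    rw [mergeAll_cons, List.length_cons]
    omega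

/-- One program and one polynomial serve all instances: a graph `G` on `n` vertices, a set `S` that
witnesses its vertex integrity, the vertex set `W` of a reduced graph `G' = G[W]`, and a contraction
sequence `C'` of `G'`. -/
theorem lemma5p3 :
    ∃ (P : RAM.Cmd) (q : Polynomial ℕ),
      ∀ (n : ℕ) (G : SimpleGraph (Fin n)) (S W : Finset (Fin n)) (C' : List (Fin n × Fin n))
        (t : ℕ),
        IntegrityWitness G S (vertexIntegrity G) →
        IsReducedVertexSet G S (vertexIntegrity G) W →
        (Trigraph.ofGraph G W).IsContractionSequence C' →
        (Trigraph.ofGraph G W).width C' = t →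
        ∃ C : List (Fin n × Fin n),
          (Trigraph.ofGraph G Finset.univ).IsContractionSequence C ∧
          (Trigraph.ofGraph G Finset.univ).width C ≤ 2 * t ∧
          RAM.ComputesWithin P (encodeInput G S W C') (encodeContractions C) (q.eval n) := by
  obtain ⟨q, hq⟩ := RAM.exists_polynomial_stepBound RAM.algorithm
  refine ⟨RAM.algorithm, q, fun n G S W C' t hint hred hseq hwidth => ?_⟩
  rw [ofGraph_eq_quotientTrigraph] at hseq hwidth
  obtain ⟨hsteps, hfin⟩ :=
    isContractionSequence_quotientTrigraph_iff.1 ⟨hseq, hwidth.le⟩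
  have hlen : C'.length ≤ n := by
    have h1 := hsteps.card_image
    have h2 := Finset.card_le_univ (W.image id)
    rw [Fintype.card_fin] at h2
    omega
  suffices h : RAM.wp (n + 1) RAM.algorithm (fun s => ∃ C, Steps G Finset.univ (2 * t) id C ∧
      (Finset.univ.image (mergeAll id C)).card = 1 ∧ RAM.OutIs s C)
      (RAM.State.init (encodeInput G S W C')) by
    obtain ⟨s, k, hexec, hk, C, h1, h2, h3⟩ := RAM.exists_exec_of_wp h
    obtain ⟨h4, h5⟩ := isContractionSequence_quotientTrigraph_iff.2 ⟨h1, h2⟩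
    rw [← ofGraph_eq_quotientTrigraph] at h4 h5
    exact ⟨C, h4, h5, s, k, hexec, hk.trans (hq n).le, h3⟩
  change RAM.wp _ RAM.prepare (RAM.wp _ RAM.labelComponents (RAM.wp _ RAM.mainLoop
    (RAM.wp _ RAM.finish _))) _
  refine RAM.wp_mono (RAM.wp_prepare (by omega) hlen) ?_
  rintro s₁ ⟨hs₁, hn1, hpart, hdone, hout⟩
  refine RAM.wp_conseq (RAM.wp_labelComponents (by omega) hs₁) ?_
  rintro s₂ ha₂ ⟨comp, hs₂, hcomp, hcS, hcN⟩
  have hS : RAM.Setting G S W C' comp t := by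
    refine ⟨hred.layout hcomp, hsteps, fun x y hxy => ⟨fun hx => ?_, fun hy => ?_⟩⟩
    · by_contra hy
      have := hcN y hy
      rw [← hxy, hcS x hx] at this
      exact this.false
    · by_contra hx
      have := hcN x hx
      rw [hxy, hcS y hy] at this
      exact this.false
  refine RAM.wp_conseq (RAM.wp_mainLoop (by omega) (by omega) hS hs₂
    (by rw [ha₂.mem arrPart rfl]; exact hpart) (by rw [ha₂.mem arrDone rfl]; exact hdone)
    ((ha₂.reg 0 rfl).trans hout)) ?_
  rintro s₃ ha₃ ⟨hs₃, -, φ, out, hp, ho, hd⟩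
  refine RAM.wp_mono (RAM.wp_finish le_rfl hs₃
    ((ha₃.reg regN1 rfl).trans ((ha₂.reg regN1 rfl).trans hn1)) ho hd) ?_
  rintro s₄ (⟨hall, ho₄⟩ | ⟨⟨x, hxW, hφx⟩, ho₄⟩)
  · -- everything has been absorbed
    have hφW : ∀ x, φ x ∈ W := by
      intro x
      by_cases hx : x ∈ W
      · rw [hp.shadow.fix x hx]
        exact hx
      · exact (hp.shadow.or x).resolve_left (hall x hx)
    obtain ⟨h1, h2⟩ := hp.steps fun x hx => (hx (hφW x)).elim
    refine ⟨out, h1, ?_, ho₄⟩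
    have himage : Finset.univ.image (mergeAll id out) = W.image (mergeAll id C') := by
      rw [h2, RAM.partsAt, List.take_length]
      ext y
      simp only [Finset.mem_image, Finset.mem_univ, true_and, Function.comp]
      exact ⟨fun ⟨x, hx⟩ => ⟨φ x, hφW x, hx⟩,
        fun ⟨x, hx, hxy⟩ => ⟨x, by rw [hp.shadow.fix x hx]; exact hxy⟩⟩
    rw [himage, hfin]
  · -- all attempts for the component of `x` have failed, which is impossible for small `t`
    have hpt : vertexIntegrity G ≤ 2 * t := by
      by_contra hlt
      obtain ⟨τ, hτ, d, code, hcode, hsucc⟩ :=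
        RAM.exists_succeeds hS hint hred hcomp hfin (not_le.1 hlt) hxW
      exact hp.tried x hxW hφx τ d code ⟨hτ, hcode⟩ hsucc
    have hcard : ∀ c, (block S comp c ∪ S).card ≤ 2 * t := fun c =>
      (hint.card_block_union_le hcomp c).trans hpt
    have hxS : x ∉ S := fun h => hxW (hred.1 h)
    have hle : ∀ y, comp y ≤ n := by
      intro y
      by_cases hy : y ∈ S
      · exact (hcS y hy).le
      · exact (hcN y hy).le
    obtain ⟨h1, h2⟩ := steps_starList (p := 2 * t)
      ((Finset.card_pos.2 ⟨x, Finset.mem_union_left _ (mem_block.2 ⟨hxS, rfl⟩)⟩ :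
        0 < (block S comp (comp x) ∪ S).card).trans_le (hcard _))
      hcS hcN (fun x y hx hy => hcomp.of_adj hx hy) hcard (RAM.nodup_labelOrder comp)
      (RAM.mem_labelOrder hle) (RAM.pairwise_labelOrder comp)
      (List.ne_nil_of_mem (RAM.mem_labelOrder hle x))
    exact ⟨_, h1, h2, ho₄⟩
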